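/- Fix an o-minimal structure over $\mathbb R$ (expanding the real field); all sets and maps below are definable in it (with parameters). The empty set counts as connected. **Definitions.** A *coordinate cone* in $\mathbb R^n$ is a set defined by finitely many conditions $x_j\,\sigma_j\,c_j$ with $\sigma_j\in\{<,=,>\}$, $c_j\in\mathbb R$, at most one for each coordinate $x_j$. An open bounded set $X\subset\mathbb R^n$ is *semi-monotone* if $X\cap C$ is connected for every coordinate cone $C$. A bounded upper semi-continuous function $f$ on a non-empty semi-monotone set $X$ is *submonotone* if $\{x\in X: f(x)<b\}$ is semi-monotone for every $b\in\mathbb R$, and *supermonotone* if $-f$ is submonotone. A function $f$ on $X$ is *monotone* if it is both sub- and supermonotone and, for each $j$, it is either strictly increasing in $x_j$, or strictly decreasing in $x_j$, or independent of $x_j$ on $X$ (comparing points of $X$ that differ only in the coordinate $x_j$). Let $f=(f_1,\dots,f_k):X\to\mathbb R^k$ be a continuous bounded map on a non-empty semi-monotone set $X\subset\mathbb R^n$, with graph $F=\{(x,f(x)) : x\in X\}\subset\mathbb R^{n+k}$, the coordinates of $\mathbb R^{n+k}$ being $x_1,\dots,x_n,y_1,\dots,y_k$. A *basis set* of $f$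 is a set of $n$ of these coordinates such that the projection of $F$ to them is injective. The map $f$ is *monotone* in the following cases, by induction on $n$. If $n=0$, always. If $n=1$, when every $f_i$ is a monotone function. If $n\ge 2$, when for all $i$, $j$ such that $f_i$ is not independent of $x_j$: for every $b\in\mathbb R$ with $F\cap\{y_i=b\}\ne\emptyset$, this set (considered in the space of all coordinates except $y_i$) is the graph of a monotone map $f_{i,j,b}$ from a semi-monotone subset of $\mathrm{span}\{x_l : l\ne j\}$ to $\mathrm{span}\{y_1,\dots,y_{i-1},x_j,y_{i+1},\dots,y_k\}$, and the system of basis sets of $f_{i,j,b}$ does not depend on $b$. For a graph $E$ write $\partial E=\overline E\setminus E$. **Theorem.** Let $n\ge1$, $k\ge0$, and let $F\subset\mathbb R^{n+k}$ be the graph of a monotone map $f:X\to\mathbb R^k$ on a non-empty semi-monotone set $X\subset\mathbb R^n$. Let $G\subset F$ be the graph of a monotone map $g$ with $\dim G=n-1$ (that is, $g$ is a monotone map from a non-empty semi-monotone subset of the span of some $n-1$ of the coordinates $x_1,\dots,x_n,y_1,\dots,y_k$ to the span of the remaining $k+1$), and suppose $\partial G\subset\partial F$. Then $F\setminus G$ is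 the disjoint union of the graphs of two monotone maps, $f_1:X_1\to\mathbb R^k$ and $f_2:X_2\to\mathbb R^k$, on non-empty semi-monotone sets $X_1,X_2\subset\mathbb R^n$. -/

import Mathlib

open Set

universe u v

/-- Definability with arbitrary real parameters. -/
def DefinableSet (L : FirstOrder.Language.{u, v}) [L.Structure ℝ] {α : Type} (s : Set (α → ℝ)) : Prop :=
  (Set.univ : Set ℝ).Definable L s

/-- `L` interprets an o-minimal structure over the real field `ℝ`: the graphs of addition and of
multiplication are definable (hence so are all algebraic sets, and the order), and every definable
subset of `ℝ` is a finite union of points and intervals (the order-connected subsets of `ℝ` are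
exactly the empty set, the points and the intervals, bounded or not). -/
structure IsOMinimalOverReals (L : FirstOrder.Language.{u, v}) [L.Structure ℝ] : Prop where
  definable_add : DefinableSet L {v : Fin 3 → ℝ | v 0 + v 1 = v 2}
  definable_mul : DefinableSet L {v : Fin 3 → ℝ | v 0 * v 1 = v 2}
  finite_union : ∀ s : Set ℝ, DefinableSet L {v : Fin 1 → ℝ | v 0 ∈ s} →
    ∃ 𝓘 : Set (Set ℝ), 𝓘.Finite ∧ (∀ I ∈ 𝓘, I.OrdConnected) ∧ ⋃₀ 𝓘 = s

/-- Coordinate cones: sets given by conditions `x j < c j`, `x j = c j` or `x j > c j`, at most one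
for each coordinate. -/
def IsCoordinateCone {n : ℕ} (C : Set (Fin n → ℝ)) : Prop :=
  ∃ (J : Finset (Fin n)) (σ : Fin n → Ordering) (c : Fin n → ℝ),
    C = {x | ∀ j ∈ J, (σ j).Compares (x j) (c j)}

/-- Semi-monotone sets. The empty set counts as connected, hence `IsPreconnected`. -/
structure IsSemiMonotone (L : FirstOrder.Language.{u, v}) [L.Structure ℝ] {n : ℕ} (X : Set (Fin n → ℝ)) :
    Prop where
  definable : DefinableSet L X
  isOpen : IsOpen X
  isBounded : Bornology.IsBounded X
  connected : ∀ C : Set (Fin n → ℝ), IsCoordinateCone C → IsPreconnected (X ∩ C)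

/-- The graph of the restriction to `X` of a map into `ℝ^k`. The coordinates `Sum.inl j` of the
ambient space are `x_j`, the coordinates `Sum.inr i` are `y_i`. -/
def mapGraph {n k : ℕ} (X : Set (Fin n → ℝ)) (f : (Fin n → ℝ) → (Fin k → ℝ)) :
    Set (Fin n ⊕ Fin k → ℝ) :=
  (fun x => Sum.elim x (f x)) '' X

/-- `f` is strictly increasing on `X` in the coordinate `x_j`. -/
def StrictlyIncreasingIn {n : ℕ} (X : Set (Fin n → ℝ)) (f : (Fin n → ℝ) → ℝ) (j : Fin n) : Prop :=
  ∀ x ∈ X, ∀ y ∈ X, (∀ l, l ≠ j → x l = y l) → x j < y j → f x < f y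

/-- `f` is strictly decreasing on `X` in the coordinate `x_j`. -/
def StrictlyDecreasingIn {n : ℕ} (X : Set (Fin n → ℝ)) (f : (Fin n → ℝ) → ℝ) (j : Fin n) : Prop :=
  ∀ x ∈ X, ∀ y ∈ X, (∀ l, l ≠ j → x l = y l) → x j < y j → f y < f x

/-- `f` is independent on `X` of the coordinate `x_j`. -/
def IndependentOf {n : ℕ} (X : Set (Fin n → ℝ)) (f : (Fin n → ℝ) → ℝ) (j : Fin n) : Prop :=
  ∀ x ∈ X, ∀ y ∈ X, (∀ l, l ≠ j → x l = y l) → f x = f y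

/-- Submonotone functions on a non-empty semi-monotone set. -/
structure IsSubmonotone (L : FirstOrder.Language.{u, v}) [L.Structure ℝ] {n : ℕ} (X : Set (Fin n → ℝ))
    (f : (Fin n → ℝ) → ℝ) : Prop where
  nonempty : X.Nonempty
  domain : IsSemiMonotone L X
  definable : DefinableSet L (mapGraph X (fun x (_ : Fin 1) => f x))
  bounded : Bornology.IsBounded (f '' X)
  upperSemicontinuous : UpperSemicontinuousOn f X
  sublevel : ∀ b : ℝ, IsSemiMonotone L {x ∈ X | f x < b}

/-- Monotone functions: both submonotone and supermonotone, and strictly increasing in, strictly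
decreasing in or independent of every coordinate. -/
structure IsMonotoneFunction (L : FirstOrder.Language.{u, v}) [L.Structure ℝ] {n : ℕ} (X : Set (Fin n → ℝ))
    (f : (Fin n → ℝ) → ℝ) : Prop where
  submonotone : IsSubmonotone L X f
  supermonotone : IsSubmonotone L X (fun x => - f x)
  trichotomy : ∀ j : Fin n,
    StrictlyIncreasingIn X f j ∨ StrictlyDecreasingIn X f j ∨ IndependentOf X f j

/-- The system of basis sets of a map `f` on `X ⊆ ℝ^n`: the sets of `n` of the coordinates
`x_1, …, x_n, y_1, …, y_k` such that the corresponding components of `x ↦ (x, f x)` form an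
injective map on `X`. -/
def basisSets {n k : ℕ} (X : Set (Fin n → ℝ)) (f : (Fin n → ℝ) → (Fin k → ℝ)) :
    Set (Finset (Fin n ⊕ Fin k)) :=
  {H | H.card = n ∧ Set.InjOn (fun x (h : H) => Sum.elim x (f x) h.1) X}

/-- The intersection `F ∩ {y_i = b}`, viewed in the space of all coordinates but `y_i`, where `x_j`
is removed from the source coordinates and takes the vacant place of `y_i` among the target
coordinates. -/
def levelSlice {n k : ℕ} (F : Set (Fin (n + 1) ⊕ Fin k → ℝ)) (i : Fin k) (j : Fin (n + 1))
    (b : ℝ) : Set (Fin n ⊕ Fin k → ℝ) :=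
  (fun z => Sum.elim (fun l => z (Sum.inl (j.succAbove l)))
    (Function.update (fun l => z (Sum.inr l)) i (z (Sum.inl j)))) '' {z ∈ F | z (Sum.inr i) = b}

/-- What every monotone map satisfies by convention: a definable, continuous and bounded map on a
non-empty semi-monotone set. -/
structure IsAdmissibleMap (L : FirstOrder.Language.{u, v}) [L.Structure ℝ] {n k : ℕ} (X : Set (Fin n → ℝ))
    (f : (Fin n → ℝ) → (Fin k → ℝ)) : Prop where
  nonempty : X.Nonempty
  domain : IsSemiMonotone L X
  definable : DefinableSet L (mapGraph X f)
  continuousOn : ContinuousOn f X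
  bounded : Bornology.IsBounded (f '' X)

/-- Monotone maps, by induction on the dimension of the domain. In dimension `0` every map on the
one-point space is monotone. In dimension at least `2` the set `m` is the common system of basis
sets of the maps whose graphs are the slices `F ∩ {y_i = b}`; it does not depend on `b`. -/
def IsMonotoneMap (L : FirstOrder.Language.{u, v}) [L.Structure ℝ] {k : ℕ} :
    (n : ℕ) → Set (Fin n → ℝ) → ((Fin n → ℝ) → (Fin k → ℝ)) → Prop
  | 0, X, f => IsAdmissibleMap L X f
  | 1, X, f => IsAdmissibleMap L X f ∧ ∀ i : Fin k, IsMonotoneFunction L X (fun x => f x i)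
  | n + 2, X, f => IsAdmissibleMap L X f ∧
      ∀ (i : Fin k) (j : Fin (n + 2)), ¬ IndependentOf X (fun x => f x i) j →
        ∃ m : Set (Finset (Fin (n + 1) ⊕ Fin k)),
          ∀ b : ℝ, (levelSlice (mapGraph X f) i j b).Nonempty →
            ∃ (Y : Set (Fin (n + 1) → ℝ)) (h : (Fin (n + 1) → ℝ) → (Fin k → ℝ)),
              mapGraph Y h = levelSlice (mapGraph X f) i j b ∧
              IsMonotoneMap L (n + 1) Y h ∧ basisSets Y h = m

/-- The boundary `∂E` of a graph `E`, in the sense of `closure E` minus `E` (for an open set this is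
the topological frontier). -/
def relBoundary {α : Type} (E : Set (α → ℝ)) : Set (α → ℝ) := closure E \ E

/-- `E` is the graph of a monotone map of `d` of the coordinates of the ambient space (an open
subset of whose span is the domain) into the span of the other `m` coordinates. The equivalence `e`
says which coordinates play which role. -/
def IsMonotoneGraph (L : FirstOrder.Language.{u, v}) [L.Structure ℝ] {α : Type} (d m : ℕ)
    (E : Set (α → ℝ)) : Prop :=
  ∃ (e : Fin d ⊕ Fin m ≃ α) (Y : Set (Fin d → ℝ)) (g : (Fin d → ℝ) → (Fin m → ℝ)),
    IsMonotoneMap L d Y g ∧ E = {z | z ∘ e ∈ mapGraph Y g}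

set_option linter.unusedSectionVars false

section MonotoneGraphs

open Filter Topology

/-! ### Connectedness through locally constant functions -/

section Connectedness

variable {X γ : Type*} [TopologicalSpace X]

/-! The graph `F` behaves like a manifold and `G` like a hypersurface in it, closed in `F` because
`∂G ⊆ ∂F`. Definability is set aside at first, and monotonicity is reduced to the combinatorial
notion `IsCell`: a slice of a cell by a non-constant coordinate is a cell of dimension one less, and
the small sets of coordinates that separate its points do not depend on the level. Induction over
slices then gives matroid-like facts. Separating coordinates, as many as the dimension, form a chart
(`IsCell.isChart`), and a basis `H` of `G` extends by one coordinate `w` to a basis of `F`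
(`IsCell.exists_separates_insert`). In this chart `F` is open and `G` is locally the graph of `w` as
a function of the coordinates in `H`; so `G` has locally two sides in `F`, above and below.

The local sides have to be matched globally. Sections of `F` by coordinate subspaces and strips are
connected, and this excludes monodromy: compatible local signs, each defined up to a flip, glue
(`exists_global_sign`). As `G` is connected, the result is a splitting of `F \ G` into two disjoint
relatively open sides, each accumulating at every point of `G` (`exists_isCut`).

Each side meets coordinate cones in connected sets (`IsCut.isPreconnected_cone`). For open
conditions, a locally constant function on a side extends across `G` to `F`, where it must be
constant; equalities are removed by slicing the whole cut. A side need not consist of points above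
`G`, since `F` may have points over whose `H`-coordinates there is no point of `G`. It is definable
nevertheless: its points are joined to points above `G` by a bounded number of connected sections of
`F` that avoid `G` (`IsCut.exists_definable_between`).

Finally, monotonicity passes to relatively open definable pieces of the graph with connected cone
sections (`IsMonotoneMap.restrict`), so both maps are restrictions of `f`. -/

/-- The target carries no topology, so that predicates such as membership in a relatively clopen
subset are admitted. -/
theorem IsPreconnected.eq_of_eventually_eq {s : Set X} (hs : IsPreconnected s) (f : X → γ)
    (h : ∀ x ∈ s, ∀ᶠ y in 𝓝[s] x, f y = f x) {x y : X} (hx : x ∈ s) (hy : y ∈ s) : f x = f y := by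
  have := isPreconnected_iff_preconnectedSpace.1 hs
  have hl : IsLocallyConstant (fun z : s => f z) := by
    rw [IsLocallyConstant.iff_eventually_eq]
    intro z
    exact (eventually_nhds_subtype_iff s z (fun w => f w = f z)).2 (h z z.2)
  exact hl.apply_eq_of_isPreconnected isPreconnected_univ (x := ⟨x, hx⟩) (y := ⟨y, hy⟩)
    trivial trivial

theorem isPreconnected_of_eventually_eq {s : Set X}
    (h : ∀ f : X → Bool, (∀ x ∈ s, ∀ᶠ y in 𝓝[s] x, f y = f x) → ∀ x ∈ s, ∀ y ∈ s, f x = f y) :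
    IsPreconnected s := by
  refine isPreconnected_of_forall_constant fun f hf => h f fun x hx => ?_
  have := hf x hx
  rw [ContinuousWithinAt, nhds_discrete, tendsto_pure] at this
  exact this

end Connectedness

/-! ### Coordinate charts and separating sets of coordinates -/

section Charts

variable {α : Type*} [Fintype α] [DecidableEq α]

/-- A point of `E` is determined by its coordinates in `T`. -/
def Separates (T : Finset α) (E : Set (α → ℝ)) : Prop :=
  ∀ x ∈ E, ∀ y ∈ E, (∀ a ∈ T, x a = y a) → x = y

/-- The slice of `E` by the hyperplane on which the coordinate `z` equals `c`. -/
def coordSlice (E : Set (α → ℝ)) (z : α) (c : ℝ) : Set (α → ℝ) := {x ∈ E | x z = c}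

/-- The coordinates in `S` map `E` homeomorphically onto an open subset of `ℝ^S`. -/
structure IsChart (E : Set (α → ℝ)) (S : Finset α) : Prop where
  separates : Separates S E
  lift : ∀ p ∈ E, ∀ ε > 0, ∃ δ > 0, ∀ h : α → ℝ, (∀ a ∈ S, |h a - p a| < δ) →
    ∃ q ∈ E, (∀ a ∈ S, q a = h a) ∧ dist q p < ε

/-- The coordinate `i` of a point of `E` changes with the coordinate `j ∈ S`. -/
def VariesWith (E : Set (α → ℝ)) (S : Finset α) (i j : α) : Prop :=
  ∃ p ∈ E, ∃ q ∈ E, (∀ a ∈ S, a ≠ j → p a = q a) ∧ p i ≠ q i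

theorem Separates.mono {T T' : Finset α} {E : Set (α → ℝ)} (h : Separates T E) (hT : T ⊆ T') :
    Separates T' E := fun x hx y hy hxy => h x hx y hy fun a ha => hxy a (hT ha)

theorem coordSlice_subset (E : Set (α → ℝ)) (z : α) (c : ℝ) : coordSlice E z c ⊆ E := fun _ h => h.1

theorem coordSlice_comm (E : Set (α → ℝ)) (z z' : α) (c c' : ℝ) :
    coordSlice (coordSlice E z c) z' c' = coordSlice (coordSlice E z' c') z c := by
  ext x; simp only [coordSlice, mem_ofPred_eq]; tauto

/-- The bridge between separating sets of `E` and of its slices, on which all inductions over the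
dimension rest. -/
theorem separates_insert_iff {T : Finset α} {E : Set (α → ℝ)} {z : α} :
    Separates (insert z T) E ↔ ∀ c, Separates T (coordSlice E z c) := by
  constructor
  · intro h c x hx y hy hxy
    refine h x hx.1 y hy.1 fun a ha => ?_
    rcases Finset.mem_insert.1 ha with rfl | ha
    · rw [hx.2, hy.2]
    · exact hxy a ha
  · intro h x hx y hy hxy
    exact h (x z) x ⟨hx, rfl⟩ y ⟨hy, (hxy z (by simp)).symm⟩
      fun a ha => hxy a (Finset.mem_insert_of_mem ha)

theorem Separates.erase_fiber {T : Finset α} {E : Set (α → ℝ)} (h : Separates T E) (z : α) (c : ℝ) :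
    Separates (T.erase z) (coordSlice E z c) := by
  have : Separates (insert z (T.erase z)) E := h.mono (Finset.insert_erase_subset z T)
  exact separates_insert_iff.1 this c

theorem abs_sub_le_dist (x y : α → ℝ) (a : α) : |x a - y a| ≤ dist x y := by
  rw [← Real.dist_eq]; exact dist_le_pi_dist x y a

theorem IsChart.fiber {E : Set (α → ℝ)} {S : Finset α} (h : IsChart E S) {j : α}
    (hj : j ∈ S) (c : ℝ) : IsChart (coordSlice E j c) (S.erase j) where
  separates := h.separates.erase_fiber j c
  lift p hp ε hε := by
    obtain ⟨δ, hδ, H⟩ := h.lift p hp.1 ε hε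
    refine ⟨δ, hδ, fun k hk => ?_⟩
    obtain ⟨q, hq, hqk, hqp⟩ := H (Function.update k j c) (by
      intro a ha
      by_cases haj : a = j
      · subst haj; simpa [hp.2] using hδ
      · simpa [haj] using hk a (Finset.mem_erase.2 ⟨haj, ha⟩))
    refine ⟨q, ⟨hq, by simpa using hqk j hj⟩, fun a ha => ?_, hqp⟩
    obtain ⟨haj, ha⟩ := Finset.mem_erase.1 ha
    simpa [haj] using hqk a ha

/-- Inside a chart one gets from a point to a nearby one by changing the coordinates in `S` one at a
time, and no such move changes `z`. So `z` is locally constant. -/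
theorem IsChart.eq_of_forall_not_variesWith {E : Set (α → ℝ)} {S : Finset α} (h : IsChart E S)
    (hE : IsPreconnected E) {z : α} (hz : ∀ j ∈ S, ¬ VariesWith E S z j) {p q : α → ℝ}
    (hp : p ∈ E) (hq : q ∈ E) : p z = q z := by
  refine hE.eq_of_eventually_eq (fun x => x z) (fun p hp => ?_) hp hq
  obtain ⟨δ, hδ, H⟩ := h.lift p hp 1 one_pos
  filter_upwards [inter_mem_nhdsWithin E (Metric.ball_mem_nhds p hδ)] with q hq
  -- The intermediate point `r` has the `S`-coordinates of `q` on `T` and those of `p` elsewhere.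
  have key : ∀ T : Finset α, T ⊆ S → ∃ r ∈ E, (∀ a ∈ S, r a = T.piecewise q p a) ∧ r z = p z := by
    intro T
    induction T using Finset.induction_on with
    | empty => exact fun _ => ⟨p, hp, by simp, rfl⟩
    | insert j T hj ih =>
      intro hT
      obtain ⟨r, hr, hrS, hrz⟩ := ih ((Finset.subset_insert _ _).trans hT)
      obtain ⟨r', hr', hrS', -⟩ := H ((insert j T).piecewise q p) (by
        intro a _
        by_cases ha : a ∈ insert j T
        · rw [Finset.piecewise_eq_of_mem _ _ _ ha]
          exact (abs_sub_le_dist q p a).trans_lt hq.2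
        · rw [Finset.piecewise_eq_of_notMem _ _ _ ha]; simpa using hδ)
      refine ⟨r', hr', hrS', ?_⟩
      by_contra hne
      refine hz j (hT (by simp)) ⟨r', hr', r, hr, fun a ha haj => ?_, by rwa [hrz]⟩
      rw [hrS a ha, hrS' a ha]
      simp [Finset.piecewise, haj]
  obtain ⟨r, hr, hrS, hrz⟩ := key S subset_rfl
  have : r = q := h.separates r hr q hq.1 fun a ha => by simp [hrS a ha, Finset.piecewise, ha]
  rw [← this, hrz]

/-- Moving a coordinate `j ∈ S` missing from `H` alone would give two points of `E` with the same
`H`-coordinates. -/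
theorem IsChart.subset_of_separates {E : Set (α → ℝ)} {S H : Finset α} (h : IsChart E S)
    (hne : E.Nonempty) (hH : Separates H E)
    (hc : ∀ i ∈ H, i ∉ S → ∀ p ∈ E, ∀ q ∈ E, p i = q i) : S ⊆ H := by
  intro j hj
  by_contra hjH
  obtain ⟨p, hp⟩ := hne
  obtain ⟨δ, hδ, H'⟩ := h.lift p hp 1 one_pos
  obtain ⟨q, hq, hqS, -⟩ := H' (Function.update p j (p j + δ / 2)) (by
    intro a _
    by_cases haj : a = j
    · subst haj; simp [abs_of_pos (half_pos hδ), hδ]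
    · simpa [haj] using hδ)
  have hqp : q = p := by
    refine hH q hq p hp fun a ha => ?_
    by_cases haS : a ∈ S
    · have : a ≠ j := fun h => hjH (h ▸ ha)
      simp [hqS a haS, this]
    · exact hc a ha haS q hq p hp
  have := hqS j hj
  simp only [hqp, Function.update_self] at this
  linarith

end Charts

/-! ### Cells and their slices -/

section Cells

variable {α : Type*} [Fintype α] [DecidableEq α]

/-- Connectedness is required only for conditions of the form `x a = c a` on source coordinates. For
cells, sections with strict inequalities and with conditions on target coordinates are recovered in
`IsCell.isPreconnected_slice`. -/
structure IsCellBase (n : ℕ) (E : Set (α → ℝ)) (S : Finset α) : Prop where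
  card : S.card = n
  nonempty : E.Nonempty
  chart : IsChart E S
  preconnected : ∀ T ⊆ S, ∀ c : α → ℝ, IsPreconnected {x ∈ E | ∀ a ∈ T, x a = c a}

/-- `E` is the graph of a monotone map whose source coordinates are those in `S`; the coordinates
outside of `S` are the target coordinates. Definability and boundedness are left out. -/
def IsCellOver : ℕ → Set (α → ℝ) → Finset α → Prop
  | 0, E, S => IsCellBase 0 E S
  | n + 1, E, S => IsCellBase (n + 1) E S ∧ ∀ i ∉ S, ∀ j ∈ S, VariesWith E S i j →
      (∀ b, (coordSlice E i b).Nonempty → IsCellOver n (coordSlice E i b) (S.erase j)) ∧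
      ∀ b b', (coordSlice E i b).Nonempty → ∀ H : Finset α, H.card ≤ n →
        Separates H (coordSlice E i b) → Separates H (coordSlice E i b')

/-- `E` is the graph of a monotone map with respect to some choice of source coordinates. -/
def IsCell (n : ℕ) (E : Set (α → ℝ)) : Prop := ∃ S, IsCellOver n E S

theorem IsCellOver.base {n : ℕ} {E : Set (α → ℝ)} {S : Finset α} (h : IsCellOver n E S) :
    IsCellBase n E S := by
  cases n with
  | zero => exact h
  | succ n => exact h.1

theorem IsCellBase.isPreconnected {n : ℕ} {E : Set (α → ℝ)} {S : Finset α} (h : IsCellBase n E S) :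
    IsPreconnected E := by
  simpa using h.preconnected ∅ (by simp) 0

theorem IsCellBase.fiber {n : ℕ} {E : Set (α → ℝ)} {S : Finset α} (h : IsCellBase (n + 1) E S)
    {j : α} (hj : j ∈ S) {c : ℝ} (hne : (coordSlice E j c).Nonempty) :
    IsCellBase n (coordSlice E j c) (S.erase j) where
  card := by rw [Finset.card_erase_of_mem hj, h.card]; rfl
  nonempty := hne
  chart := h.chart.fiber hj c
  preconnected T hT c' := by
    have hjT : j ∉ T := fun hjT => (Finset.mem_erase.1 (hT hjT)).1 rfl
    convert h.preconnected (insert j T) (Finset.insert_subset hj (hT.trans (Finset.erase_subset _ _)))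
      (Function.update c' j c) using 1
    ext x
    have : (∀ a ∈ T, x a = Function.update c' j c a) ↔ ∀ a ∈ T, x a = c' a := by
      refine forall₂_congr fun a ha => ?_
      rw [Function.update_of_ne (ne_of_mem_of_not_mem ha hjT)]
    simp only [coordSlice, mem_ofPred_eq, Finset.forall_mem_insert, Function.update_self, this,
      and_assoc]

/-- If a target coordinate in `H` varies, slicing by it lowers both the dimension and the
cardinality by one. Otherwise the target coordinates in `H` are constant and `S ⊆ H`. In particular,
a separating `H` with at most `n` elements, as in the definition of `IsCellOver`, has exactly `n` on
a non-empty slice. -/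
theorem IsCellOver.le_card {n : ℕ} {E : Set (α → ℝ)} {S : Finset α} (h : IsCellOver n E S)
    {H : Finset α} (hH : Separates H E) : n ≤ H.card := by
  induction n generalizing E S H with
  | zero => exact Nat.zero_le _
  | succ n ih =>
    by_cases hd : ∃ i ∈ H, i ∉ S ∧ ∃ j ∈ S, VariesWith E S i j
    · obtain ⟨i, hiH, hiS, j, hj, hij⟩ := hd
      obtain ⟨p, hp⟩ := h.base.nonempty
      have := ih ((h.2 i hiS j hj hij).1 (p i) ⟨p, hp, rfl⟩) (hH.erase_fiber i (p i))
      rw [Finset.card_erase_of_mem hiH] at this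
      have := Finset.card_pos.2 ⟨i, hiH⟩
      omega
    · push Not at hd
      rw [← h.base.card]
      refine Finset.card_le_card (h.base.chart.subset_of_separates h.base.nonempty hH ?_)
      exact fun i hi hiS p hp q hq =>
        h.base.chart.eq_of_forall_not_variesWith h.base.isPreconnected (hd i hi hiS) hp hq

theorem VariesWith.of_subset {E E' : Set (α → ℝ)} {S S' : Finset α} {i j : α}
    (h : VariesWith E' S' i j) (hE : E' ⊆ E)
    (hS : ∀ p ∈ E', ∀ q ∈ E', ∀ a ∈ S, a ∉ S' → p a = q a) : VariesWith E S i j := by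
  obtain ⟨p, hp, q, hq, hpq, hne⟩ := h
  refine ⟨p, hE hp, q, hE hq, fun a ha haj => ?_, hne⟩
  by_cases haS : a ∈ S'
  · exact hpq a haS haj
  · exact hS p hp q hq a ha haS

theorem VariesWith.of_fiber {E : Set (α → ℝ)} {S : Finset α} {i j l : α} {c : ℝ}
    (h : VariesWith (coordSlice E j c) (S.erase j) i l) : VariesWith E S i l := by
  refine h.of_subset (coordSlice_subset _ _ _) fun p hp q hq a ha haS => ?_
  have : a = j := by by_contra h; exact haS (Finset.mem_erase.2 ⟨h, ha⟩)
  rw [this, hp.2, hq.2]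

/-- The definition gives independence of the level only for target slices; this is the counterpart
for source slices. If some target coordinate `i ∈ H` varies on the slice, slice by `i` first, apply
induction there, and spread the result over all levels of `i`. Otherwise `H` contains `S.erase j`.
-/
theorem IsCellOver.separates_insert_source {n : ℕ} {E : Set (α → ℝ)} {S : Finset α}
    (h : IsCellOver (n + 1) E S) {j : α} (hj : j ∈ S) {c : ℝ} (hne : (coordSlice E j c).Nonempty)
    {H : Finset α} (hH : H.card ≤ n) (hs : Separates H (coordSlice E j c)) :
    Separates (insert j H) E := by
  induction n generalizing E S H with
  | zero =>
    have hS : S = {j} := (Finset.card_eq_one.1 h.base.card).elim fun a ha => by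
      subst ha; rw [Finset.mem_singleton.1 hj]
    exact h.base.chart.separates.mono (by simp [hS])
  | succ n ih =>
    by_cases hd : ∃ i ∈ H, i ∉ S ∧ ∃ l ∈ S.erase j, VariesWith (coordSlice E j c) (S.erase j) i l
    · obtain ⟨i, hiH, hiS, l, hl, hil⟩ := hd
      obtain ⟨hl', hl⟩ := Finset.mem_erase.1 hl
      obtain ⟨p, hp⟩ := hne
      obtain ⟨h1, h2⟩ := h.2 i hiS l hl hil.of_fiber
      have hpi : (coordSlice E i (p i)).Nonempty := ⟨p, hp.1, rfl⟩
      have hcard : (H.erase i).card ≤ n := by rw [Finset.card_erase_of_mem hiH]; omega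
      have h3 := ih (h1 (p i) hpi) (Finset.mem_erase.2 ⟨hl'.symm, hj⟩)
        ⟨p, ⟨hp.1, rfl⟩, hp.2⟩ hcard (by rw [coordSlice_comm]; exact hs.erase_fiber i (p i))
      have h4 : Separates (insert i (insert j (H.erase i))) E :=
        separates_insert_iff.2 fun b =>
          h2 (p i) b hpi _ ((Finset.card_insert_le _ _).trans (by omega)) h3
      rwa [Finset.insert_comm, Finset.insert_erase hiH] at h4
    · push Not at hd
      have hb := h.base.fiber hj hne
      have : S.erase j ⊆ H := hb.chart.subset_of_separates hne hs fun i hi hiS p hp q hq => by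
        by_cases hij : i = j
        · rw [hij, hp.2, hq.2]
        · exact hb.chart.eq_of_forall_not_variesWith hb.isPreconnected
            (hd i hi fun h => hiS (Finset.mem_erase.2 ⟨hij, h⟩)) hp hq
      exact h.base.chart.separates.mono (Finset.subset_insert_iff.2 this)

/-- Slices by `i` and by `j` commute. Level independence is transported by adding `j` to the
separating set, changing the level of `i` in `E`, and removing `j` again. -/
theorem IsCellOver.fiber_source {n : ℕ} {E : Set (α → ℝ)} {S : Finset α}
    (h : IsCellOver (n + 1) E S) {j : α} (hj : j ∈ S) {c : ℝ} (hne : (coordSlice E j c).Nonempty) :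
    IsCellOver n (coordSlice E j c) (S.erase j) := by
  induction n generalizing E S with
  | zero => exact h.base.fiber hj hne
  | succ n ih =>
    refine ⟨h.base.fiber hj hne, fun i hi l hl hil => ?_⟩
    have hij : i ≠ j := by
      rintro rfl
      obtain ⟨p, hp, q, hq, -, h⟩ := hil
      exact h (hp.2.trans hq.2.symm)
    have hiS : i ∉ S := fun h => hi (Finset.mem_erase.2 ⟨hij, h⟩)
    obtain ⟨hlj, hlS⟩ := Finset.mem_erase.1 hl
    obtain ⟨h1, h2⟩ := h.2 i hiS l hlS hil.of_fiber
    have hjl : j ∈ S.erase l := Finset.mem_erase.2 ⟨hlj.symm, hj⟩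
    constructor
    · intro b hb
      rw [coordSlice_comm] at hb ⊢
      rw [Finset.erase_right_comm]
      exact ih (h1 b (hb.mono (coordSlice_subset _ _ _))) hjl hb
    · intro b b' hb H hH hs
      rw [coordSlice_comm] at hb hs ⊢
      have hb1 := hb.mono (coordSlice_subset _ _ _)
      have h3 := (h1 b hb1).separates_insert_source hjl hb hH hs
      exact separates_insert_iff.1 (h2 b b' hb1 _ ((Finset.card_insert_le _ _).trans (by omega)) h3) c

/-- The coordinate `z`, as a function on `E`, is an open map. -/
def IsOpenCoord (E : Set (α → ℝ)) (z : α) : Prop :=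
  ∀ p ∈ E, ∀ ε > 0, ∃ δ > 0, ∀ t, |t - p z| < δ → ∃ q ∈ E, dist q p < ε ∧ q z = t

theorem IsChart.isOpenCoord {E : Set (α → ℝ)} {S : Finset α} (h : IsChart E S) {z : α}
    (hz : z ∈ S) : IsOpenCoord E z := by
  intro p hp ε hε
  obtain ⟨δ, hδ, H⟩ := h.lift p hp ε hε
  refine ⟨δ, hδ, fun t ht => ?_⟩
  obtain ⟨q, hq, hqS, hqp⟩ := H (Function.update p z t) (by
    intro a _
    by_cases haz : a = z
    · subst haz; simpa using ht
    · simpa [haz] using hδ)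
  exact ⟨q, hq, hqp, by simpa using hqS z hz⟩

/-- A continuous injective function on an interval is strictly monotone, and the intermediate value
theorem applies on it. -/
theorem exists_forall_abs_sub_lt_of_injOn {φ : ℝ → ℝ} {t r : ℝ} (hr : 0 < r)
    (hc : ContinuousOn φ (Icc (t - r) (t + r))) (hi : InjOn φ (Icc (t - r) (t + r))) :
    ∃ δ > 0, ∀ y, |y - φ t| < δ → ∃ x ∈ Icc (t - r) (t + r), φ x = y := by
  have hl : t - r ∈ Icc (t - r) (t + r) := ⟨le_rfl, by linarith⟩
  have ht : t ∈ Icc (t - r) (t + r) := ⟨by linarith, by linarith⟩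
  have hu : t + r ∈ Icc (t - r) (t + r) := ⟨by linarith, le_rfl⟩
  have hle : t - r ≤ t + r := by linarith
  rcases hc.strictMonoOn_of_injOn_Icc' hle hi with h | h
  · have h1 := h hl ht (by linarith)
    have h2 := h ht hu (by linarith)
    refine ⟨min (φ t - φ (t - r)) (φ (t + r) - φ t), by simp [h1, h2], fun y hy => ?_⟩
    obtain ⟨h3, h4⟩ := lt_min_iff.1 hy
    exact intermediate_value_Icc hle hc
      ⟨by linarith [neg_abs_le (y - φ t)], by linarith [le_abs_self (y - φ t)]⟩
  · have h1 := h hl ht (by linarith)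
    have h2 := h ht hu (by linarith)
    refine ⟨min (φ (t - r) - φ t) (φ t - φ (t + r)), by simp [h1, h2], fun y hy => ?_⟩
    obtain ⟨h3, h4⟩ := lt_min_iff.1 hy
    exact intermediate_value_Icc' hle hc
      ⟨by linarith [neg_abs_le (y - φ t)], by linarith [le_abs_self (y - φ t)]⟩

/-- Along the curve in `E` on which only `x_j` changes among the coordinates in `S`, the coordinate
`i` is continuous, and injective by `hs`; so it takes all values near `p i`. -/
theorem IsChart.isOpenCoord_of_separates {E : Set (α → ℝ)} {S : Finset α} (h : IsChart E S) {i j : α}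
    (hj : j ∈ S) (hs : ∀ b, Separates (S.erase j) (coordSlice E i b)) : IsOpenCoord E i := by
  intro p hp ε hε
  obtain ⟨δ, hδ, H⟩ := h.lift p hp ε hε
  have hlift : ∀ t, ∃ q, |t - p j| < δ → q ∈ E ∧ (∀ a ∈ S, q a = Function.update p j t a) ∧
      dist q p < ε := by
    intro t
    by_cases ht : |t - p j| < δ
    · obtain ⟨q, hq⟩ := H (Function.update p j t) (by
        intro a _
        by_cases haj : a = j
        · subst haj; simpa using ht
        · simpa [haj] using hδ)
      exact ⟨q, fun _ => hq⟩
    · exact ⟨p, fun h => absurd h ht⟩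
  choose γ hγ using hlift
  have hmem : ∀ t ∈ Icc (p j - δ / 2) (p j + δ / 2), |t - p j| < δ := fun t ht => by
    rw [abs_lt]; constructor <;> linarith [ht.1, ht.2]
  have hcont : ContinuousOn (fun t => γ t i) (Icc (p j - δ / 2) (p j + δ / 2)) := by
    rw [Metric.continuousOn_iff]
    intro t ht η hη
    obtain ⟨hq, hqS, hqp⟩ := hγ t (hmem t ht)
    obtain ⟨δ', hδ', H'⟩ := h.lift (γ t) hq η hη
    refine ⟨δ', hδ', fun s hs' hst => ?_⟩
    obtain ⟨hq', hqS', -⟩ := hγ s (hmem s hs')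
    obtain ⟨r, hr, hrS, hrd⟩ := H' (γ s) (by
      intro a ha
      rw [hqS' a ha, hqS a ha]
      by_cases haj : a = j
      · subst haj; simpa [Real.dist_eq] using hst
      · simpa [haj] using hδ')
    rw [h.separates r hr _ hq' hrS] at hrd
    exact (dist_le_pi_dist _ _ i).trans_lt hrd
  have hinj : InjOn (fun t => γ t i) (Icc (p j - δ / 2) (p j + δ / 2)) := by
    intro t ht s hs' hts
    obtain ⟨hq, hqS, -⟩ := hγ t (hmem t ht)
    obtain ⟨hq', hqS', -⟩ := hγ s (hmem s hs')
    have heq : γ t = γ s := by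
      refine hs (γ s i) _ ⟨hq, hts⟩ _ ⟨hq', rfl⟩ fun a ha => ?_
      obtain ⟨haj, ha⟩ := Finset.mem_erase.1 ha
      rw [hqS a ha, hqS' a ha]; simp [haj]
    have h1 := hqS j hj
    have h2 := hqS' j hj
    simp only [Function.update_self] at h1 h2
    rw [← h1, ← h2, heq]
  have hpj : γ (p j) = p := by
    obtain ⟨hq, hqS, -⟩ := hγ (p j) (by simpa using hδ)
    exact h.separates _ hq _ hp fun a ha => by simpa using hqS a ha
  obtain ⟨δ', hδ', H'⟩ := exists_forall_abs_sub_lt_of_injOn (half_pos hδ) hcont hinj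
  refine ⟨δ', hδ', fun t ht => ?_⟩
  obtain ⟨x, hx, hxt⟩ := H' t (by simpa only [hpj] using ht)
  obtain ⟨hq, -, hqp⟩ := hγ x (hmem x hx)
  exact ⟨_, hq, hqp, hxt⟩

/-- The coordinate `z` takes the same value at all points of `E`. -/
def IsConstCoord (E : Set (α → ℝ)) (z : α) : Prop := ∀ p ∈ E, ∀ q ∈ E, p z = q z

theorem IsCell.nonempty {n : ℕ} {E : Set (α → ℝ)} (h : IsCell n E) : E.Nonempty :=
  h.elim fun _ h => h.base.nonempty

theorem IsCell.isPreconnected {n : ℕ} {E : Set (α → ℝ)} (h : IsCell n E) : IsPreconnected E :=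
  h.elim fun _ h => h.base.isPreconnected

theorem IsCell.le_card {n : ℕ} {E : Set (α → ℝ)} (h : IsCell n E) {H : Finset α}
    (hH : Separates H E) : n ≤ H.card :=
  h.elim fun _ h => h.le_card hH

theorem IsCell.subsingleton {E : Set (α → ℝ)} (h : IsCell 0 E) : E.Subsingleton := by
  obtain ⟨S, h⟩ := h
  intro x hx y hy
  refine h.base.chart.separates x hx y hy ?_
  simp [Finset.card_eq_zero.1 h.base.card]

theorem IsCell.exists_not_isConstCoord {n : ℕ} {E : Set (α → ℝ)} (h : IsCell (n + 1) E)
    {H : Finset α} (hH : Separates H E) : ∃ z ∈ H, ¬ IsConstCoord E z := by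
  by_contra! hc
  have : Separates ∅ E := fun x hx y hy _ => hH x hx y hy fun a ha => hc a ha x hx y hy
  simpa using h.le_card this

theorem IsCellOver.exists_variesWith {n : ℕ} {E : Set (α → ℝ)} {S : Finset α}
    (h : IsCellOver n E S) {z : α} (hz : ¬ IsConstCoord E z) : ∃ j ∈ S, VariesWith E S z j := by
  by_contra! hc
  exact hz fun p hp q hq =>
    h.base.chart.eq_of_forall_not_variesWith h.base.isPreconnected hc hp hq

theorem IsCell.isOpenCoord {n : ℕ} {E : Set (α → ℝ)} (h : IsCell (n + 1) E) {z : α}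
    (hz : ¬ IsConstCoord E z) : IsOpenCoord E z := by
  obtain ⟨S, h⟩ := h
  by_cases hzS : z ∈ S
  · exact h.base.chart.isOpenCoord hzS
  · obtain ⟨j, hj, hd⟩ := h.exists_variesWith hz
    refine h.base.chart.isOpenCoord_of_separates hj fun b => ?_
    by_cases hne : (coordSlice E z b).Nonempty
    · exact ((h.2 z hzS j hj hd).1 b hne).base.chart.separates
    · intro x hx; exact absurd ⟨x, hx⟩ hne

/-- With `IsCell.separates_insert`, this makes source and target coordinates interchangeable: only
constancy of the coordinate matters from here on. -/
theorem IsCell.fiber {n : ℕ} {E : Set (α → ℝ)} (h : IsCell (n + 1) E) {z : α}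
    (hz : ¬ IsConstCoord E z) {c : ℝ} (hne : (coordSlice E z c).Nonempty) : IsCell n (coordSlice E z c) := by
  obtain ⟨S, h⟩ := h
  by_cases hzS : z ∈ S
  · exact ⟨_, h.fiber_source hzS hne⟩
  · obtain ⟨j, hj, hd⟩ := h.exists_variesWith hz
    exact ⟨_, (h.2 z hzS j hj hd).1 c hne⟩

theorem IsCell.separates_insert {n : ℕ} {E : Set (α → ℝ)} (h : IsCell (n + 1) E) {z : α}
    (hz : ¬ IsConstCoord E z) {c : ℝ} (hne : (coordSlice E z c).Nonempty) {H : Finset α}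
    (hH : H.card ≤ n) (hs : Separates H (coordSlice E z c)) : Separates (insert z H) E := by
  obtain ⟨S, h⟩ := h
  by_cases hzS : z ∈ S
  · exact h.separates_insert_source hzS hne hH hs
  · obtain ⟨j, hj, hd⟩ := h.exists_variesWith hz
    exact separates_insert_iff.2 fun b => (h.2 z hzS j hj hd).2 c b hne H hH hs

end Cells

/-! ### Connected sections of cells -/

section Boxes

variable {α : Type*} [Fintype α] [DecidableEq α]

/-- A locally constant function is constant on the connected fibres of `z`, so it descends to the
interval `z(U) ∩ K`; as `z` is open, the descended function is locally constant there. -/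
theorem isPreconnected_coord_mem {U : Set (α → ℝ)} (hU : IsPreconnected U) {z : α}
    (ho : IsOpenCoord U z) (hf : ∀ c, IsPreconnected (coordSlice U z c)) {K : Set ℝ}
    (hK : K.OrdConnected) : IsPreconnected {x ∈ U | x z ∈ K} := by
  classical
  refine isPreconnected_of_eventually_eq fun f hf' => ?_
  have hJ : IsPreconnected ((fun x : α → ℝ => x z) '' U ∩ K) := by
    have := (hU.image (fun x : α → ℝ => x z) (by fun_prop)).ordConnected
    exact (this.inter hK).isPreconnected
  have hg : ∃ g : ℝ → Bool, ∀ x ∈ U, x z ∈ K → g (x z) = f x := by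
    refine ⟨fun c => if h : ∃ x ∈ U, x z = c then f h.choose else true, fun x hx hxK => ?_⟩
    have h : ∃ y ∈ U, y z = x z := ⟨x, hx, rfl⟩
    simp only [h, dif_pos]
    refine (hf (x z)).eq_of_eventually_eq f (fun y hy => ?_) h.choose_spec ⟨hx, rfl⟩
    have hyK : y z ∈ K := by rw [hy.2]; exact hxK
    refine (hf' y ⟨hy.1, hyK⟩).filter_mono (nhdsWithin_mono _ ?_)
    rintro w ⟨hw, hwz⟩
    exact ⟨hw, by rw [hwz]; exact hxK⟩
  obtain ⟨g, hg⟩ := hg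
  rintro x ⟨hx, hxK⟩ y ⟨hy, hyK⟩
  rw [← hg x hx hxK, ← hg y hy hyK]
  refine hJ.eq_of_eventually_eq g ?_ ⟨⟨x, hx, rfl⟩, hxK⟩ ⟨⟨y, hy, rfl⟩, hyK⟩
  rintro _ ⟨⟨w, hw, rfl⟩, hwK⟩
  obtain ⟨ε, hε, h⟩ := Metric.mem_nhdsWithin_iff.1 (hf' w ⟨hw, hwK⟩)
  obtain ⟨δ, hδ, H⟩ := ho w hw ε hε
  refine Metric.mem_nhdsWithin_iff.2 ⟨δ, hδ, ?_⟩
  rintro t ⟨ht, ⟨-, htK⟩⟩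
  obtain ⟨q, hq, hqw, rfl⟩ := H t (by simpa [Real.dist_eq] using ht)
  have := h ⟨hqw, ⟨hq, htK⟩⟩
  simp only [mem_ofPred_eq] at this ⊢
  rw [hg q hq htK, hg w hw hwK, this]

theorem IsOpenCoord.inter {E D : Set (α → ℝ)} {z : α} (h : IsOpenCoord E z) (hD : IsOpen D) :
    IsOpenCoord (E ∩ D) z := by
  rintro p ⟨hp, hpD⟩ ε hε
  obtain ⟨ε', hε', hb⟩ := Metric.isOpen_iff.1 hD p hpD
  obtain ⟨δ, hδ, H⟩ := h p hp (min ε ε') (lt_min hε hε')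
  refine ⟨δ, hδ, fun t ht => ?_⟩
  obtain ⟨q, hq, hqp, hqt⟩ := H t ht
  exact ⟨q, ⟨hq, hb (hqp.trans_le (min_le_right _ _))⟩, hqp.trans_le (min_le_left _ _), hqt⟩

/-- The hypothesis `hf` stands for an induction hypothesis on slices, of dimension one less. It is
needed only if `z` is not constant; otherwise the condition on `z` is void or unsatisfiable. -/
theorem IsCell.isPreconnected_inter_coord_mem {n : ℕ} {E : Set (α → ℝ)} (h : IsCell n E)
    {D : Set (α → ℝ)} (hD : IsOpen D) (hED : IsPreconnected (E ∩ D)) (z : α)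
    (hf : ∀ m, m + 1 = n → ∀ c, IsCell m (coordSlice E z c) → IsPreconnected (coordSlice E z c ∩ D))
    {K : Set ℝ} (hK : K.OrdConnected) : IsPreconnected {x ∈ E ∩ D | x z ∈ K} := by
  by_cases hz : IsConstCoord E z
  · by_cases hne : ∃ p ∈ E, p z ∈ K
    · obtain ⟨p, hp, hpK⟩ := hne
      convert hED using 1
      refine subset_antisymm (fun x hx => hx.1) fun x hx => ⟨hx, ?_⟩
      rwa [hz x hx.1 p hp]
    · convert isPreconnected_empty using 1
      exact eq_empty_of_forall_notMem fun x hx => hne ⟨x, hx.1.1, hx.2⟩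
  · cases n with
    | zero => exact absurd (fun p hp q hq => by rw [h.subsingleton hp hq]) hz
    | succ n =>
      refine isPreconnected_coord_mem hED ((h.isOpenCoord hz).inter hD) (fun c => ?_) hK
      have he : coordSlice (E ∩ D) z c = coordSlice E z c ∩ D := by
        ext x; simp only [coordSlice, mem_inter_iff, mem_ofPred_eq]; tauto
      rw [he]
      by_cases hne : (coordSlice E z c).Nonempty
      · exact hf n rfl c (h.fiber hz hne)
      · rw [not_nonempty_iff_eq_empty.1 hne, empty_inter]; exact isPreconnected_empty

theorem isOpen_forall_mem {O : Finset α} {I : α → Set ℝ} (hI : ∀ a ∈ O, IsOpen (I a)) :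
    IsOpen {x : α → ℝ | ∀ a ∈ O, x a ∈ I a} := by
  have : {x : α → ℝ | ∀ a ∈ O, x a ∈ I a} = ⋂ a ∈ O, (fun x => x a) ⁻¹' I a := by ext; simp
  rw [this]
  exact isOpen_biInter_finset fun a ha => (hI a ha).preimage (continuous_apply a)

/-- Double induction, on the dimension and on the number of inequalities: each new inequality is
handled by fibering over its coordinate. -/
theorem IsCell.isPreconnected_inter_box {n : ℕ} {E : Set (α → ℝ)} (h : IsCell n E) (O : Finset α)
    {I : α → Set ℝ} (hI : ∀ a ∈ O, IsOpen (I a) ∧ (I a).OrdConnected) :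
    IsPreconnected (E ∩ {x | ∀ a ∈ O, x a ∈ I a}) := by
  induction n generalizing E O with
  | zero => exact (h.subsingleton.anti inter_subset_left).isPreconnected
  | succ n ih =>
    induction O using Finset.induction_on with
    | empty => simpa using h.isPreconnected
    | insert z O _ ihO =>
      have hI' : ∀ a ∈ O, IsOpen (I a) ∧ (I a).OrdConnected :=
        fun a ha => hI a (Finset.mem_insert_of_mem ha)
      convert h.isPreconnected_inter_coord_mem (isOpen_forall_mem fun a ha => (hI' a ha).1)
        (ihO hI') z (fun m hm c hc => ?_) (hI z (by simp)).2 using 1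
      · ext x; simp only [Finset.forall_mem_insert, mem_inter_iff, mem_ofPred_eq]; tauto
      · obtain rfl : m = n := by omega
        exact ih hc O hI'

/-- The dimension `m` is not determined by `T`: fixing a coordinate that is already constant changes
nothing. -/
theorem IsCell.exists_isCell_slice {n : ℕ} {E : Set (α → ℝ)} (h : IsCell n E) (T : Finset α)
    {p : α → ℝ} (hp : p ∈ E) : ∃ m, IsCell m {x ∈ E | ∀ a ∈ T, x a = p a} := by
  induction T using Finset.induction_on with
  | empty => exact ⟨n, by simpa using h⟩
  | insert z T _ ih =>
    obtain ⟨m, hm⟩ := ih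
    have he : {x ∈ E | ∀ a ∈ insert z T, x a = p a} =
        coordSlice {x ∈ E | ∀ a ∈ T, x a = p a} z (p z) := by
      ext x; simp only [coordSlice, Finset.forall_mem_insert, mem_ofPred_eq]; tauto
    have hpT : p ∈ {x ∈ E | ∀ a ∈ T, x a = p a} := ⟨hp, fun _ _ => rfl⟩
    rw [he]
    by_cases hz : IsConstCoord {x ∈ E | ∀ a ∈ T, x a = p a} z
    · refine ⟨m, ?_⟩
      convert hm
      exact subset_antisymm (coordSlice_subset _ _ _) fun x hx => ⟨hx, hz x hx p hpT⟩
    · cases m with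
      | zero => exact absurd (fun p hp q hq => by rw [hm.subsingleton hp hq]) hz
      | succ m => exact ⟨m, hm.fiber hz ⟨p, hpT, rfl⟩⟩

theorem IsCell.isPreconnected_slice {n : ℕ} {E : Set (α → ℝ)} (h : IsCell n E) (T O : Finset α)
    (c : α → ℝ) {I : α → Set ℝ} (hI : ∀ a ∈ O, IsOpen (I a) ∧ (I a).OrdConnected) :
    IsPreconnected {x ∈ E | (∀ a ∈ T, x a = c a) ∧ ∀ a ∈ O, x a ∈ I a} := by
  rcases eq_empty_or_nonempty {x ∈ E | (∀ a ∈ T, x a = c a) ∧ ∀ a ∈ O, x a ∈ I a} with he | ⟨p, hp⟩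
  · rw [he]; exact isPreconnected_empty
  obtain ⟨m, hm⟩ := h.exists_isCell_slice T hp.1
  convert hm.isPreconnected_inter_box O hI using 1
  ext x
  have : (∀ a ∈ T, x a = c a) ↔ ∀ a ∈ T, x a = p a :=
    forall₂_congr fun a ha => by rw [hp.2.1 a ha]
  simp only [this, mem_inter_iff, mem_ofPred_eq, and_assoc]

/-- For one coordinate the interval need not be open. Closed segments are what the links between
points require later. -/
theorem IsCell.isPreconnected_slice_interval {n : ℕ} {E : Set (α → ℝ)} (h : IsCell n E)
    (T : Finset α) (c : α → ℝ) (z : α) {K : Set ℝ} (hK : K.OrdConnected) :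
    IsPreconnected {x ∈ E | (∀ a ∈ T, x a = c a) ∧ x z ∈ K} := by
  rcases eq_empty_or_nonempty {x ∈ E | (∀ a ∈ T, x a = c a) ∧ x z ∈ K} with he | ⟨p, hp⟩
  · rw [he]; exact isPreconnected_empty
  obtain ⟨m, hm⟩ := h.exists_isCell_slice T hp.1
  convert hm.isPreconnected_inter_coord_mem isOpen_univ (by simpa using hm.isPreconnected) z
    (fun m _ c hc => by simpa using hc.isPreconnected) hK using 1
  ext x
  have : (∀ a ∈ T, x a = c a) ↔ ∀ a ∈ T, x a = p a :=
    forall₂_congr fun a ha => by rw [hp.2.1 a ha]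
  simp only [this, mem_inter_iff, mem_ofPred_eq, and_assoc, mem_univ, and_true]

end Boxes

/-! ### Bases, exchange and invariance of domain -/

section Bases

variable {α : Type*} [Fintype α] [DecidableEq α]

theorem IsCell.exists_separates {n : ℕ} {E : Set (α → ℝ)} (h : IsCell (n + 1) E) {z : α}
    (hz : ¬ IsConstCoord E z) : ∃ H : Finset α, H.card = n + 1 ∧ z ∈ H ∧ Separates H E := by
  obtain ⟨p, hp⟩ := h.nonempty
  have hne : (coordSlice E z (p z)).Nonempty := ⟨p, hp, rfl⟩
  obtain ⟨S, hS⟩ := h.fiber hz hne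
  have hs := h.separates_insert hz hne hS.base.card.le hS.base.chart.separates
  refine ⟨insert z S, le_antisymm ?_ (h.le_card hs), by simp, hs⟩
  exact (Finset.card_insert_le _ _).trans (by rw [hS.base.card])

theorem not_isConstCoord_mono {E E' : Set (α → ℝ)} (h : E' ⊆ E) {z : α}
    (hz : ¬ IsConstCoord E' z) : ¬ IsConstCoord E z :=
  fun hc => hz fun p hp q hq => hc p (h hp) q (h hq)

theorem coordSlice_mono {E E' : Set (α → ℝ)} (h : E' ⊆ E) (z : α) (c : ℝ) :
    coordSlice E' z c ⊆ coordSlice E z c := fun _ hx => ⟨h hx.1, hx.2⟩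

/-- Slice both cells by a coordinate of `H` not constant on `G`; by level independence a single
slice of `E` decides. -/
theorem IsCell.separates_of_subset {n : ℕ} {G E : Set (α → ℝ)} (hG : IsCell n G) (hE : IsCell n E)
    (hGE : G ⊆ E) {H : Finset α} (hH : H.card = n) (hs : Separates H G) : Separates H E := by
  induction n generalizing G E H with
  | zero => exact fun x hx y hy _ => hE.subsingleton hx hy
  | succ n ih =>
    obtain ⟨z, hzH, hz⟩ := hG.exists_not_isConstCoord hs
    have hzE := not_isConstCoord_mono hGE hz
    obtain ⟨p, hp⟩ := hG.nonempty
    have hcard : (H.erase z).card = n := by rw [Finset.card_erase_of_mem hzH, hH]; rfl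
    have := ih (hG.fiber hz ⟨p, hp, rfl⟩) (hE.fiber hzE ⟨p, hGE hp, rfl⟩) (coordSlice_mono hGE z (p z))
      hcard (hs.erase_fiber z _)
    have := hE.separates_insert hzE ⟨p, hGE hp, rfl⟩ hcard.le this
    rwa [Finset.insert_erase hzH] at this

/-- The exchange property. Slicing by elements of `H` leads down to a point in a curve, where one
coordinate `w` suffices; level independence then carries `w` back up. It is new to `H` because a
basis of `F` needs `n + 1` elements. -/
theorem IsCell.exists_separates_insert {n : ℕ} {G F : Set (α → ℝ)} (hG : IsCell n G)
    (hF : IsCell (n + 1) F) (hGF : G ⊆ F) {H : Finset α} (hH : H.card = n)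
    (hs : Separates H G) : ∃ w, w ∉ H ∧ Separates (insert w H) F := by
  have key : ∃ w, Separates (insert w H) F := by
    induction n generalizing G F H with
    | zero =>
      obtain ⟨S, hS⟩ := hF
      obtain ⟨w, hw⟩ := Finset.card_eq_one.1 hS.base.card
      refine ⟨w, ?_⟩
      rw [Finset.card_eq_zero.1 hH]
      simpa [hw] using hS.base.chart.separates
    | succ n ih =>
      obtain ⟨z, hzH, hz⟩ := hG.exists_not_isConstCoord hs
      have hzF := not_isConstCoord_mono hGF hz
      obtain ⟨p, hp⟩ := hG.nonempty
      have hcard : (H.erase z).card = n := by rw [Finset.card_erase_of_mem hzH, hH]; rfl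
      obtain ⟨w, hw⟩ := ih (hG.fiber hz ⟨p, hp, rfl⟩) (hF.fiber hzF ⟨p, hGF hp, rfl⟩)
        (coordSlice_mono hGF z (p z)) hcard (hs.erase_fiber z _)
      refine ⟨w, ?_⟩
      have := hF.separates_insert hzF ⟨p, hGF hp, rfl⟩
        ((Finset.card_insert_le _ _).trans (by rw [hcard])) hw
      rwa [Finset.insert_comm, Finset.insert_erase hzH] at this
  obtain ⟨w, hw⟩ := key
  refine ⟨w, fun hwH => ?_, hw⟩
  have := hF.le_card hw
  rw [Finset.insert_eq_of_mem hwH] at this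
  omega

/-- `A` is a relatively open subset of `E`. -/
def IsRelOpen (A E : Set (α → ℝ)) : Prop := ∀ p ∈ A, ∃ ε > 0, ∀ q ∈ E, dist q p < ε → q ∈ A

theorem IsRelOpen.fiber {A E : Set (α → ℝ)} (h : IsRelOpen A E) (z : α) (c : ℝ) :
    IsRelOpen (coordSlice A z c) (coordSlice E z c) := by
  rintro p ⟨hp, hpz⟩
  obtain ⟨ε, hε, H⟩ := h p hp
  exact ⟨ε, hε, fun q hq hqp => ⟨H q hq.1 hqp, hq.2⟩⟩

/-- If all coordinates in `H` were constant on `E`, a non-constant coordinate of `E`, being open,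
would give two points of `E'` not separated by `H`. So one can slice by an element of `H`. -/
theorem IsCell.separates_of_isRelOpen {n : ℕ} {E E' : Set (α → ℝ)} (hE : IsCell n E)
    (hE' : E' ⊆ E) (hne : E'.Nonempty) (ho : IsRelOpen E' E) {H : Finset α} (hH : H.card ≤ n)
    (hs : Separates H E') : Separates H E := by
  induction n generalizing E E' H with
  | zero => exact fun x hx y hy _ => hE.subsingleton hx hy
  | succ n ih =>
    obtain ⟨p, hp⟩ := hne
    have : ∃ z ∈ H, ¬ IsConstCoord E z := by
      by_contra! hc
      obtain ⟨S, hS⟩ := id hE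
      obtain ⟨z, hz⟩ := hE.exists_not_isConstCoord hS.base.chart.separates
      obtain ⟨ε, hε, hb⟩ := ho p hp
      obtain ⟨δ, hδ, ht⟩ := hE.isOpenCoord hz.2 p (hE' hp) ε hε
      obtain ⟨q, hq, hqp, hqz⟩ := ht (p z + δ / 2) (by simp [abs_of_pos (half_pos hδ), hδ])
      rw [hs q (hb q hq hqp) p hp fun a ha => hc a ha q hq p (hE' hp)] at hqz
      linarith
    obtain ⟨z, hzH, hz⟩ := this
    have hcard : (H.erase z).card ≤ n := by rw [Finset.card_erase_of_mem hzH]; omega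
    have hpE : (coordSlice E z (p z)).Nonempty := ⟨p, hE' hp, rfl⟩
    have := ih (hE.fiber hz hpE) (coordSlice_mono hE' z (p z)) ⟨p, hp, rfl⟩ (ho.fiber z _) hcard
      (hs.erase_fiber z _)
    have := hE.separates_insert hz hpE hcard this
    rwa [Finset.insert_erase hzH] at this

/-- A limit of points of `E` near `p` has the `S`-coordinates of some `q ∈ E`, and continuity of the
inverse chart at `q` identifies the limit with `q`. -/
theorem IsChart.exists_isCompact {E : Set (α → ℝ)} {S : Finset α} (h : IsChart E S) {p : α → ℝ}
    (hp : p ∈ E) {ε : ℝ} (hε : 0 < ε) :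
    ∃ r > 0, r < ε ∧ IsCompact (E ∩ Metric.closedBall p r) := by
  obtain ⟨δ, hδ, H⟩ := h.lift p hp 1 one_pos
  have hr : 0 < min δ ε := lt_min hδ hε
  refine ⟨min δ ε / 2, half_pos hr, (half_lt_self hr).trans_le (min_le_right _ _), ?_⟩
  refine (isCompact_closedBall p (min δ ε / 2)).of_isClosed_subset ?_ inter_subset_right
  refine isClosed_of_closure_subset fun x hx => ?_
  have hxp : dist x p ≤ min δ ε / 2 :=
    closure_minimal inter_subset_right Metric.isClosed_closedBall hx
  refine ⟨?_, hxp⟩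
  obtain ⟨q, hq, hqx, -⟩ := H x fun a _ => (abs_sub_le_dist x p a).trans_lt
    (hxp.trans_lt ((half_lt_self hr).trans_le (min_le_left _ _)))
  have : x = q := by
    refine eq_of_forall_dist_le fun η hη => ?_
    obtain ⟨δ', hδ', H'⟩ := h.lift q hq (η / 2) (half_pos hη)
    obtain ⟨y, ⟨hy, -⟩, hyx⟩ := Metric.mem_closure_iff.1 hx (min δ' (η / 2))
      (lt_min hδ' (half_pos hη))
    obtain ⟨q', hq', hqS, hqq⟩ := H' y fun a ha => by
      rw [hqx a ha]
      exact (abs_sub_le_dist y x a).trans_lt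
        ((dist_comm x y ▸ hyx).trans_le (min_le_left _ _))
    rw [h.separates q' hq' y hy hqS] at hqq
    have h1 := dist_triangle x y q
    have h2 := min_le_right δ' (η / 2)
    linarith
  rwa [this]

/-- By compactness the `H`-coordinates of points of `E` on the sphere stay away from those of `p`.
This prevents points with `H`-coordinates near those of `p` from escaping through the sphere. -/
theorem exists_pos_forall_dist_ne {E : Set (α → ℝ)} {p : α → ℝ} (hp : p ∈ E) {r : ℝ} (hr : 0 < r)
    (hc : IsCompact (E ∩ Metric.closedBall p r)) {H : Finset α} (hs : Separates H E) :
    ∃ η > 0, ∀ q ∈ E, (∀ a ∈ H, |q a - p a| < η) → dist q p ≠ r := by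
  have hsphere : IsCompact ((E ∩ Metric.closedBall p r) ∩ Metric.sphere p r) :=
    hc.inter_right Metric.isClosed_sphere
  have hpos : ∀ q ∈ (E ∩ Metric.closedBall p r) ∩ Metric.sphere p r,
      0 < ∑ a ∈ H, |q a - p a| := by
    rintro q ⟨⟨hq, -⟩, hqr⟩
    refine lt_of_le_of_ne (Finset.sum_nonneg fun _ _ => abs_nonneg _) fun h0 => ?_
    have h1 := (Finset.sum_eq_zero_iff_of_nonneg fun a _ => abs_nonneg (q a - p a)).1 h0.symm
    have : q = p := hs q hq p hp fun a ha => by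
      have := h1 a ha; rwa [abs_eq_zero, sub_eq_zero] at this
    rw [Metric.mem_sphere, this, dist_self] at hqr
    exact hr.ne hqr
  obtain ⟨m, hm, hmin⟩ : ∃ m > 0, ∀ q ∈ (E ∩ Metric.closedBall p r) ∩ Metric.sphere p r,
      m ≤ ∑ a ∈ H, |q a - p a| := by
    rcases eq_empty_or_nonempty ((E ∩ Metric.closedBall p r) ∩ Metric.sphere p r) with he | hne
    · exact ⟨1, one_pos, by simp [he]⟩
    · obtain ⟨x, hx, hmin⟩ := hsphere.exists_isMinOn hne
        (f := fun q : α → ℝ => ∑ a ∈ H, |q a - p a|) (by fun_prop)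
      exact ⟨_, hpos x hx, fun q hq => hmin hq⟩
  refine ⟨m / (H.card + 1), by positivity, fun q hq hqa hqr => ?_⟩
  have h1 := hmin q ⟨⟨hq, hqr.le⟩, hqr⟩
  have h2 : ∑ a ∈ H, |q a - p a| ≤ H.card • (m / (H.card + 1)) :=
    Finset.sum_le_card_nsmul _ _ _ fun a ha => (hqa a ha).le
  have h3 : H.card • (m / (H.card + 1)) < m := by
    rw [nsmul_eq_mul, mul_div_assoc', div_lt_iff₀ (by positivity)]
    nlinarith
  linarith

/-- Invariance of domain for cells: coordinates that separate the points of `E`, as many as its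
dimension, form a chart. -/
theorem IsCell.isChart {n : ℕ} {E : Set (α → ℝ)} (h : IsCell n E) {H : Finset α} (hH : H.card = n)
    (hs : Separates H E) : IsChart E H := by
  induction n generalizing E H with
  | zero =>
    exact ⟨hs, fun p hp ε hε => ⟨1, one_pos, fun _ _ =>
      ⟨p, hp, by simp [Finset.card_eq_zero.1 hH], by simpa using hε⟩⟩⟩
  | succ n ih =>
    refine ⟨hs, fun p hp ε hε => ?_⟩
    obtain ⟨S, hS⟩ := id h
    obtain ⟨r, hr, hrε, hcomp⟩ := hS.base.chart.exists_isCompact hp hε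
    obtain ⟨η, hη, hne⟩ := exists_pos_forall_dist_ne hp hr hcomp hs
    obtain ⟨y, hyH, hy⟩ := h.exists_not_isConstCoord hs
    obtain ⟨δ, hδ, ho⟩ := h.isOpenCoord hy p hp (min η r) (lt_min hη hr)
    refine ⟨min δ η, lt_min hδ hη, fun k hk => ?_⟩
    have hky := hk y hyH
    obtain ⟨qc, hqc, hqcp, hqcy⟩ := ho (k y) (hky.trans_le (min_le_left _ _))
    have hcell : IsCell n (coordSlice E y (k y)) := h.fiber hy ⟨qc, hqc, hqcy⟩
    have hchart := ih hcell (H := H.erase y)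
      (by rw [Finset.card_erase_of_mem hyH, hH]; rfl) (hs.erase_fiber y _)
    have hV : IsPreconnected {x : α → ℝ | ∀ a ∈ H.erase y, |x a - p a| < η} := by
      refine Convex.isPreconnected ?_
      have he : {x : α → ℝ | ∀ a ∈ H.erase y, |x a - p a| < η} =
          (↑(H.erase y) : Set α).pi fun a => Metric.ball (p a) η := by
        ext x; simp only [Set.mem_pi, Real.dist_eq, Finset.mem_coe, Metric.mem_ball, mem_ofPred_eq]
      rw [he]
      exact convex_pi fun a _ => convex_ball _ _
    -- Which parameters are attained by the slice `y = k y` inside the open ball. On the convex box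
    -- of radius `η` this is an open condition by the induction hypothesis, and a closed one by
    -- compactness, as the sphere is avoided. It holds at `qc`, hence at `k`.
    set f : (α → ℝ) → Prop := fun x =>
      ∃ q ∈ coordSlice E y (k y), dist q p < r ∧ ∀ a ∈ H.erase y, q a = x a with hf
    have hloc : ∀ x ∈ {x : α → ℝ | ∀ a ∈ H.erase y, |x a - p a| < η},
        ∀ᶠ x' in 𝓝[{x : α → ℝ | ∀ a ∈ H.erase y, |x a - p a| < η}] x, f x' = f x := by
      intro x hx
      by_cases hfx : f x
      · obtain ⟨q, hq, hqp, hqx⟩ := hfx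
        obtain ⟨δ', hδ', hl⟩ := hchart.lift q hq (r - dist q p) (sub_pos.2 hqp)
        filter_upwards [mem_nhdsWithin_of_mem_nhds (Metric.ball_mem_nhds x hδ')] with x' hx'
        refine propext (iff_of_true ?_ ⟨q, hq, hqp, hqx⟩)
        obtain ⟨q', hq', hqx', hqq⟩ := hl x' fun a ha => by
          rw [hqx a ha]; exact (abs_sub_le_dist x' x a).trans_lt hx'
        refine ⟨q', hq', ?_, hqx'⟩
        linarith [dist_triangle q' q p]
      · have hcl : IsClosed {x : α → ℝ | ∃ q ∈ E ∩ Metric.closedBall p r ∩ {q | q y = k y},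
            ∀ a ∈ H.erase y, q a = x a} := by
          have hcomp' : IsCompact (E ∩ Metric.closedBall p r ∩ {q | q y = k y}) :=
            hcomp.inter_right (isClosed_eq (continuous_apply y) continuous_const)
          have hcont : Continuous fun x : α → ℝ => (H.erase y).piecewise x 0 := by
            refine continuous_pi fun a => ?_
            by_cases ha : a ∈ H.erase y
            · simpa only [Finset.piecewise_eq_of_mem _ _ _ ha] using continuous_apply a
            · simpa only [Finset.piecewise_eq_of_notMem _ _ _ ha] using continuous_const
          convert (hcomp'.image hcont).isClosed.preimage hcont using 1
          ext x
          simp only [mem_preimage, mem_image, mem_ofPred_eq]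
          refine exists_congr fun q => and_congr_right fun _ => ?_
          constructor
          · intro h; ext a
            by_cases ha : a ∈ H.erase y
            · simp only [Finset.piecewise_eq_of_mem _ _ _ ha, h a ha]
            · simp only [Finset.piecewise_eq_of_notMem _ _ _ ha]
          · intro h a ha
            have := congrFun h a
            simpa only [Finset.piecewise_eq_of_mem _ _ _ ha] using this
        have hiff : ∀ x ∈ {x : α → ℝ | ∀ a ∈ H.erase y, |x a - p a| < η},
            (∃ q ∈ E ∩ Metric.closedBall p r ∩ {q | q y = k y}, ∀ a ∈ H.erase y, q a = x a) →
            f x := by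
          rintro x hx ⟨q, ⟨⟨hq, hqp⟩, hqy⟩, hqx⟩
          refine ⟨q, ⟨hq, hqy⟩, lt_of_le_of_ne hqp (hne q hq fun a ha => ?_), hqx⟩
          by_cases hay : a = y
          · rw [hay, hqy]; exact hky.trans_le (min_le_right _ _)
          · have ha' := Finset.mem_erase.2 ⟨hay, ha⟩
            rw [hqx a ha']; exact hx a ha'
        filter_upwards [self_mem_nhdsWithin, mem_nhdsWithin_of_mem_nhds
          (hcl.isOpen_compl.mem_nhds fun h => hfx (hiff x hx h))] with x' _ hx'
        refine propext (iff_of_false ?_ hfx)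
        rintro ⟨q, hq, hqp, hqx⟩
        exact hx' ⟨q, ⟨⟨hq.1, hqp.le⟩, hq.2⟩, hqx⟩
    have hfq : f qc := ⟨qc, ⟨hqc, hqcy⟩, hqcp.trans_le (min_le_right _ _), fun _ _ => rfl⟩
    have hfk : f k := by
      rw [hV.eq_of_eventually_eq f hloc (x := k) (y := qc)]
      · exact hfq
      · exact fun a ha => (hk a (Finset.mem_of_mem_erase ha)).trans_le (min_le_right _ _)
      · exact fun a _ => (abs_sub_le_dist qc p a).trans_lt (hqcp.trans_le (min_le_left _ _))
    obtain ⟨q, hq, hqp, hqk⟩ := hfk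
    refine ⟨q, hq.1, fun a ha => ?_, hqp.trans hrε⟩
    by_cases hay : a = y
    · rw [hay, hq.2]
    · exact hqk a (Finset.mem_erase.2 ⟨hay, ha⟩)

/-- A cell that is closed in a cell of the same dimension is equal to it. -/
theorem IsCell.eq_of_subset {n : ℕ} {G E : Set (α → ℝ)} (hG : IsCell n G) (hE : IsCell n E)
    (hGE : G ⊆ E) (hcl : closure G ∩ E ⊆ G) : G = E := by
  obtain ⟨S, hS⟩ := id hG
  have hsE := hG.separates_of_subset hE hGE hS.base.card hS.base.chart.separates
  obtain ⟨p, hp⟩ := hG.nonempty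
  refine subset_antisymm hGE fun q hq => ?_
  have := hE.isPreconnected.eq_of_eventually_eq (fun x => x ∈ G) (fun x hx => ?_) (hGE hp) hq
  · exact this ▸ hp
  by_cases hxG : x ∈ G
  · obtain ⟨δ, hδ, H⟩ := hS.base.chart.lift x hxG 1 one_pos
    filter_upwards [inter_mem_nhdsWithin E (Metric.ball_mem_nhds x hδ)] with y hy
    obtain ⟨g, hg, hgy, -⟩ := H y fun a _ => (abs_sub_le_dist y x a).trans_lt hy.2
    rw [hsE g (hGE hg) y hy.1 hgy] at hg
    exact propext (iff_of_true hg hxG)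
  · have : x ∉ closure G := fun h => hxG (hcl ⟨h, hx⟩)
    filter_upwards [mem_nhdsWithin_of_mem_nhds (isClosed_closure.isOpen_compl.mem_nhds this)]
      with y hy
    exact propext (iff_of_false (fun h => hy (subset_closure h)) hxG)

end Bases

/-- The point `b` is the end of the interval `J` on the side of `x`. If the segment from `x` to `b`
met `J`, then `b` would lie between two points of `J`. -/
theorem exists_mem_closure_of_notMem {J : Set ℝ} (hJ : IsOpen J) (hJc : J.OrdConnected) {x j : ℝ}
    (hj : j ∈ J) (hx : x ∉ J) :
    ∃ b ∈ uIcc x j, b ∈ closure J ∧ b ∉ J ∧ ∀ y ∈ uIcc x b, y ∉ J := by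
  have h : (uIcc x j ∩ frontier J).Nonempty := by
    have hp : IsPreconnected (uIcc x j) := ordConnected_uIcc.isPreconnected
    by_contra hne
    rw [not_nonempty_iff_eq_empty] at hne
    have := hp.eq_of_eventually_eq (fun y => y ∈ J) (fun y hy => ?_) left_mem_uIcc right_mem_uIcc
    · exact hx (this ▸ hj)
    by_cases hyJ : y ∈ J
    · filter_upwards [mem_nhdsWithin_of_mem_nhds (hJ.mem_nhds hyJ)] with z hz
      exact propext (iff_of_true hz hyJ)
    · have : y ∉ closure J := fun hc => by
        have : y ∈ uIcc x j ∩ frontier J := ⟨hy, hc, by rwa [hJ.interior_eq]⟩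
        rw [hne] at this; exact this
      filter_upwards [mem_nhdsWithin_of_mem_nhds (isClosed_closure.isOpen_compl.mem_nhds this)]
        with z hz
      exact propext (iff_of_false (fun h => hz (subset_closure h)) hyJ)
  obtain ⟨b, hb, hbc, hbi⟩ := h
  rw [hJ.interior_eq] at hbi
  refine ⟨b, hb, hbc, hbi, fun y hy hyJ => hbi (hJc.uIcc_subset hyJ hj ?_)⟩
  rw [mem_uIcc] at hb hy ⊢
  rcases hb with hb | hb <;> rcases hy with hy | hy
  · exact Or.inl ⟨hy.2, hb.2⟩
  · exact Or.inl ⟨by linarith [hb.1, hy.1, hy.2], hb.2⟩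
  · exact Or.inr ⟨hb.1, by linarith [hb.2, hy.1, hy.2]⟩
  · exact Or.inr ⟨hb.1, hy.1⟩

/-! ### Gluing local signs: absence of monodromy -/

section Sign

variable {β : Type*} [Fintype β] [DecidableEq β]

/-- Near `q` and on `K`, the function `s` equals `σ q` up to a change of sign. -/
def IsSignAt (σ : (β → ℝ) → (β → ℝ) → Bool) (K : Set (β → ℝ)) (s : (β → ℝ) → Bool)
    (q : β → ℝ) : Prop :=
  ∃ b, ∀ᶠ r in 𝓝[K] q, s r = xor b (σ q r)

variable {σ : (β → ℝ) → (β → ℝ) → Bool} {X K K' : Set (β → ℝ)} {s s' : (β → ℝ) → Bool}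
  {p q : β → ℝ}

theorem IsSignAt.mono (h : IsSignAt σ K s q) (hK : K' ⊆ K) : IsSignAt σ K' s q :=
  h.imp fun _ hb => hb.filter_mono (nhdsWithin_mono _ hK)

theorem IsSignAt.congr (h : IsSignAt σ K s q) {b : Bool}
    (hs : ∀ᶠ r in 𝓝[K] q, s' r = xor b (s r)) : IsSignAt σ K s' q := by
  obtain ⟨c, hc⟩ := h
  refine ⟨xor b c, ?_⟩
  filter_upwards [hc, hs] with r h1 h2
  rw [h2, h1, Bool.xor_assoc]

/-- Uniqueness up to a flip: the `xor` of two sign functions is locally constant. -/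
theorem IsSignAt.exists_xor (hK : IsPreconnected K) (h : ∀ q ∈ K, IsSignAt σ K s q)
    (h' : ∀ q ∈ K, IsSignAt σ K s' q) : ∃ b, ∀ x ∈ K, s' x = xor b (s x) := by
  rcases eq_empty_or_nonempty K with rfl | ⟨p, hp⟩
  · exact ⟨true, by simp⟩
  refine ⟨xor (s p) (s' p), fun x hx => ?_⟩
  have := hK.eq_of_eventually_eq (fun x => xor (s x) (s' x)) (fun q hq => ?_) hx hp
  · rw [← this, Bool.xor_comm (s x), Bool.xor_assoc, Bool.xor_self, Bool.xor_false]
  obtain ⟨b, hb⟩ := h q hq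
  obtain ⟨b', hb'⟩ := h' q hq
  filter_upwards [hb, hb'] with r h1 h2
  rw [h1, h2, hb.self_of_nhdsWithin hq, hb'.self_of_nhdsWithin hq]
  cases b <;> cases b' <;> cases σ q r <;> cases σ q q <;> rfl

theorem isPreconnected_ball_slice (p : β → ℝ) (δ : ℝ) (T : Finset β) (c : β → ℝ) :
    IsPreconnected (Metric.ball p δ ∩ {x | ∀ a ∈ T, x a = c a}) := by
  have : {x : β → ℝ | ∀ a ∈ T, x a = c a} = (T : Set β).pi fun a => {c a} := by
    ext x; simp [Set.mem_pi]
  rw [this]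
  exact ((convex_ball p δ).inter (convex_pi fun a _ => convex_singleton _)).isPreconnected

/-- The local sign functions `σ p` agree up to a change of sign where they overlap. -/
def IsSignSystem (σ : (β → ℝ) → (β → ℝ) → Bool) (X : Set (β → ℝ)) : Prop :=
  ∀ p ∈ X, ∃ δ > 0, Metric.ball p δ ⊆ X ∧ ∀ q ∈ Metric.ball p δ, IsSignAt σ univ (σ p) q

theorem dist_update_lt {p : β → ℝ} {z : β} {y δ : ℝ} (hδ : 0 < δ) (h : |y - p z| < δ) :
    dist (Function.update p z y) p < δ := by
  rw [dist_pi_lt_iff hδ]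
  intro a
  by_cases ha : a = z
  · subst ha; simpa [Real.dist_eq] using h
  · simpa [ha] using hδ

theorem slice_insert {X : Set (β → ℝ)} {T : Finset β} {z : β} (hz : z ∉ T) (c : β → ℝ) (y : ℝ) :
    {x ∈ X | ∀ a ∈ insert z T, x a = Function.update c z y a} =
      coordSlice {x ∈ X | ∀ a ∈ T, x a = c a} z y := by
  ext x
  have : (∀ a ∈ T, x a = Function.update c z y a) ↔ ∀ a ∈ T, x a = c a := by
    refine forall₂_congr fun a ha => ?_
    rw [Function.update_of_ne (ne_of_mem_of_not_mem ha hz)]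
  simp only [coordSlice, Finset.forall_mem_insert, mem_ofPred_eq, Function.update_self, this]
  tauto

/-- Sign functions on the single slices `z = y` become one on a strip around `p` once they are
normalised on the line through `p` in direction `z`. The result agrees with `σ p` near `p`, and
being a sign function propagates along the connected slices. -/
theorem exists_sign_near (hσ : IsSignSystem σ X) {T : Finset β} {z : β} (hz : z ∉ T)
    {c : β → ℝ}
    (hX : ∀ y, IsPreconnected (coordSlice {x ∈ X | ∀ a ∈ T, x a = c a} z y))
    (hs : ∀ y, ∃ s, ∀ q ∈ coordSlice {x ∈ X | ∀ a ∈ T, x a = c a} z y,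
      IsSignAt σ (coordSlice {x ∈ X | ∀ a ∈ T, x a = c a} z y) s q)
    (hp : p ∈ {x ∈ X | ∀ a ∈ T, x a = c a}) :
    ∃ δ > 0, ∃ s, ∀ q ∈ {x ∈ X | ∀ a ∈ T, x a = c a}, |q z - p z| < δ →
      IsSignAt σ {x ∈ X | ∀ a ∈ T, x a = c a} s q := by
  set K := {x ∈ X | ∀ a ∈ T, x a = c a} with hK
  have hupd : ∀ {q : β → ℝ} {δ y : ℝ}, q ∈ K → 0 < δ → Metric.ball q δ ⊆ X → |y - q z| < δ →
      Function.update q z y ∈ coordSlice K z y := by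
    intro q δ y hq hδ hb hy
    refine ⟨⟨hb (dist_update_lt hδ hy), fun a ha => ?_⟩, by simp⟩
    rw [Function.update_of_ne (ne_of_mem_of_not_mem ha hz), hq.2 a ha]
  have hball : ∀ {q : β → ℝ} {δ : ℝ}, Metric.ball q δ ⊆ X → ∀ y,
      IsPreconnected (coordSlice K z y ∩ Metric.ball q δ) := by
    intro q δ hb y
    convert isPreconnected_ball_slice q δ (insert z T) (Function.update c z y) using 1
    rw [← slice_insert hz]
    ext x
    exact ⟨fun h => ⟨h.2, h.1.2⟩, fun h => ⟨⟨hb h.1, h.2⟩, h.1⟩⟩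
  choose t ht using hs
  obtain ⟨δ, hδ, hbX, hσp⟩ := hσ p hp.1
  -- The flip on each slice is chosen so that `s` equals `σ p` at the point of the line through `p`.
  set s : (β → ℝ) → Bool := fun r => xor (xor (t (r z) (Function.update p z (r z)))
    (σ p (Function.update p z (r z)))) (t (r z) r) with hsdef
  have hslice : ∀ y, ∀ q ∈ coordSlice K z y, IsSignAt σ (coordSlice K z y) s q := by
    intro y q hq
    refine (ht y q hq).congr
      (b := xor (t y (Function.update p z y)) (σ p (Function.update p z y))) ?_
    filter_upwards [self_mem_nhdsWithin] with r hr
    simp only [hsdef, hr.2]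
  have hnear : ∀ r ∈ K ∩ Metric.ball p δ, s r = σ p r := by
    rintro r ⟨hr, hrp⟩
    have hrz : |r z - p z| < δ := (abs_sub_le_dist r p z).trans_lt hrp
    obtain ⟨b, hb⟩ := IsSignAt.exists_xor (hball hbX (r z))
      (fun q hq => (hσp q hq.2).mono (subset_univ _))
      (fun q hq => (hslice (r z) q hq.1).mono inter_subset_left)
    have h1 := hb (Function.update p z (r z)) ⟨hupd hp hδ hbX hrz, dist_update_lt hδ hrz⟩
    have h2 := hb r ⟨⟨hr, rfl⟩, hrp⟩
    have h3 : b = false := by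
      simp only [hsdef, Function.update_self] at h1
      revert h1
      cases b <;> cases t (r z) (Function.update p z (r z)) <;>
        cases σ p (Function.update p z (r z)) <;> simp
    rw [h2, h3, Bool.false_xor]
  refine ⟨δ, hδ, s, fun q hq hqp => ?_⟩
  have hq' : q ∈ coordSlice K z (q z) := ⟨hq, rfl⟩
  have hp' := hupd hp hδ hbX hqp
  have hpgood : IsSignAt σ K s (Function.update p z (q z)) := by
    have hmem : Function.update p z (q z) ∈ Metric.ball p δ := dist_update_lt hδ hqp
    refine ((hσp _ hmem).mono (subset_univ K)).congr (b := false) ?_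
    filter_upwards [inter_mem_nhdsWithin K (Metric.isOpen_ball.mem_nhds hmem)] with r hr
    rw [hnear r hr, Bool.false_xor]
  -- Being a sign function on `K`, and not only on the slice, is a clopen condition along the slice
  -- through `q`.
  have key := (hX (q z)).eq_of_eventually_eq (fun x => IsSignAt σ K s x) (fun x hx => ?_) hq' hp'
  · exact key ▸ hpgood
  obtain ⟨δ', hδ', hbX', hσx⟩ := hσ x hx.1.1
  -- On each nearby slice within the ball, `s` and `σ x` differ by a constant flip. Testing at the
  -- translate of `x₁` in direction `z` shows that this flip is the same for all levels.
  have himp : ∀ x₁ ∈ coordSlice K z (q z) ∩ Metric.ball x δ',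
      ∀ x₂ ∈ coordSlice K z (q z) ∩ Metric.ball x δ', IsSignAt σ K s x₁ → IsSignAt σ K s x₂ := by
    intro x₁ hx₁ x₂ hx₂ ⟨b, hb⟩
    obtain ⟨b₁, hb₁⟩ := (hσx x₁ hx₁.2).mono (subset_univ K)
    have hev : ∀ᶠ r in 𝓝[K] x₁, s r = xor (xor b b₁) (σ x r) := by
      filter_upwards [hb, hb₁] with r h1 h2
      rw [h1, h2]; cases b <;> cases b₁ <;> simp
    obtain ⟨ε, hε, hsub⟩ := Metric.mem_nhdsWithin_iff.1
      (inter_mem hev (mem_nhdsWithin_of_mem_nhds (Metric.isOpen_ball.mem_nhds hx₁.2)))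
    have hall : ∀ r ∈ K ∩ Metric.ball x δ', |r z - q z| < ε → s r = xor (xor b b₁) (σ x r) := by
      rintro r ⟨hr, hrx⟩ hrz
      obtain ⟨b₂, hb₂⟩ := IsSignAt.exists_xor (hball hbX' (r z))
        (fun q hq => (hσx q hq.2).mono (subset_univ _))
        (fun q hq => (hslice (r z) q hq.1).mono inter_subset_left)
      have hrz' : |r z - x₁ z| < ε := by rw [hx₁.1.2]; exact hrz
      have hm1 : Function.update x₁ z (r z) ∈ Metric.ball x₁ ε := dist_update_lt hε hrz'
      have hm2 : Function.update x₁ z (r z) ∈ {y : β → ℝ | ∀ a ∈ T, y a = c a} := fun a ha => by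
        rw [Function.update_of_ne (ne_of_mem_of_not_mem ha hz), hx₁.1.1.2 a ha]
      have hm3 : Function.update x₁ z (r z) ∈ Metric.ball x δ' := by
        rw [Metric.mem_ball, dist_pi_lt_iff hδ']
        intro a
        by_cases ha : a = z
        · subst ha
          simp only [Function.update_self]
          exact (dist_le_pi_dist r x a).trans_lt hrx
        · rw [Function.update_of_ne ha]
          exact (dist_le_pi_dist x₁ x a).trans_lt hx₁.2
      have hm4 : Function.update x₁ z (r z) ∈ K := ⟨hbX' hm3, hm2⟩
      have h1 := (hsub ⟨hm1, hm4⟩).1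
      have h2 := hb₂ _ ⟨⟨hm4, by simp⟩, hm3⟩
      have h3 : b₂ = xor b b₁ := by
        rw [mem_ofPred_eq, h2] at h1
        exact Bool.xor_left_inj.1 h1
      rw [hb₂ r ⟨⟨hr, rfl⟩, hrx⟩, h3]
    refine ((hσx x₂ hx₂.2).mono (subset_univ K)).congr (b := xor b b₁) ?_
    filter_upwards [self_mem_nhdsWithin, mem_nhdsWithin_of_mem_nhds (Metric.ball_mem_nhds x₂ hε),
      mem_nhdsWithin_of_mem_nhds (Metric.isOpen_ball.mem_nhds hx₂.2)] with r h1 h2 h3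
    refine hall r ⟨h1, h3⟩ ?_
    rw [← hx₂.1.2]
    exact (abs_sub_le_dist r x₂ z).trans_lt h2
  filter_upwards [inter_mem_nhdsWithin _ (Metric.ball_mem_nhds x hδ')] with x' hx'
  have hxx := (⟨hx, Metric.mem_ball_self hδ'⟩ : x ∈ coordSlice K z (q z) ∩ Metric.ball x δ')
  exact propext ⟨himp x' hx' x hxx, himp x hxx x' hx'⟩

theorem eventually_coord_mem {U : Set ℝ} {z : β} (hU : IsOpen U) (h : q z ∈ U) :
    ∀ᶠ r in 𝓝 q, r z ∈ U :=
  (continuous_apply z).continuousAt (hU.mem_nhds h)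

/-- Continuation along the coordinate `z`: sign functions over open intervals around `p z`,
normalised at `p`, agree on overlaps by `hK`. Their union is maximal, and local existence extends it
past any end point attained on `K`. -/
theorem exists_sign_of_local {z : β}
    (hK : ∀ I : Set ℝ, I.OrdConnected → IsPreconnected {x ∈ K | x z ∈ I})
    (hloc : ∀ p ∈ K, ∃ δ > 0, ∃ s, ∀ q ∈ K, |q z - p z| < δ → IsSignAt σ K s q) :
    ∃ s, ∀ q ∈ K, IsSignAt σ K s q := by
  classical
  rcases eq_empty_or_nonempty K with rfl | ⟨p, hp⟩
  · exact ⟨fun _ => true, by simp⟩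
  let 𝓘 : Set (Set ℝ × ((β → ℝ) → Bool)) := {m | IsOpen m.1 ∧ m.1.OrdConnected ∧ p z ∈ m.1 ∧
    m.2 p = false ∧ ∀ q ∈ K, q z ∈ m.1 → IsSignAt σ K m.2 q}
  have huniq : ∀ m ∈ 𝓘, ∀ m' ∈ 𝓘, ∀ q ∈ K, q z ∈ m.1 → q z ∈ m'.1 → m.2 q = m'.2 q := by
    rintro m ⟨-, h1, h2, h3, h4⟩ m' ⟨-, h1', h2', h3', h4'⟩ q hq hqm hqm'
    obtain ⟨b, hb⟩ := IsSignAt.exists_xor (hK _ (h1.inter h1'))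
      (fun q hq => (h4 q hq.1 hq.2.1).mono fun x hx => hx.1)
      (fun q hq => (h4' q hq.1 hq.2.2).mono fun x hx => hx.1)
    have h5 := hb p ⟨hp, h2, h2'⟩
    rw [h3, h3', Bool.xor_false] at h5
    rw [hb q ⟨hq, hqm, hqm'⟩, ← h5, Bool.false_xor]
  set U : Set ℝ := ⋃ m ∈ 𝓘, m.1 with hU
  have hUo : IsOpen U := isOpen_biUnion fun m hm => hm.1
  have hUc : U.OrdConnected := by
    refine IsPreconnected.ordConnected ?_
    rw [hU, ← sUnion_image]
    refine isPreconnected_sUnion (p z) _ ?_ ?_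
    · rintro _ ⟨m, hm, rfl⟩; exact hm.2.2.1
    · rintro _ ⟨m, hm, rfl⟩; exact hm.2.1.isPreconnected
  let s : (β → ℝ) → Bool := fun r => if h : ∃ m ∈ 𝓘, r z ∈ m.1 then h.choose.2 r else true
  have hs : ∀ m ∈ 𝓘, ∀ q ∈ K, q z ∈ m.1 → s q = m.2 q := by
    intro m hm q hq hqm
    have h : ∃ m ∈ 𝓘, q z ∈ m.1 := ⟨m, hm, hqm⟩
    simp only [s, h, dif_pos]
    exact huniq _ h.choose_spec.1 m hm q hq h.choose_spec.2 hqm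
  have hgood : ∀ q ∈ K, q z ∈ U → IsSignAt σ K s q := by
    intro q hq hqU
    obtain ⟨m, hm, hqm⟩ := mem_iUnion₂.1 hqU
    refine (hm.2.2.2.2 q hq hqm).congr (b := false) ?_
    filter_upwards [inter_mem_nhdsWithin K (eventually_coord_mem hm.1 hqm)] with r hr
    rw [hs m hm r hr.1 hr.2, Bool.false_xor]
  have hextend : ∀ e ∈ K, e z ∈ closure U → p z ∈ U → e z ∈ U := by
    intro e he hec hpU
    obtain ⟨δ, hδ, s', hs'⟩ := hloc e he
    have hI : ∀ y, y ∈ Metric.ball (e z) δ ↔ |y - e z| < δ := fun y => by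
      rw [Metric.mem_ball, Real.dist_eq]
    have hIc : (Metric.ball (e z) δ).OrdConnected :=
      (convex_ball (e z) δ).isPreconnected.ordConnected
    obtain ⟨b, hb⟩ := IsSignAt.exists_xor (s := s') (s' := s) (hK _ (hUc.inter hIc))
      (fun q hq => (hs' q hq.1 ((hI _).1 hq.2.2)).mono fun x hx => hx.1)
      (fun q hq => (hgood q hq.1 hq.2.1).mono fun x hx => hx.1)
    obtain ⟨y, hyU, hyI⟩ := mem_closure_iff_nhds.1 hec _ (Metric.ball_mem_nhds (e z) hδ)
    refine mem_iUnion₂.2 ⟨⟨U ∪ Metric.ball (e z) δ, fun r => if r z ∈ U then s r else xor b (s' r)⟩,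
      ⟨hUo.union Metric.isOpen_ball, ?_, Or.inl hpU, ?_, ?_⟩, Or.inr (Metric.mem_ball_self hδ)⟩
    · exact (IsPreconnected.union y hyI hyU hUc.isPreconnected hIc.isPreconnected).ordConnected
    · obtain ⟨m, hm, hpm⟩ := mem_iUnion₂.1 hpU
      simp only [hpU, if_true]
      rw [hs m hm p hp hpm, hm.2.2.2.1]
    · rintro q hq (hqU | hqI)
      · refine (hgood q hq hqU).congr (b := false) ?_
        filter_upwards [mem_nhdsWithin_of_mem_nhds (eventually_coord_mem hUo hqU)] with r hr
        rw [if_pos hr, Bool.false_xor]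
      · refine (hs' q hq ((hI _).1 hqI)).congr (b := b) ?_
        filter_upwards [inter_mem_nhdsWithin K (eventually_coord_mem Metric.isOpen_ball hqI)]
          with r hr
        by_cases hrU : r z ∈ U
        · simp only [hrU, if_true]; exact hb r ⟨hr.1, hrU, hr.2⟩
        · simp only [hrU, if_false]
  have hpU : p z ∈ U := by
    obtain ⟨δ, hδ, s', hs'⟩ := hloc p hp
    refine mem_iUnion₂.2 ⟨⟨Metric.ball (p z) δ, fun r => xor (s' p) (s' r)⟩,
      ⟨Metric.isOpen_ball, (convex_ball (p z) δ).isPreconnected.ordConnected,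
        Metric.mem_ball_self hδ, by simp, fun q hq hqp => ?_⟩, Metric.mem_ball_self hδ⟩
    refine (hs' q hq (by rwa [Metric.mem_ball, Real.dist_eq] at hqp)).congr (b := s' p) ?_
    exact Eventually.of_forall fun _ => rfl
  refine ⟨s, fun q hq => hgood q hq ?_⟩
  by_contra hqU
  obtain ⟨b, hb, hbc, hbU, -⟩ := exists_mem_closure_of_notMem hUo hUc hpU hqU
  have hKz : ((fun x : β → ℝ => x z) '' K).OrdConnected := by
    have := hK univ ordConnected_univ
    simp only [mem_univ, and_true, ofPred_mem_eq] at this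
    exact (this.image _ (by fun_prop)).ordConnected
  obtain ⟨e, he, heb⟩ := hKz.uIcc_subset ⟨q, hq, rfl⟩ ⟨p, hp, rfl⟩ hb
  simp only at heb
  exact hbU (heb ▸ hextend e he (heb ▸ hbc) hpU)

/-- If the sections of `X` by coordinate subspaces and strips are connected, then compatible local
sign functions on `X` glue: `X` is simply connected as far as double coverings are concerned. -/
theorem exists_global_sign
    (hX : ∀ (T : Finset β) (c : β → ℝ) (z : β) (I : Set ℝ), I.OrdConnected →
      IsPreconnected {x ∈ X | (∀ a ∈ T, x a = c a) ∧ x z ∈ I})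
    (hσ : IsSignSystem σ X) : ∃ s, ∀ q ∈ X, IsSignAt σ X s q := by
  -- Induction on the set `R` of free coordinates, all others being fixed. Freeing `z` combines the
  -- sign functions of the slices in direction `z`.
  have key : ∀ (R : Finset β) (c : β → ℝ), ∃ s, ∀ q ∈ {x ∈ X | ∀ a ∈ Rᶜ, x a = c a},
      IsSignAt σ {x ∈ X | ∀ a ∈ Rᶜ, x a = c a} s q := by
    intro R
    induction R using Finset.induction_on with
    | empty =>
      intro c
      refine ⟨fun r => σ c r, fun q hq => ⟨false, ?_⟩⟩
      have : ∀ r ∈ {x ∈ X | ∀ a ∈ (∅ : Finset β)ᶜ, x a = c a}, r = c := fun r hr =>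
        funext fun a => hr.2 a (by simp)
      rw [this q hq]
      exact Eventually.of_forall fun _ => by simp
    | insert z R hz ih =>
      intro c
      have hzT : z ∉ (insert z R)ᶜ := by simp
      have hins : insert z (insert z R)ᶜ = Rᶜ := by
        ext a
        by_cases ha : a = z
        · subst ha; simpa using hz
        · simp [ha]
      refine exists_sign_of_local (z := z) (fun I hI => ?_) fun p hp =>
        exists_sign_near hσ hzT (fun y => ?_) (fun y => ?_) hp
      · convert hX (insert z R)ᶜ c z I hI using 1
        ext x; simp only [mem_ofPred_eq, and_assoc]
      · convert hX (insert z R)ᶜ c z {y} ordConnected_singleton using 1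
        ext x; simp only [coordSlice, mem_ofPred_eq, and_assoc, mem_singleton_iff]
      · rw [← slice_insert hzT, hins]; exact ih _
  simpa using key Finset.univ 0

end Sign

/-! ### The two sides of `G` in `F` -/

section Cuts

variable {α : Type*} [Fintype α] [DecidableEq α]

/-- The point `q` lies above the graph `G` over the coordinates `H`, in the direction of the
coordinate `w`. -/
def IsAbove (G : Set (α → ℝ)) (H : Finset α) (w : α) (q : α → ℝ) : Prop :=
  ∃ g ∈ G, (∀ a ∈ H, g a = q a) ∧ g w < q w

theorem isAbove_iff {G : Set (α → ℝ)} {H : Finset α} (hs : Separates H G) {w : α} {q g : α → ℝ}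
    (hg : g ∈ G) (hgq : ∀ a ∈ H, g a = q a) : IsAbove G H w q ↔ g w < q w := by
  refine ⟨fun ⟨g', hg', hgq', h⟩ => ?_, fun h => ⟨g, hg, hgq, h⟩⟩
  rwa [hs g hg g' hg' fun a ha => (hgq a ha).trans (hgq' a ha).symm]

theorem isAbove_congr {G : Set (α → ℝ)} {H : Finset α} {w : α} {q q' : α → ℝ}
    (h : ∀ a ∈ insert w H, q a = q' a) : IsAbove G H w q ↔ IsAbove G H w q' := by
  have h1 := h w (by simp)
  refine exists_congr fun g => and_congr_right fun _ => ?_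
  rw [h1]
  exact and_congr_left fun _ => forall₂_congr fun a ha => by rw [h a (by simp [ha])]

theorem IsRelOpen.eventually {A F : Set (α → ℝ)} (h : IsRelOpen A F) {p : α → ℝ} (hp : p ∈ A) :
    ∀ᶠ q in 𝓝[F] p, q ∈ A := by
  obtain ⟨ε, hε, H⟩ := h p hp
  exact Metric.mem_nhdsWithin_iff.2 ⟨ε, hε, fun q hq => H q hq.2 hq.1⟩

theorem isRelOpen_of_eventually {A F : Set (α → ℝ)} (h : ∀ p ∈ A, ∀ᶠ q in 𝓝[F] p, q ∈ A) :
    IsRelOpen A F := by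
  intro p hp
  obtain ⟨ε, hε, H⟩ := Metric.mem_nhdsWithin_iff.1 (h p hp)
  exact ⟨ε, hε, fun q hq hqp => H ⟨hqp, hq⟩⟩

theorem IsPreconnected.subset_or_subset_of_isRelOpen {A B F V : Set (α → ℝ)} (hV : IsPreconnected V)
    (hVF : V ⊆ F) (hVAB : V ⊆ A ∪ B) (hA : IsRelOpen A F) (hB : IsRelOpen B F)
    (hAB : Disjoint A B) : V ⊆ A ∨ V ⊆ B := by
  have h : ∀ x ∈ V, ∀ y ∈ V, (x ∈ A) = (y ∈ A) := fun x hx y hy => by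
    refine hV.eq_of_eventually_eq (fun x => x ∈ A) (fun x hx => ?_) hx hy
    rcases hVAB hx with hxA | hxB
    · filter_upwards [(hA.eventually hxA).filter_mono (nhdsWithin_mono _ hVF)] with y hy
      exact propext (iff_of_true hy hxA)
    · filter_upwards [(hB.eventually hxB).filter_mono (nhdsWithin_mono _ hVF)] with y hy
      exact propext (iff_of_false (fun h => disjoint_left.1 hAB h hy)
        fun h => disjoint_left.1 hAB h hxB)
  by_cases hne : ∃ x ∈ V, x ∈ A
  · obtain ⟨x, hx, hxA⟩ := hne
    exact Or.inl fun y hy => (h x hx y hy) ▸ hxA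
  · exact Or.inr fun y hy => (hVAB hy).resolve_left fun hyA => hne ⟨y, hy, hyA⟩

/-- In the chart `insert w H` the set `F` becomes open. The local sign at a point of `G` is "above
`G`", and it is trivial away from `G`. These signs are compatible: off `G`, being above is locally
constant wherever `G` has a point over the given `H`-coordinates. -/
theorem exists_sign_of_cells {n : ℕ} {F G : Set (α → ℝ)} (hF : IsCell (n + 1) F) (hG : IsCell n G)
    (hGF : G ⊆ F) (hcl : closure G ∩ F ⊆ G) {H : Finset α} (hH : H.card = n)
    (hsG : Separates H G) {w : α} (hw : w ∉ H) (hsF : Separates (insert w H) F) :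
    ∃ s : (α → ℝ) → Bool, (∀ p ∈ F, p ∉ G → ∀ᶠ q in 𝓝[F] p, s q = s p) ∧
      ∀ p ∈ G, ∃ b, ∀ᶠ q in 𝓝[F] p, (s q = !b ↔ IsAbove G H w q) := by
  classical
  have hcF : IsChart F (insert w H) := hF.isChart (by rw [Finset.card_insert_of_notMem hw, hH]) hsF
  have hcG : IsChart G H := hG.isChart hH hsG
  let β := {a // a ∈ insert w H}
  let π : (α → ℝ) → β → ℝ := fun q a => q a
  let e : (β → ℝ) → α → ℝ := fun r a => if h : a ∈ insert w H then r ⟨a, h⟩ else 0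
  have hπ : Continuous π := by fun_prop
  have he : ∀ r, ∀ a (h : a ∈ insert w H), e r a = r ⟨a, h⟩ := fun r a h => dif_pos h
  have heπ : ∀ q, ∀ a ∈ insert w H, e (π q) a = q a := fun q a h => he _ a h
  have hπinj : ∀ p ∈ F, ∀ q ∈ F, π p = π q → p = q := fun p hp q hq h =>
    hsF p hp q hq fun a ha => congrFun h ⟨a, ha⟩
  have hlift : ∀ p ∈ F, ∀ ε > 0, ∃ δ > 0, ∀ r ∈ Metric.ball (π p) δ, ∃ q ∈ F, π q = r ∧
      dist q p < ε := by
    intro p hp ε hε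
    obtain ⟨δ, hδ, h⟩ := hcF.lift p hp ε hε
    refine ⟨δ, hδ, fun r hr => ?_⟩
    obtain ⟨q, hq, hqr, hqp⟩ := h (e r) fun a ha => by
      rw [he r a ha, ← Real.dist_eq]
      exact (dist_le_pi_dist r (π p) ⟨a, ha⟩).trans_lt hr
    exact ⟨q, hq, funext fun a => by rw [← he r a.1 a.2]; exact hqr a.1 a.2, hqp⟩
  let σ : (β → ℝ) → (β → ℝ) → Bool := fun p r =>
    decide ((∃ g ∈ G, π g = p) ∧ IsAbove G H w (e r))
  have hσ : IsSignSystem σ (π '' F) := by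
    rintro _ ⟨p, hp, rfl⟩
    by_cases hpG : p ∈ G
    · obtain ⟨δ₀, hδ₀, h₀⟩ := hlift p hp 1 one_pos
      obtain ⟨δ₁, hδ₁, h₁⟩ := hcG.lift p hpG 1 one_pos
      refine ⟨min δ₀ δ₁, lt_min hδ₀ hδ₁, fun r hr => ?_, fun r hr => ?_⟩
      · obtain ⟨q, hq, hqr, -⟩ := h₀ r (Metric.ball_subset_ball (min_le_left _ _) hr)
        exact ⟨q, hq, hqr⟩
      by_cases hrG : ∃ g ∈ G, π g = r
      · refine ⟨false, Eventually.of_forall fun r' => ?_⟩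
        have : ∃ g ∈ G, π g = π p := ⟨p, hpG, rfl⟩
        simp only [σ, hrG, this, true_and, Bool.false_xor]
      obtain ⟨g, hg, hgr, -⟩ := h₁ (e r) fun a ha => by
        rw [he r a (by simp [ha]), ← Real.dist_eq]
        exact (dist_le_pi_dist r (π p) ⟨a, by simp [ha]⟩).trans_lt
          (Metric.mem_ball.1 hr |>.trans_le (min_le_right _ _))
      have hgw : g w ≠ e r w := fun h => hrG ⟨g, hg, funext fun a => by
        rw [← he r a.1 a.2]
        rcases Finset.mem_insert.1 a.2 with h' | h'
        · change g a.1 = _; rw [h', h]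
        · exact hgr a.1 h'⟩
      have hε : 0 < |g w - e r w| / 2 := half_pos (abs_pos.2 (sub_ne_zero.2 hgw))
      obtain ⟨δ₂, hδ₂, h₂⟩ := hcG.lift g hg _ hε
      refine ⟨decide (IsAbove G H w (e r)), ?_⟩
      rw [nhdsWithin_univ]
      filter_upwards [Metric.ball_mem_nhds r (lt_min hδ₂ hε)] with r' hr'
      have hr'a : ∀ a ∈ insert w H, |e r' a - e r a| < min δ₂ (|g w - e r w| / 2) := fun a ha => by
        rw [he r a ha, he r' a ha, ← Real.dist_eq]
        exact (dist_le_pi_dist r' r ⟨a, ha⟩).trans_lt hr'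
      obtain ⟨g', hg', hgr', hgg⟩ := h₂ (e r') fun a ha => by
        rw [hgr a ha]
        exact (hr'a a (by simp [ha])).trans_le (min_le_left _ _)
      have h3 : IsAbove G H w (e r') ↔ IsAbove G H w (e r) := by
        rw [isAbove_iff hsG hg hgr, isAbove_iff hsG hg' hgr']
        have h4 := (abs_sub_le_dist g' g w).trans_lt hgg
        have h5 := (hr'a w (by simp)).trans_le (min_le_right _ _)
        rw [abs_lt] at h4 h5
        rcases lt_or_gt_of_ne hgw with h | h
        · rw [abs_of_neg (sub_neg.2 h)] at h4 h5
          exact iff_of_true (by linarith [h4.1, h4.2, h5.1, h5.2]) h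
        · rw [abs_of_pos (sub_pos.2 h)] at h4 h5
          exact iff_of_false (by linarith [h4.1, h4.2, h5.1, h5.2]) h.not_gt
      have h6 : ∃ g ∈ G, π g = π p := ⟨p, hpG, rfl⟩
      simp only [σ, h6, hrG, h3, true_and, false_and, decide_false, Bool.xor_false]
    · have : p ∉ closure G := fun h => hpG (hcl ⟨h, hp⟩)
      obtain ⟨ε, hε, hεG⟩ := Metric.isOpen_iff.1 isClosed_closure.isOpen_compl p this
      obtain ⟨δ₀, hδ₀, h₀⟩ := hlift p hp ε hε
      refine ⟨δ₀, hδ₀, fun r hr => ?_, fun r hr => ?_⟩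
      · obtain ⟨q, hq, hqr, -⟩ := h₀ r hr
        exact ⟨q, hq, hqr⟩
      have hno : ∀ r ∈ Metric.ball (π p) δ₀, ¬ ∃ g ∈ G, π g = r := by
        rintro r hr ⟨g, hg, hgr⟩
        obtain ⟨q, hq, hqr, hqp⟩ := h₀ r hr
        rw [hπinj q hq g (hGF hg) (hqr.trans hgr.symm)] at hqp
        exact hεG hqp (subset_closure hg)
      refine ⟨false, Eventually.of_forall fun r' => ?_⟩
      simp only [σ, hno r hr, hno (π p) (Metric.mem_ball_self hδ₀), false_and, Bool.false_xor]
  have hX : ∀ (T : Finset β) (c : β → ℝ) (z : β) (I : Set ℝ), I.OrdConnected →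
      IsPreconnected {x ∈ π '' F | (∀ a ∈ T, x a = c a) ∧ x z ∈ I} := by
    intro T c z I hI
    convert (hF.isPreconnected_slice_interval (T.map (Function.Embedding.subtype _)) (e c) z.1
      hI).image π hπ.continuousOn using 1
    ext x
    constructor
    · rintro ⟨⟨q, hq, rfl⟩, h1, h2⟩
      refine ⟨q, ⟨hq, fun a ha => ?_, h2⟩, rfl⟩
      obtain ⟨a', ha', rfl⟩ := Finset.mem_map.1 ha
      exact (h1 a' ha').trans (he c a'.1 a'.2).symm
    · rintro ⟨q, ⟨hq, h1, h2⟩, rfl⟩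
      exact ⟨⟨q, hq, rfl⟩, fun a ha =>
        (h1 a.1 (Finset.mem_map.2 ⟨a, ha, rfl⟩)).trans (he c a.1 a.2), h2⟩
  obtain ⟨s, hs⟩ := exists_global_sign hX hσ
  have hpull : ∀ p ∈ F, ∃ b, ∀ᶠ q in 𝓝[F] p, s (π q) = xor b (σ (π p) (π q)) := by
    intro p hp
    obtain ⟨b, hb⟩ := hs (π p) ⟨p, hp, rfl⟩
    exact ⟨b, (hπ.continuousWithinAt.tendsto_nhdsWithin (mapsTo_image π F)).eventually hb⟩
  refine ⟨fun q => s (π q), fun p hp hpG => ?_, fun p hp => ?_⟩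
  · obtain ⟨b, hb⟩ := hpull p hp
    have hno : ¬ ∃ g ∈ G, π g = π p := by
      rintro ⟨g, hg, hgp⟩
      rw [hπinj g (hGF hg) p hp hgp] at hg
      exact hpG hg
    have hp' := hb.self_of_nhdsWithin hp
    filter_upwards [hb] with q hq
    simp only [hq, hp', σ, hno, false_and]
  · obtain ⟨b, hb⟩ := hpull p (hGF hp)
    refine ⟨b, hb.mono fun q hq => ?_⟩
    have h1 : ∃ g ∈ G, π g = π p := ⟨p, hp, rfl⟩
    have h2 : IsAbove G H w (e (π q)) ↔ IsAbove G H w q := isAbove_congr (heπ q)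
    simp only [hq, σ, h1, true_and, h2]
    by_cases h3 : IsAbove G H w q <;> cases b <;> simp [h3]

/-- `G` cuts `F` into the two sides `A` and `B`. -/
structure IsCut (n : ℕ) (F G A B : Set (α → ℝ)) : Prop where
  cell : IsCell (n + 1) F
  cell_wall : IsCell n G
  subset : G ⊆ F
  closed : closure G ∩ F ⊆ G
  isRelOpen_left : IsRelOpen A F
  isRelOpen_right : IsRelOpen B F
  disjoint : Disjoint A B
  union_eq : A ∪ B = F \ G
  subset_closure_left : G ⊆ closure A
  subset_closure_right : G ⊆ closure B

/-- No point of `G` is above `G`, so the sign is locally constant on `G`, hence constant. The sides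
are then the points off `G` with the other sign and those with the same sign. -/
theorem exists_isCut {n : ℕ} {F G : Set (α → ℝ)} (hF : IsCell (n + 1) F) (hG : IsCell n G)
    (hGF : G ⊆ F) (hcl : closure G ∩ F ⊆ G) {H : Finset α} (hH : H.card = n)
    (hsG : Separates H G) {w : α} (hw : w ∉ H) (hsF : Separates (insert w H) F) :
    ∃ A B, IsCut n F G A B ∧
      ∀ p ∈ G, ∀ᶠ q in 𝓝[F] p, q ∉ G → (q ∈ A ↔ IsAbove G H w q) := by
  obtain ⟨s, hs, hsG'⟩ := exists_sign_of_cells hF hG hGF hcl hH hsG hw hsF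
  have hcF : IsChart F (insert w H) := hF.isChart (by rw [Finset.card_insert_of_notMem hw, hH]) hsF
  have hnot : ∀ p ∈ G, ¬ IsAbove G H w p := fun p hp => by
    rw [isAbove_iff hsG hp fun _ _ => rfl]; exact lt_irrefl _
  have hb : ∀ p ∈ G, ∀ᶠ q in 𝓝[F] p, (s q = !(s p) ↔ IsAbove G H w q) := by
    intro p hp
    obtain ⟨b, hb⟩ := hsG' p hp
    have h1 := hb.self_of_nhdsWithin (hGF hp)
    have h2 : s p = b := by
      have := mt h1.1 (hnot p hp)
      revert this; cases s p <;> cases b <;> simp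
    rwa [h2]
  obtain ⟨p₀, hp₀⟩ := hG.nonempty
  have hconst : ∀ p ∈ G, s p = s p₀ := fun p hp => by
    refine hG.isPreconnected.eq_of_eventually_eq s (fun p hp => ?_) hp hp₀
    filter_upwards [(hb p hp).filter_mono (nhdsWithin_mono _ hGF), self_mem_nhdsWithin]
      with q hq hqG
    have := mt hq.1 (hnot q hqG)
    revert this; cases s p <;> cases s q <;> simp
  have habove : ∀ p ∈ G, ∀ᶠ q in 𝓝[F] p, (s q = !(s p₀) ↔ IsAbove G H w q) := fun p hp => by
    rw [← hconst p hp]; exact hb p hp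
  have hG' : ∀ p ∈ F, p ∉ G → ∀ᶠ q in 𝓝[F] p, q ∈ F ∧ q ∉ G := fun p hp hpG => by
    have : p ∉ closure G := fun h => hpG (hcl ⟨h, hp⟩)
    filter_upwards [inter_mem_nhdsWithin F (isClosed_closure.isOpen_compl.mem_nhds this)] with q hq
    exact ⟨hq.1, fun h => hq.2 (subset_closure h)⟩
  have hopen : ∀ b, IsRelOpen {q ∈ F | q ∉ G ∧ s q = b} F := by
    intro b
    refine isRelOpen_of_eventually fun p hp => ?_
    filter_upwards [hs p hp.1 hp.2.1, hG' p hp.1 hp.2.1] with q h1 h2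
    exact ⟨h2.1, h2.2, by rw [h1, hp.2.2]⟩
  -- Only the sign of `t` matters: the point is moved by `δ / 2` in direction `w`, upwards for `t =
  -- 1` and downwards for `t = -1`.
  have hclos : ∀ t : ℝ, t ≠ 0 → ∀ p ∈ G, ∀ U ∈ 𝓝 p, ∃ q ∈ U, q ∈ F ∧ q ∉ G ∧
      (IsAbove G H w q ↔ 0 < t) ∧ (s q = !(s p₀) ↔ IsAbove G H w q) := by
    intro t ht p hp U hU
    obtain ⟨ε, hε, hεU⟩ := Metric.mem_nhdsWithin_iff.1
      (inter_mem (habove p hp) (mem_nhdsWithin_of_mem_nhds hU))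
    obtain ⟨δ, hδ, h⟩ := hcF.lift p (hGF hp) ε hε
    have hpos : 0 < δ / 2 / |t| := by positivity
    obtain ⟨q, hq, hqS, hqp⟩ := h (Function.update p w (p w + δ / 2 / |t| * t)) (by
      intro a ha
      by_cases haw : a = w
      · subst haw
        simp only [Function.update_self, add_sub_cancel_left, abs_mul, abs_of_pos hpos]
        rw [div_mul_cancel₀ _ (abs_ne_zero.2 ht)]; linarith
      · simpa [haw] using hδ)
    have hqw : q w = p w + δ / 2 / |t| * t := by simpa using hqS w (by simp)
    have hqH : ∀ a ∈ H, p a = q a := fun a ha => by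
      rw [hqS a (by simp [ha]), Function.update_of_ne (ne_of_mem_of_not_mem ha hw)]
    have hmem := hεU ⟨hqp, hq⟩
    refine ⟨q, hmem.2, hq, fun hqG => ?_, ?_, hmem.1⟩
    · rw [hsG p hp q hqG hqH] at hqw
      have : δ / 2 / |t| * t ≠ 0 := mul_ne_zero hpos.ne' ht
      exact this (by linarith)
    · rw [isAbove_iff hsG hp hqH, hqw, lt_add_iff_pos_right, mul_pos_iff_of_pos_left hpos]
  refine ⟨{q ∈ F | q ∉ G ∧ s q = !(s p₀)}, {q ∈ F | q ∉ G ∧ s q = s p₀},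
    ⟨hF, hG, hGF, hcl, hopen _, hopen _, ?_, ?_, ?_, ?_⟩, fun p hp => ?_⟩
  · rw [disjoint_left]
    rintro q ⟨-, -, h1⟩ ⟨-, -, h2⟩
    rw [h1] at h2
    revert h2; cases s p₀ <;> simp
  · ext q
    constructor
    · rintro (h | h) <;> exact ⟨h.1, h.2.1⟩
    · rintro ⟨h1, h2⟩
      by_cases h3 : s q = s p₀
      · exact Or.inr ⟨h1, h2, h3⟩
      · exact Or.inl ⟨h1, h2, by revert h3; cases s q <;> cases s p₀ <;> simp⟩
  · intro p hp
    refine mem_closure_iff_nhds.2 fun U hU => ?_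
    obtain ⟨q, hqU, hq, hqG, h1, h2⟩ := hclos 1 one_ne_zero p hp U hU
    exact ⟨q, hqU, hq, hqG, h2.2 (h1.2 one_pos)⟩
  · intro p hp
    refine mem_closure_iff_nhds.2 fun U hU => ?_
    obtain ⟨q, hqU, hq, hqG, h1, h2⟩ := hclos (-1) (by norm_num) p hp U hU
    refine ⟨q, hqU, hq, hqG, ?_⟩
    have h3 : ¬ (s q = !(s p₀)) := fun h => by have := h1.1 (h2.1 h); norm_num at this
    revert h3; cases s q <;> cases s p₀ <;> simp
  · filter_upwards [habove p hp, self_mem_nhdsWithin] with q hq hqF hqG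
    exact ⟨fun h => hq.1 h.2.2, fun h => ⟨hqF, hqG, hq.2 h⟩⟩

/-- Every point of `U` is joined inside `U`, by a section of `F` with fixed `H`-coordinates, to the
level `w = t`; the part of this level over the box is connected. -/
theorem IsCell.isPreconnected_of_level {n : ℕ} {F U : Set (α → ℝ)} (hF : IsCell n F)
    {H : Finset α} {w : α} (p : α → ℝ) (ρ t : ℝ)
    (hlevel : ∀ x ∈ F, (∀ a ∈ H, |x a - p a| < ρ) → x w = t → x ∈ U)
    (hU : ∀ x ∈ U, ∃ K : Set ℝ, K.OrdConnected ∧ x w ∈ K ∧ t ∈ K ∧ x ∈ F ∧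
      (∀ a ∈ H, |x a - p a| < ρ) ∧ (∀ y ∈ F, (∀ a ∈ H, y a = x a) → y w ∈ K → y ∈ U) ∧
      ∃ y ∈ F, (∀ a ∈ H, y a = x a) ∧ y w = t) : IsPreconnected U := by
  refine isPreconnected_of_eventually_eq fun f hf => ?_
  have hsub : ∀ V ⊆ U, IsPreconnected V → ∀ x ∈ V, ∀ y ∈ V, f x = f y := fun V hV hVc x hx y hy =>
    hVc.eq_of_eventually_eq f (fun x hx => (hf x (hV hx)).filter_mono (nhdsWithin_mono _ hV)) hx hy
  have hlev : IsPreconnected {x ∈ F | (∀ a ∈ ({w} : Finset α), x a = (fun _ => t) a) ∧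
      ∀ a ∈ H, x a ∈ Metric.ball (p a) ρ} :=
    hF.isPreconnected_slice {w} H (fun _ => t) fun a _ =>
      ⟨Metric.isOpen_ball, (convex_ball (p a) ρ).isPreconnected.ordConnected⟩
  have hdown : ∀ x ∈ U, ∃ y ∈ {x ∈ F | (∀ a ∈ ({w} : Finset α), x a = (fun _ => t) a) ∧
      ∀ a ∈ H, x a ∈ Metric.ball (p a) ρ}, f x = f y := by
    intro x hx
    obtain ⟨K, hK, hxK, htK, hxF, hxp, hKU, y, hy, hyx, hyt⟩ := hU x hx
    refine ⟨y, ⟨hy, by simpa using hyt, fun a ha => ?_⟩,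
      hsub _ (fun z hz => hKU z hz.1 hz.2.1 hz.2.2) (hF.isPreconnected_slice_interval H x w hK)
        x ⟨hxF, fun _ _ => rfl, hxK⟩ y ⟨hy, hyx, by rwa [hyt]⟩⟩
    rw [Metric.mem_ball, Real.dist_eq, hyx a ha]
    exact hxp a ha
  intro x hx y hy
  obtain ⟨x', hx', hxx⟩ := hdown x hx
  obtain ⟨y', hy', hyy⟩ := hdown y hy
  rw [hxx, hyy]
  refine hsub _ (fun z hz => hlevel z hz.1 (fun a ha => ?_) (hz.2.1 w (by simp))) hlev _ hx' _ hy'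
  rw [← Real.dist_eq]; exact hz.2.2 a ha

theorem IsCut.symm {n : ℕ} {F G A B : Set (α → ℝ)} (h : IsCut n F G A B) : IsCut n F G B A :=
  ⟨h.cell, h.cell_wall, h.subset, h.closed, h.isRelOpen_right, h.isRelOpen_left, h.disjoint.symm,
    by rw [union_comm, h.union_eq], h.subset_closure_right, h.subset_closure_left⟩

theorem IsCut.subset_left {n : ℕ} {F G A B : Set (α → ℝ)} (h : IsCut n F G A B) : A ⊆ F \ G :=
  h.union_eq ▸ subset_union_left

/-- Near `p` the complement of `G` consists of two connected pieces, above and below. Each lies on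
one side of the cut, and both sides occur near `p`, so each side is exactly one piece. The point `q`
over the `H`-coordinates of `p` serves for slicing cuts. -/
theorem IsCut.exists_isPreconnected {n : ℕ} {F G A B : Set (α → ℝ)} (h : IsCut n F G A B)
    {H : Finset α} (hH : H.card = n) (hsG : Separates H G) {p : α → ℝ} (hp : p ∈ G) {ε : ℝ}
    (hε : 0 < ε) : ∃ N, IsOpen N ∧ p ∈ N ∧ N ⊆ Metric.ball p ε ∧ IsPreconnected (A ∩ N) ∧
      ∃ q ∈ A ∩ N, ∀ a ∈ H, q a = p a := by
  obtain ⟨w, hw, hsF⟩ := h.cell_wall.exists_separates_insert h.cell h.subset hH hsG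
  have hcF : IsChart F (insert w H) :=
    h.cell.isChart (by rw [Finset.card_insert_of_notMem hw, hH]) hsF
  have hcG : IsChart G H := h.cell_wall.isChart hH hsG
  obtain ⟨δ, hδ, hlF⟩ := hcF.lift p (h.subset hp) ε hε
  obtain ⟨δ', hδ', hlG⟩ := hcG.lift p hp (δ / 2) (half_pos hδ)
  set ρ := min δ δ' with hρdef
  have hρ : 0 < ρ := lt_min hδ hδ'
  set N : Set (α → ℝ) := Metric.ball p ε ∩
    {x | ∀ a ∈ insert w H, x a ∈ Metric.ball (p a) (if a = w then δ else ρ)} with hN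
  have hNo : IsOpen N := Metric.isOpen_ball.inter (isOpen_forall_mem fun a _ => Metric.isOpen_ball)
  have hpN : p ∈ N := ⟨Metric.mem_ball_self hε, fun a _ => Metric.mem_ball_self (by split_ifs <;> assumption)⟩
  have hNw : ∀ x ∈ N, |x w - p w| < δ := fun x hx => by
    have := hx.2 w (by simp); rwa [if_pos rfl, Metric.mem_ball, Real.dist_eq] at this
  have hNH : ∀ x ∈ N, ∀ a ∈ H, |x a - p a| < ρ := fun x hx a ha => by
    have := hx.2 a (by simp [ha])
    rwa [if_neg (ne_of_mem_of_not_mem ha hw), Metric.mem_ball, Real.dist_eq] at this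
  have hlift : ∀ k : α → ℝ, (∀ a ∈ H, |k a - p a| < ρ) → |k w - p w| < δ →
      ∃ q ∈ F ∩ N, ∀ a ∈ insert w H, q a = k a := by
    intro k hk hkw
    obtain ⟨q, hq, hqk, hqp⟩ := hlF k fun a ha => by
      rcases Finset.mem_insert.1 ha with rfl | ha
      · exact hkw
      · exact (hk a ha).trans_le (min_le_left _ _)
    refine ⟨q, ⟨hq, hqp, fun a ha => ?_⟩, hqk⟩
    rw [Metric.mem_ball, Real.dist_eq, hqk a ha]
    split_ifs with haw
    · rw [haw]; exact hkw
    · exact hk a (Finset.mem_of_mem_insert_of_ne ha haw)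
  have hFN : ∀ x ∈ F, (∀ a ∈ H, |x a - p a| < ρ) → |x w - p w| < δ → x ∈ N := by
    intro x hx h1 h2
    obtain ⟨q, hq, hqx⟩ := hlift x h1 h2
    rw [hsF x hx q hq.1 fun a ha => (hqx a ha).symm]
    exact hq.2
  have hwall : ∀ k : α → ℝ, (∀ a ∈ H, |k a - p a| < ρ) → ∃ g ∈ G, (∀ a ∈ H, g a = k a) ∧
      |g w - p w| < δ / 2 := by
    intro k hk
    obtain ⟨g, hg, hgk, hgp⟩ := hlG k fun a ha => (hk a ha).trans_le (min_le_right _ _)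
    exact ⟨g, hg, hgk, (abs_sub_le_dist g p w).trans_lt hgp⟩
  have hreach : ∀ x : α → ℝ, (∀ a ∈ H, |x a - p a| < ρ) → ∀ t, |t - p w| < δ →
      ∃ y ∈ F ∩ N, (∀ a ∈ H, y a = x a) ∧ y w = t := by
    intro x hx t ht
    obtain ⟨y, hy, hyx⟩ := hlift (Function.update x w t)
      (fun a ha => by rw [Function.update_of_ne (ne_of_mem_of_not_mem ha hw)]; exact hx a ha)
      (by simpa using ht)
    refine ⟨y, hy, fun a ha => ?_, by simpa using hyx w (by simp)⟩
    rw [hyx a (by simp [ha]), Function.update_of_ne (ne_of_mem_of_not_mem ha hw)]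
  set P : Set (α → ℝ) := {x ∈ F ∩ N | IsAbove G H w x} with hPdef
  set Q : Set (α → ℝ) := {x ∈ F ∩ N | x ∉ G ∧ ¬ IsAbove G H w x} with hQdef
  -- In the box the wall stays within `δ / 2` of `p w`, while `w` ranges up to distance `δ`. The
  -- levels at distance `3 / 4 * δ` thus lie strictly between.
  have habs : |p w + 3 / 4 * δ - p w| < δ ∧ |p w - 3 / 4 * δ - p w| < δ := by
    constructor <;> rw [abs_lt] <;> constructor <;> linarith
  have hP : IsPreconnected P := by
    refine h.cell.isPreconnected_of_level p ρ (p w + 3 / 4 * δ) (H := H) (w := w)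
      (fun x hx hxp hxw => ?_) fun x hx => ?_
    · obtain ⟨g, hg, hgx, hgw⟩ := hwall x hxp
      refine ⟨⟨hx, hFN x hx hxp (by rw [hxw]; exact habs.1)⟩, g, hg, hgx, ?_⟩
      linarith [(abs_lt.1 hgw).2]
    · have hxp := hNH x hx.1.2
      have hxw := hNw x hx.1.2
      obtain ⟨g, hg, hgx, hgw⟩ := hwall x hxp
      rw [abs_lt] at hxw hgw
      have hxg := (isAbove_iff hsG hg hgx).1 hx.2
      refine ⟨Ioo (g w) (p w + δ), ordConnected_Ioo, ⟨hxg, by linarith⟩,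
        ⟨by linarith, by linarith⟩, hx.1.1, hxp, fun y hy hyx hyw => ?_, ?_⟩
      · refine ⟨⟨hy, hFN y hy (fun a ha => by rw [hyx a ha]; exact hxp a ha) ?_⟩, g, hg,
          fun a ha => by rw [hgx a ha, hyx a ha], hyw.1⟩
        rw [abs_lt]; constructor <;> linarith [hyw.1, hyw.2]
      · obtain ⟨y, hy, hyx, hyw⟩ := hreach x hxp _ habs.1
        exact ⟨y, hy.1, hyx, hyw⟩
  have hQ : IsPreconnected Q := by
    refine h.cell.isPreconnected_of_level p ρ (p w - 3 / 4 * δ) (H := H) (w := w)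
      (fun x hx hxp hxw => ?_) fun x hx => ?_
    · obtain ⟨g, hg, hgx, hgw⟩ := hwall x hxp
      have hlt : x w < g w := by linarith [(abs_lt.1 hgw).1]
      refine ⟨⟨hx, hFN x hx hxp (by rw [hxw]; exact habs.2)⟩, fun hxG => ?_, ?_⟩
      · rw [hsG g hg x hxG hgx] at hlt; exact lt_irrefl _ hlt
      · rw [isAbove_iff hsG hg hgx]; exact hlt.not_gt
    · have hxp := hNH x hx.1.2
      have hxw := hNw x hx.1.2
      obtain ⟨g, hg, hgx, hgw⟩ := hwall x hxp
      rw [abs_lt] at hxw hgw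
      have hxg : x w < g w := by
        refine lt_of_le_of_ne (not_lt.1 ((isAbove_iff hsG hg hgx).not.1 hx.2.2)) fun he => hx.2.1 ?_
        rw [hsF x hx.1.1 g (h.subset hg) fun a ha => ?_]
        · exact hg
        · rcases Finset.mem_insert.1 ha with rfl | ha
          · exact he
          · exact (hgx a ha).symm
      refine ⟨Ioo (p w - δ) (g w), ordConnected_Ioo, ⟨by linarith, hxg⟩,
        ⟨by linarith, by linarith⟩, hx.1.1, hxp, fun y hy hyx hyw => ?_, ?_⟩
      · have hgy : ∀ a ∈ H, g a = y a := fun a ha => by rw [hgx a ha, hyx a ha]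
        refine ⟨⟨hy, hFN y hy (fun a ha => by rw [hyx a ha]; exact hxp a ha) ?_⟩,
          fun hyG => ?_, ?_⟩
        · rw [abs_lt]; constructor <;> linarith [hyw.1, hyw.2]
        · rw [hsG g hg y hyG hgy] at hyw; exact lt_irrefl _ hyw.2
        · rw [isAbove_iff hsG hg hgy]; exact hyw.2.not_gt
      · obtain ⟨y, hy, hyx, hyw⟩ := hreach x hxp _ habs.2
        exact ⟨y, hy.1, hyx, hyw⟩
  have hPG : ∀ x ∈ P, x ∉ G := fun x hx hxG =>
    lt_irrefl _ ((isAbove_iff hsG hxG fun _ _ => rfl).1 hx.2)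
  have hpP : ∃ q ∈ P, ∀ a ∈ H, q a = p a := by
    obtain ⟨q, hq, hqp, hqw⟩ := hreach p (fun a _ => by simpa using hρ) _ habs.1
    exact ⟨q, ⟨hq, p, hp, fun a ha => (hqp a ha).symm, by linarith⟩, hqp⟩
  have hpQ : ∃ q ∈ Q, ∀ a ∈ H, q a = p a := by
    obtain ⟨q, hq, hqp, hqw⟩ := hreach p (fun a _ => by simpa using hρ) _ habs.2
    have hlt : q w < p w := by linarith
    refine ⟨q, ⟨hq, fun hqG => ?_, ?_⟩, hqp⟩
    · rw [hsG q hqG p hp hqp] at hlt; exact lt_irrefl _ hlt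
    · rw [isAbove_iff hsG hp fun a ha => (hqp a ha).symm]; exact hlt.not_gt
  have hcover : ∀ x ∈ F ∩ N, x ∉ G → x ∈ P ∨ x ∈ Q := fun x hx hxG => by
    by_cases ha : IsAbove G H w x
    · exact Or.inl ⟨hx, ha⟩
    · exact Or.inr ⟨hx, hxG, ha⟩
  have hside : ∀ V ⊆ F ∩ N, (∀ x ∈ V, x ∉ G) → IsPreconnected V → V ⊆ A ∨ V ⊆ B := by
    intro V hV hVG hVc
    refine hVc.subset_or_subset_of_isRelOpen (fun x hx => (hV hx).1) (fun x hx => ?_)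
      h.isRelOpen_left h.isRelOpen_right h.disjoint
    rw [h.union_eq]
    exact ⟨(hV hx).1, hVG x hx⟩
  have hAF : A ⊆ F \ G := h.subset_left
  have hBF : B ⊆ F \ G := h.symm.subset_left
  obtain ⟨a, haN, haA⟩ := mem_closure_iff_nhds.1 (h.subset_closure_left hp) N (hNo.mem_nhds hpN)
  obtain ⟨b, hbN, hbB⟩ := mem_closure_iff_nhds.1 (h.subset_closure_right hp) N (hNo.mem_nhds hpN)
  have hres : ∀ V W : Set (α → ℝ), V ⊆ A → W ⊆ B → V ⊆ N → (∀ x ∈ F ∩ N, x ∉ G → x ∈ V ∨ x ∈ W) →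
      A ∩ N = V := by
    intro V W hV hW hVN hVW
    refine subset_antisymm (fun x hx => ?_) (subset_inter hV hVN)
    exact (hVW x ⟨(hAF hx.1).1, hx.2⟩ (hAF hx.1).2).resolve_right
      fun hxW => disjoint_left.1 h.disjoint hx.1 (hW hxW)
  rcases hside P (fun x hx => hx.1) hPG hP with hPA | hPB <;>
    rcases hside Q (fun x hx => hx.1) (fun x hx => hx.2.1) hQ with hQA | hQB
  · exfalso
    have := hcover b ⟨(hBF hbB).1, hbN⟩ (hBF hbB).2
    exact disjoint_left.1 h.disjoint (this.elim (fun h => hPA h) fun h => hQA h) hbB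
  · have he := hres P Q hPA hQB (fun x hx => hx.1.2) hcover
    exact ⟨N, hNo, hpN, inter_subset_left, by rwa [he], by rwa [he]⟩
  · have he := hres Q P hQA hPB (fun x hx => hx.1.2) fun x hx hxG => (hcover x hx hxG).symm
    exact ⟨N, hNo, hpN, inter_subset_left, by rwa [he], by rwa [he]⟩
  · exfalso
    have := hcover a ⟨(hAF haA).1, haN⟩ (hAF haA).2
    exact disjoint_left.1 h.disjoint haA (this.elim (fun h => hPB h) fun h => hQB h)

/-- Near a point of `G` the side `A` is connected, so a locally constant function on `A ∩ O` has one
value there. This value is the same along the connected set `G ∩ O`. Giving it to all points outside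
`A` extends the function to `F ∩ O`. -/
theorem IsCut.isPreconnected_inter_open {n : ℕ} {F G A B : Set (α → ℝ)} (h : IsCut n F G A B)
    {O : Set (α → ℝ)} (hO : IsOpen O) (hFO : IsPreconnected (F ∩ O))
    (hGO : IsPreconnected (G ∩ O)) : IsPreconnected (A ∩ O) := by
  classical
  have hAF : A ⊆ F \ G := h.subset_left
  by_cases hne : (G ∩ O).Nonempty
  swap
  · rcases hFO.subset_or_subset_of_isRelOpen inter_subset_left (fun x hx => by
      rw [h.union_eq]; exact ⟨hx.1, fun hxG => hne ⟨x, hxG, hx.2⟩⟩)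
      h.isRelOpen_left h.isRelOpen_right h.disjoint with hA | hB
    · rwa [subset_antisymm (inter_subset_inter_left O fun x hx => (hAF hx).1)
        (subset_inter hA inter_subset_right)]
    · convert isPreconnected_empty using 1
      exact eq_empty_of_forall_notMem fun x hx =>
        disjoint_left.1 h.disjoint hx.1 (hB ⟨(hAF hx.1).1, hx.2⟩)
  obtain ⟨S, hS⟩ := id h.cell_wall
  refine isPreconnected_of_eventually_eq fun f hf => ?_
  have hloc : ∀ p ∈ G ∩ O, ∃ N, IsOpen N ∧ p ∈ N ∧ ∃ b, ∀ x ∈ A ∩ N, f x = b := by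
    rintro p ⟨hp, hpO⟩
    obtain ⟨ε, hε, hεO⟩ := Metric.isOpen_iff.1 hO p hpO
    obtain ⟨N, hN, hpN, hNε, hAN, q, hq, -⟩ :=
      h.exists_isPreconnected hS.base.card hS.base.chart.separates hp hε
    have hsub : A ∩ N ⊆ A ∩ O := inter_subset_inter_right A (hNε.trans hεO)
    refine ⟨N, hN, hpN, f q, fun x hx => hAN.eq_of_eventually_eq f (fun y hy => ?_) hx hq⟩
    exact (hf y (hsub hy)).filter_mono (nhdsWithin_mono _ hsub)
  have hval : ∃ v : (α → ℝ) → Bool, ∀ p ∈ G ∩ O, ∃ N, IsOpen N ∧ p ∈ N ∧ ∀ x ∈ A ∩ N, f x = v p := by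
    have : ∀ p, ∃ b, p ∈ G ∩ O → ∃ N, IsOpen N ∧ p ∈ N ∧ ∀ x ∈ A ∩ N, f x = b := by
      intro p
      by_cases hp : p ∈ G ∩ O
      · obtain ⟨N, h1, h2, b, hb⟩ := hloc p hp
        exact ⟨b, fun _ => ⟨N, h1, h2, hb⟩⟩
      · exact ⟨true, fun h => absurd h hp⟩
    choose v hv using this
    exact ⟨v, hv⟩
  obtain ⟨v, hv⟩ := hval
  obtain ⟨p₀, hp₀⟩ := hne
  have hconst : ∀ p ∈ G ∩ O, v p = v p₀ := fun p hp => by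
    refine hGO.eq_of_eventually_eq v (fun p hp => ?_) hp hp₀
    obtain ⟨N, hN, hpN, hNv⟩ := hv p hp
    filter_upwards [inter_mem_nhdsWithin _ (hN.mem_nhds hpN)] with q hq
    obtain ⟨N', hN', hqN', hNv'⟩ := hv q hq.1
    obtain ⟨x, hx, hxA⟩ := mem_closure_iff_nhds.1 (h.subset_closure_left hq.1.1) _
      ((hN.inter hN').mem_nhds ⟨hq.2, hqN'⟩)
    rw [← hNv x ⟨hxA, hx.1⟩, ← hNv' x ⟨hxA, hx.2⟩]
  have hglob : ∀ x ∈ F ∩ O, ∀ y ∈ F ∩ O,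
      (if x ∈ A then f x else v p₀) = if y ∈ A then f y else v p₀ := by
    intro x hx y hy
    refine hFO.eq_of_eventually_eq (fun x => if x ∈ A then f x else v p₀) (fun x hx => ?_) hx hy
    have hFO' : F ∩ O ⊆ F := inter_subset_left
    by_cases hxG : x ∈ G
    · obtain ⟨N, hN, hxN, hNv⟩ := hv x ⟨hxG, hx.2⟩
      have hxA : x ∉ A := fun hxA => (hAF hxA).2 hxG
      filter_upwards [mem_nhdsWithin_of_mem_nhds (hN.mem_nhds hxN)] with y hyN
      rw [if_neg hxA]
      split_ifs with hyA
      · rw [hNv y ⟨hyA, hyN⟩, hconst x ⟨hxG, hx.2⟩]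
      · rfl
    · have : x ∈ A ∪ B := by rw [h.union_eq]; exact ⟨hx.1, hxG⟩
      rcases this with hxA | hxB
      · have h1 : ∀ᶠ y in 𝓝[F ∩ O] x, y ∈ A ∩ O :=
          ((h.isRelOpen_left.eventually hxA).filter_mono (nhdsWithin_mono _ hFO')).and
            (mem_nhdsWithin_of_mem_nhds (hO.mem_nhds hx.2))
        have h2 : ∀ᶠ y in 𝓝[F ∩ O] x, y ∈ A ∩ O → f y = f x := by
          have := eventually_nhdsWithin_iff.1 (hf x ⟨hxA, hx.2⟩)
          exact this.filter_mono nhdsWithin_le_nhds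
        filter_upwards [h1, h2] with y hy1 hy2
        rw [if_pos hy1.1, if_pos hxA, hy2 hy1]
      · filter_upwards [(h.isRelOpen_right.eventually hxB).filter_mono (nhdsWithin_mono _ hFO')]
          with y hy
        rw [if_neg fun hA => disjoint_left.1 h.disjoint hA hy,
          if_neg fun hA => disjoint_left.1 h.disjoint hA hxB]
  intro x hx y hy
  have := hglob x ⟨(hAF hx.1).1, hx.2⟩ y ⟨(hAF hy.1).1, hy.2⟩
  rwa [if_pos hx.1, if_pos hy.1] at this

/-- Only the accumulation at the sliced wall needs an argument. A basis of `G` containing `z`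
exists, and points of each side can be found near `p` with the same coordinates in this basis, in
particular in the slice. -/
theorem IsCut.coordSlice {n : ℕ} {F G A B : Set (α → ℝ)} (h : IsCut (n + 1) F G A B) {z : α}
    (hz : ¬ IsConstCoord G z) {c : ℝ} (hne : (coordSlice G z c).Nonempty) :
    IsCut n (coordSlice F z c) (coordSlice G z c) (coordSlice A z c) (coordSlice B z c) where
  cell := h.cell.fiber (not_isConstCoord_mono h.subset hz) (hne.mono (coordSlice_mono h.subset z c))
  cell_wall := h.cell_wall.fiber hz hne
  subset := coordSlice_mono h.subset z c
  closed x hx := ⟨h.closed ⟨closure_mono (coordSlice_subset G z c) hx.1, hx.2.1⟩, hx.2.2⟩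
  isRelOpen_left := h.isRelOpen_left.fiber z c
  isRelOpen_right := h.isRelOpen_right.fiber z c
  disjoint := h.disjoint.mono (coordSlice_subset _ _ _) (coordSlice_subset _ _ _)
  union_eq := by
    ext x
    have := Set.ext_iff.1 h.union_eq x
    simp only [mem_union, Set.mem_sdiff] at this
    simp only [_root_.coordSlice, mem_union, Set.mem_sdiff, mem_ofPred_eq]
    tauto
  subset_closure_left := by
    obtain ⟨H, hH, hzH, hs⟩ := h.cell_wall.exists_separates hz
    intro p hp
    refine Metric.mem_closure_iff.2 fun ε hε => ?_
    obtain ⟨N, -, -, hNε, -, q, hq, hqp⟩ := h.exists_isPreconnected hH hs hp.1 hε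
    refine ⟨q, ⟨hq.1, (hqp z hzH).trans hp.2⟩, ?_⟩
    rw [dist_comm]; exact hNε hq.2
  subset_closure_right := by
    obtain ⟨H, hH, hzH, hs⟩ := h.cell_wall.exists_separates hz
    intro p hp
    refine Metric.mem_closure_iff.2 fun ε hε => ?_
    obtain ⟨N, -, -, hNε, -, q, hq, hqp⟩ := h.symm.exists_isPreconnected hH hs hp.1 hε
    refine ⟨q, ⟨hq.1, (hqp z hzH).trans hp.2⟩, ?_⟩
    rw [dist_comm]; exact hNε hq.2

/-- The intersection of a side of a cut with a coordinate cone is connected. -/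
theorem IsCut.isPreconnected_cone {n : ℕ} {F G A B : Set (α → ℝ)} (h : IsCut n F G A B)
    (T O : Finset α) (c : α → ℝ) {I : α → Set ℝ} (hI : ∀ a ∈ O, IsOpen (I a) ∧ (I a).OrdConnected) :
    IsPreconnected {x ∈ A | (∀ a ∈ T, x a = c a) ∧ ∀ a ∈ O, x a ∈ I a} := by
  induction T using Finset.induction_on generalizing n F G A B with
  | empty =>
    convert h.isPreconnected_inter_open (isOpen_forall_mem fun a ha => (hI a ha).1)
      (h.cell.isPreconnected_inter_box O hI) (h.cell_wall.isPreconnected_inter_box O hI) using 1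
    ext x; simp
  | insert z T _ ih =>
    have hAF : A ⊆ F \ G := h.subset_left
    -- If the section of `F` misses the wall, it is connected and lies on one side.
    by_cases hne : ∃ p ∈ G, (∀ a ∈ insert z T, p a = c a) ∧ ∀ a ∈ O, p a ∈ I a
    swap
    · rcases (h.cell.isPreconnected_slice (insert z T) O c hI).subset_or_subset_of_isRelOpen
        (fun x hx => hx.1) (fun x hx => by
          rw [h.union_eq]; exact ⟨hx.1, fun hxG => hne ⟨x, hxG, hx.2⟩⟩)
        h.isRelOpen_left h.isRelOpen_right h.disjoint with hA | hB
      · convert h.cell.isPreconnected_slice (insert z T) O c hI using 1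
        exact subset_antisymm (fun x hx => ⟨(hAF hx.1).1, hx.2⟩) fun x hx => ⟨hA hx, hx.2⟩
      · convert isPreconnected_empty using 1
        exact eq_empty_of_forall_notMem fun x hx =>
          disjoint_left.1 h.disjoint hx.1 (hB ⟨(hAF hx.1).1, hx.2⟩)
    obtain ⟨p, hp, hpT, hpO⟩ := hne
    have hpz : p z = c z := hpT z (by simp)
    by_cases hzF : IsConstCoord F z
    · convert ih h using 1
      ext x
      refine and_congr_right fun hx => and_congr_left fun _ => ?_
      rw [Finset.forall_mem_insert, and_iff_right]
      rw [← hpz]; exact hzF x (hAF hx).1 p (h.subset hp)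
    -- If `z` is constant on `G` but not on `F`, then `G` is closed in the slice of `F` and of the
    -- same dimension, so it is the whole slice and `A` does not meet it.
    by_cases hzG : IsConstCoord G z
    · have hc := h.cell.fiber hzF (c := c z) ⟨p, h.subset hp, hpz⟩
      have he := h.cell_wall.eq_of_subset hc
        (fun x hx => ⟨h.subset hx, (hzG x hx p hp).trans hpz⟩) fun x hx => h.closed ⟨hx.1, hx.2.1⟩
      convert isPreconnected_empty using 1
      refine eq_empty_of_forall_notMem fun x hx => (hAF hx.1).2 ?_
      rw [he]
      exact ⟨(hAF hx.1).1, hx.2.1 z (by simp)⟩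
    cases n with
    | zero => exact absurd (fun p hp q hq => by rw [h.cell_wall.subsingleton hp hq]) hzG
    | succ n =>
      convert ih (h.coordSlice hzG (c := c z) ⟨p, hp, hpz⟩) using 1
      ext x
      simp only [_root_.coordSlice, Finset.forall_mem_insert, mem_ofPred_eq]
      tauto

end Cuts

/-! ### Definability of the sides -/

section Definability

variable {L : FirstOrder.Language.{u, v}} [L.Structure ℝ] {α β : Type}

namespace DefinableSet

theorem and {P Q : (α → ℝ) → Prop} (hP : DefinableSet L {x | P x}) (hQ : DefinableSet L {x | Q x}) :
    DefinableSet L {x | P x ∧ Q x} :=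
  Set.Definable.inter hP hQ

theorem or {P Q : (α → ℝ) → Prop} (hP : DefinableSet L {x | P x}) (hQ : DefinableSet L {x | Q x}) :
    DefinableSet L {x | P x ∨ Q x} :=
  Set.Definable.union hP hQ

theorem not {P : (α → ℝ) → Prop} (hP : DefinableSet L {x | P x}) : DefinableSet L {x | ¬ P x} :=
  Set.Definable.compl hP

theorem comp {s : Set (α → ℝ)} (hs : DefinableSet L s) (i : α → β) :
    DefinableSet L {x : β → ℝ | x ∘ i ∈ s} :=
  Set.Definable.preimage_comp i hs

theorem exists_real [Finite α] [Finite β] {R : (α → ℝ) → (β → ℝ) → Prop}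
    (hR : DefinableSet L {x : α ⊕ β → ℝ | R (x ∘ Sum.inl) (x ∘ Sum.inr)}) :
    DefinableSet L {x | ∃ y, R x y} := by
  have : DefinableSet L _ := Set.Definable.image_comp hR (Sum.inl : α → α ⊕ β)
  convert this using 1
  ext x
  constructor
  · rintro ⟨y, hy⟩
    exact ⟨Sum.elim x y, by simpa using hy, by simp⟩
  · rintro ⟨z, hz, rfl⟩
    exact ⟨_, hz⟩

theorem eq_coord (a b : α) : DefinableSet L {x : α → ℝ | x a = x b} := by
  refine ⟨(FirstOrder.Language.Term.var a).equal (FirstOrder.Language.Term.var b), ?_⟩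
  ext v
  simp [FirstOrder.Language.Formula.realize_equal]

theorem eq_const (a : α) (c : ℝ) : DefinableSet L {x : α → ℝ | x a = c} := by
  refine ⟨(FirstOrder.Language.Term.var a).equal
    (L.con (⟨c, trivial⟩ : (univ : Set ℝ))).term, ?_⟩
  ext v
  simp [FirstOrder.Language.Formula.realize_equal]

theorem forall_eq_coord (T : Finset β) (i j : β → α) :
    DefinableSet L {x : α → ℝ | ∀ a ∈ T, x (i a) = x (j a)} := by
  have : DefinableSet L _ := Set.definable_biInter_finset (A := univ) (L := L)
    (f := fun a => {x : α → ℝ | x (i a) = x (j a)}) (fun a => eq_coord (i a) (j a)) T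
  convert this using 1
  ext x; simp

/-- The order is defined from the field operations: the difference is a square, and the two
coordinates differ. -/
theorem lt_coord (hL : IsOMinimalOverReals L) (a b : α) :
    DefinableSet L {x : α → ℝ | x a < x b} := by
  have h : DefinableSet L {x : Fin 4 → ℝ | (x 0 + x 2 = x 1 ∧ x 3 * x 3 = x 2) ∧ ¬ x 0 = x 1} :=
    ((hL.definable_add.comp ![0, 2, 1]).and (hL.definable_mul.comp ![3, 3, 2])).and
      (eq_coord 0 1).not
  have h2 : DefinableSet L _ := Set.Definable.image_comp h (![0, 1] : Fin 2 → Fin 4)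
  have h3 : DefinableSet L {x : Fin 2 → ℝ | x 0 < x 1} := by
    convert h2 using 1
    ext x
    constructor
    · intro hx
      have hx' : x 0 < x 1 := hx
      refine ⟨![x 0, x 1, x 1 - x 0, √(x 1 - x 0)], ?_, ?_⟩
      · refine ⟨⟨?_, ?_⟩, hx'.ne⟩
        · simp
        · simp [Real.mul_self_sqrt (sub_nonneg.2 hx'.le)]
      · ext i; fin_cases i <;> simp
    · rintro ⟨y, ⟨⟨h1, h2⟩, h3⟩, rfl⟩
      have : 0 ≤ y 2 := h2 ▸ mul_self_nonneg _
      exact lt_of_le_of_ne (by change y 0 ≤ y 1; linarith) h3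
  exact h3.comp ![a, b]

theorem le_coord (hL : IsOMinimalOverReals L) (a b : α) :
    DefinableSet L {x : α → ℝ | x a ≤ x b} := by
  simpa only [not_lt] using (lt_coord hL b a).not

end DefinableSet

variable [Fintype α] [DecidableEq α]

/-- The points of `F` joined to a point of `D` by a section of `F` by a coordinate subspace and a
strip, on which there are no points of `G`. -/
def linkTo (F G D : Set (α → ℝ)) (T : Finset α) (z : α) : Set (α → ℝ) :=
  {p | p ∈ F ∧ ∃ q, q ∈ D ∧ (∀ a ∈ T, p a = q a) ∧
    ¬ ∃ g, g ∈ G ∧ (∀ a ∈ T, g a = p a) ∧ g z ∈ uIcc (p z) (q z)}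

theorem definable_linkTo (hL : IsOMinimalOverReals L) {F G D : Set (α → ℝ)}
    (hF : DefinableSet L F) (hG : DefinableSet L G) (hD : DefinableSet L D) (T : Finset α) (z : α) :
    DefinableSet L (linkTo F G D T z) := by
  refine hF.and (DefinableSet.exists_real ((hD.comp Sum.inr).and
    ((DefinableSet.forall_eq_coord T Sum.inl Sum.inr).and (DefinableSet.not ?_))))
  refine DefinableSet.exists_real (α := α ⊕ α) (β := α) (R := fun x g => g ∈ G ∧
    (∀ a ∈ T, g a = x (Sum.inl a)) ∧ g z ∈ uIcc (x (Sum.inl z)) (x (Sum.inr z))) ?_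
  refine (hG.comp Sum.inr).and ((DefinableSet.forall_eq_coord T Sum.inr (Sum.inl ∘ Sum.inl)).and ?_)
  simp only [mem_uIcc]
  exact ((DefinableSet.le_coord hL _ _).and (DefinableSet.le_coord hL _ _)).or
    ((DefinableSet.le_coord hL _ _).and (DefinableSet.le_coord hL _ _))

/-- The section of `F` joining the two points is connected and avoids `G`, so it stays on one side.
-/
theorem IsCut.mem_of_mem_link {n : ℕ} {F G A B : Set (α → ℝ)} (h : IsCut n F G A B) {T : Finset α}
    {z : α} {p q : α → ℝ} (hp : p ∈ F) (hq : q ∈ F) (hpq : ∀ a ∈ T, p a = q a)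
    (hG : ¬ ∃ g, g ∈ G ∧ (∀ a ∈ T, g a = p a) ∧ g z ∈ uIcc (p z) (q z)) : p ∈ A ↔ q ∈ A := by
  have hp' : p ∈ {x ∈ F | (∀ a ∈ T, x a = p a) ∧ x z ∈ uIcc (p z) (q z)} :=
    ⟨hp, fun _ _ => rfl, left_mem_uIcc⟩
  have hq' : q ∈ {x ∈ F | (∀ a ∈ T, x a = p a) ∧ x z ∈ uIcc (p z) (q z)} :=
    ⟨hq, fun a ha => (hpq a ha).symm, right_mem_uIcc⟩
  rcases (h.cell.isPreconnected_slice_interval T p z ordConnected_uIcc).subset_or_subset_of_isRelOpen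
    (fun x hx => hx.1) (fun x hx => by
      rw [h.union_eq]; exact ⟨hx.1, fun hxG => hG ⟨x, hxG, hx.2⟩⟩)
    h.isRelOpen_left h.isRelOpen_right h.disjoint with hA | hB
  · exact iff_of_true (hA hp') (hA hq')
  · exact iff_of_false (fun hA => disjoint_left.1 h.disjoint hA (hB hp'))
      fun hA => disjoint_left.1 h.disjoint hA (hB hq')

/-- The description of `A` near `G` persists along the whole line in direction `w`: this line meets
`G` only at `g`, so `p` is linked to a point `q` close to `g`. -/
theorem IsCut.mem_iff_isAbove {n : ℕ} {F G A B : Set (α → ℝ)} (h : IsCut n F G A B)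
    {H : Finset α} (hH : H.card = n) (hsG : Separates H G) {w : α} (hw : w ∉ H)
    (hsF : Separates (insert w H) F)
    (hA : ∀ p ∈ G, ∀ᶠ q in 𝓝[F] p, q ∉ G → (q ∈ A ↔ IsAbove G H w q)) {p g : α → ℝ}
    (hp : p ∈ F) (hpG : p ∉ G) (hg : g ∈ G) (hgp : ∀ a ∈ H, g a = p a) :
    p ∈ A ↔ IsAbove G H w p := by
  have hcF : IsChart F (insert w H) :=
    h.cell.isChart (by rw [Finset.card_insert_of_notMem hw, hH]) hsF
  have hne : p w ≠ g w := fun he => hpG <| by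
    rw [hsF p hp g (h.subset hg) fun a ha => ?_]
    · exact hg
    · rcases Finset.mem_insert.1 ha with rfl | ha
      · exact he
      · exact (hgp a ha).symm
  obtain ⟨ε, hε, hεA⟩ := Metric.mem_nhdsWithin_iff.1 (hA g hg)
  obtain ⟨δ, hδ, hl⟩ := hcF.lift g (h.subset hg) ε hε
  -- With this factor `q` lies between `g` and `p` in the coordinate `w`, and within `δ / 2` of `g`.
  have ht : 0 < min 1 (δ / 2 / |p w - g w|) :=
    lt_min one_pos (div_pos (half_pos hδ) (abs_pos.2 (sub_ne_zero.2 hne)))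
  set t := min 1 (δ / 2 / |p w - g w|) with htdef
  obtain ⟨q, hq, hqS, hqg⟩ := hl (Function.update g w (g w + t * (p w - g w))) (by
    intro a _
    by_cases haw : a = w
    · subst haw
      rw [Function.update_self, add_sub_cancel_left, abs_mul, abs_of_pos ht]
      have : t * |p a - g a| ≤ δ / 2 / |p a - g a| * |p a - g a| :=
        mul_le_mul_of_nonneg_right (min_le_right _ _) (abs_nonneg _)
      rw [div_mul_cancel₀ _ (abs_ne_zero.2 (sub_ne_zero.2 hne))] at this
      linarith
    · simpa [haw] using hδ)
  have hqw : q w = g w + t * (p w - g w) := by simpa using hqS w (by simp)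
  have hqH : ∀ a ∈ H, q a = g a := fun a ha => by
    rw [hqS a (by simp [ha]), Function.update_of_ne (ne_of_mem_of_not_mem ha hw)]
  have hgq : g w ∉ uIcc (p w) (q w) := by
    have h1 : t ≤ 1 := min_le_left _ _
    rw [mem_uIcc, hqw]
    rcases lt_or_gt_of_ne hne with h | h
    · rintro (h' | h')
      · nlinarith [h'.2]
      · linarith [h'.2]
    · rintro (h' | h')
      · linarith [h'.1]
      · nlinarith [h'.1]
  have hqG : q ∉ G := fun hqG => by
    rw [hsG q hqG g hg hqH] at hgq; exact hgq right_mem_uIcc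
  have h1 : p ∈ A ↔ q ∈ A := by
    refine h.mem_of_mem_link (T := H) (z := w) hp hq
      (fun a ha => by rw [hqH a ha, hgp a ha]) ?_
    rintro ⟨g', hg', hgp', hw'⟩
    rw [hsG g' hg' g hg fun a ha => (hgp' a ha).trans (hgp a ha).symm] at hw'
    exact hgq hw'
  have h2 : q ∈ A ↔ IsAbove G H w q := hεA ⟨hqg, hq⟩ hqG
  rw [h1, h2, isAbove_iff hsG hg hgp, isAbove_iff hsG hg fun a ha => (hqH a ha).symm, hqw,
    lt_add_iff_pos_right, mul_pos_iff_of_pos_left ht, sub_pos]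

/-- Membership in `A` is definable where `p` and `G` agree on `H`, and the coordinates required to
agree are dropped one at a time. For `R = H` the set `D` is all of `A`. -/
theorem IsCut.exists_definable_between (hL : IsOMinimalOverReals L) {n : ℕ}
    {F G A B : Set (α → ℝ)} (h : IsCut n F G A B) (hF : DefinableSet L F) (hG : DefinableSet L G)
    {H : Finset α} (hH : H.card = n) (hsG : Separates H G) {w : α} (hw : w ∉ H)
    (hsF : Separates (insert w H) F)
    (hA : ∀ p ∈ G, ∀ᶠ q in 𝓝[F] p, q ∉ G → (q ∈ A ↔ IsAbove G H w q)) (R : Finset α) :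
    ∃ D, DefinableSet L D ∧ D ⊆ A ∧ ∀ p ∈ A, (∃ g ∈ G, ∀ a ∈ H \ R, g a = p a) → p ∈ D := by
  have hAF : A ⊆ F \ G := h.subset_left
  have hcF : IsChart F (insert w H) :=
    h.cell.isChart (by rw [Finset.card_insert_of_notMem hw, hH]) hsF
  have hcG : IsChart G H := h.cell_wall.isChart hH hsG
  have hnot : ∀ p ∈ G, ¬ IsAbove G H w p := fun p hp => by
    rw [isAbove_iff hsG hp fun _ _ => rfl]; exact lt_irrefl _
  induction R using Finset.induction_on with
  | empty =>
    refine ⟨{p | p ∈ F ∧ ∃ g, g ∈ G ∧ (∀ a ∈ H, g a = p a) ∧ g w < p w}, ?_, ?_, ?_⟩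
    · exact hF.and (DefinableSet.exists_real ((hG.comp Sum.inr).and
        ((DefinableSet.forall_eq_coord H Sum.inr Sum.inl).and (DefinableSet.lt_coord hL _ _))))
    · rintro p ⟨hp, g, hg, hgp, hgw⟩
      have hab : IsAbove G H w p := ⟨g, hg, hgp, hgw⟩
      exact (h.mem_iff_isAbove hH hsG hw hsF hA hp (fun hpG => hnot p hpG hab) hg hgp).2 hab
    · rintro p hp ⟨g, hg, hgp⟩
      rw [Finset.sdiff_empty] at hgp
      exact ⟨(hAF hp).1,
        (h.mem_iff_isAbove hH hsG hw hsF hA (hAF hp).1 (hAF hp).2 hg hgp).1 hp⟩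
  | insert z R hzR ih =>
    obtain ⟨D, hD, hDA, hAD⟩ := ih
    have herase : H \ insert z R = (H \ R).erase z := by
      ext a; simp only [Finset.mem_sdiff, Finset.mem_insert, Finset.mem_erase]; tauto
    set S := H \ insert z R with hS
    have hzS : z ∉ S := by simp [hS]
    by_cases hzH : z ∈ H
    swap
    · refine ⟨D, hD, hDA, fun p hp hg => hAD p hp ?_⟩
      rwa [herase, Finset.erase_eq_of_notMem (by simp [hzH])] at hg
    have hins : H \ R = insert z S := by
      rw [herase, Finset.insert_erase (by simp [hzH, hzR])]
    have hSH : S ⊆ H := Finset.sdiff_subset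
    have hlink : ∀ E ⊆ A, ∀ T y, linkTo F G E T y ⊆ A := by
      rintro E hE T y p ⟨hp, q, hq, hpq, hno⟩
      exact (h.mem_of_mem_link hp (hAF (hE hq)).1 hpq hno).2 (hE hq)
    -- Two links reach `D`: first `z` moves to the end of its range on `G`, with the coordinates in
    -- `S` fixed; then `z` alone moves within the chart into this range.
    refine ⟨D ∪ linkTo F G (linkTo F G D ((insert w H).erase z) z) S z, ?_, ?_, ?_⟩
    · exact Set.Definable.union hD
        (definable_linkTo hL hF hG (definable_linkTo hL hF hG hD _ _) _ _)
    · exact union_subset hDA (hlink _ (hlink _ hDA _ _) _ _)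
    rintro p hp ⟨g₀, hg₀, hg₀p⟩
    have hpF := (hAF hp).1
    by_cases hT : ∃ g ∈ G, ∀ a ∈ H \ R, g a = p a
    · exact Or.inl (hAD p hp hT)
    right
    -- The range of `z` over the points of `G` with the same `S`-coordinates as `p`: an open
    -- interval that does not contain `p z`.
    set J : Set ℝ := (fun x : α → ℝ => x z) '' {g ∈ G | ∀ a ∈ S, g a = p a} with hJ
    have hslice : ∀ {m : ℕ} {E : Set (α → ℝ)}, IsCell m E →
        ((fun x : α → ℝ => x z) '' {g ∈ E | ∀ a ∈ S, g a = p a}).OrdConnected := by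
      intro m E hE
      have := hE.isPreconnected_slice S ∅ p (I := fun _ => univ) (by simp)
      simp only [Finset.notMem_empty, false_imp_iff, implies_true, and_true] at this
      exact (this.image _ (by fun_prop)).ordConnected
    have hJo : IsOpen J := by
      rw [Metric.isOpen_iff]
      rintro _ ⟨g, ⟨hg, hgp⟩, rfl⟩
      obtain ⟨δ, hδ, hl⟩ := hcG.lift g hg 1 one_pos
      refine ⟨δ, hδ, fun y hy => ?_⟩
      obtain ⟨g', hg', hgS, -⟩ := hl (Function.update g z y) (by
        intro a _
        by_cases haz : a = z
        · subst haz; simpa [Real.dist_eq] using hy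
        · simpa [haz] using hδ)
      refine ⟨g', ⟨hg', fun a ha => ?_⟩, by simpa using hgS z hzH⟩
      rw [hgS a (hSH ha), Function.update_of_ne (ne_of_mem_of_not_mem ha hzS), hgp a ha]
    have hpJ : p z ∉ J := by
      rintro ⟨g, ⟨hg, hgp⟩, hgz⟩
      refine hT ⟨g, hg, fun a ha => ?_⟩
      rw [hins] at ha
      rcases Finset.mem_insert.1 ha with rfl | ha
      · exact hgz
      · exact hgp a ha
    obtain ⟨b, hb, hbc, hbJ, hbno⟩ :=
      exists_mem_closure_of_notMem hJo (hslice h.cell_wall) ⟨g₀, ⟨hg₀, hg₀p⟩, rfl⟩ hpJ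
    obtain ⟨q, ⟨hq, hqp⟩, hqb⟩ := (hslice h.cell).uIcc_subset ⟨p, ⟨hpF, fun _ _ => rfl⟩, rfl⟩
      ⟨g₀, ⟨h.subset hg₀, hg₀p⟩, rfl⟩ hb
    simp only at hqb
    have hqG : q ∉ G := fun hqG => hbJ ⟨q, ⟨hqG, hqp⟩, hqb⟩
    have hlink₁ : ¬ ∃ g, g ∈ G ∧ (∀ a ∈ S, g a = p a) ∧ g z ∈ uIcc (p z) (q z) := by
      rintro ⟨g, hg, hgp, hgz⟩
      exact hbno (g z) (hqb ▸ hgz) ⟨g, ⟨hg, hgp⟩, rfl⟩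
    -- The point `q` over the end of `J` is off the closure of `G`, so a short move in direction `z`
    -- cannot cross the wall.
    obtain ⟨ε, hε, hεG⟩ := Metric.isOpen_iff.1 isClosed_closure.isOpen_compl q
      fun hqc => hqG (h.closed ⟨hqc, hq⟩)
    obtain ⟨δ, hδ, hl⟩ := hcF.lift q hq ε hε
    obtain ⟨_, ⟨g', ⟨hg', hgp'⟩, rfl⟩, hyb⟩ := Metric.mem_closure_iff.1 hbc δ hδ
    simp only at hyb
    rw [dist_comm, Real.dist_eq] at hyb
    obtain ⟨q', hq', hqS', -⟩ := hl (Function.update q z (g' z)) (by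
      intro a _
      by_cases haz : a = z
      · subst haz; rw [hqb]; simpa using hyb
      · simpa [haz] using hδ)
    have hqz' : q' z = g' z := by simpa using hqS' z (by simp [hzH])
    have hqq : ∀ a ∈ (insert w H).erase z, q a = q' a := fun a ha => by
      obtain ⟨haz, ha⟩ := Finset.mem_erase.1 ha
      rw [hqS' a ha, Function.update_of_ne haz]
    have hlink₂ : ¬ ∃ g, g ∈ G ∧ (∀ a ∈ (insert w H).erase z, g a = q a) ∧
        g z ∈ uIcc (q z) (q' z) := by
      rintro ⟨g, hg, hgq, hgz⟩
      obtain ⟨r, hr, hrg, hrq⟩ := hl g fun a ha => by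
        by_cases haz : a = z
        · rw [haz]
          refine (abs_sub_left_of_mem_uIcc hgz).trans_lt ?_
          rw [hqz', hqb]; exact hyb
        · rw [hgq a (Finset.mem_erase.2 ⟨haz, ha⟩)]; simpa using hδ
      rw [hsF r hr g (h.subset hg) hrg] at hrq
      exact hεG hrq (subset_closure hg)
    have hqA : q ∈ A := (h.mem_of_mem_link hpF hq (fun a ha => (hqp a ha).symm) hlink₁).1 hp
    have hqA' : q' ∈ A := (h.mem_of_mem_link hq hq' hqq hlink₂).1 hqA
    refine ⟨hpF, q, ⟨hq, q', hAD q' hqA' ⟨g', hg', fun a ha => ?_⟩, hqq, hlink₂⟩,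
      fun a ha => (hqp a ha).symm, hlink₁⟩
    rw [hins] at ha
    rcases Finset.mem_insert.1 ha with rfl | ha
    · exact hqz'.symm
    · have haz : a ≠ z := ne_of_mem_of_not_mem ha hzS
      rw [← hqq a (Finset.mem_erase.2 ⟨haz, Finset.mem_insert_of_mem (hSH ha)⟩), hqp a ha, hgp' a ha]

theorem IsCut.definable_left (hL : IsOMinimalOverReals L) {n : ℕ}
    {F G A B : Set (α → ℝ)} (h : IsCut n F G A B) (hF : DefinableSet L F) (hG : DefinableSet L G)
    {H : Finset α} (hH : H.card = n) (hsG : Separates H G) {w : α} (hw : w ∉ H)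
    (hsF : Separates (insert w H) F)
    (hA : ∀ p ∈ G, ∀ᶠ q in 𝓝[F] p, q ∉ G → (q ∈ A ↔ IsAbove G H w q)) : DefinableSet L A := by
  obtain ⟨D, hD, hDA, hAD⟩ := h.exists_definable_between hL hF hG hH hsG hw hsF hA H
  obtain ⟨g, hg⟩ := h.cell_wall.nonempty
  rwa [subset_antisymm (fun p hp => hAD p hp ⟨g, hg, by simp⟩) hDA]

theorem IsCut.definable_right {n : ℕ} {F G A B : Set (α → ℝ)} (h : IsCut n F G A B)
    (hF : DefinableSet L F) (hG : DefinableSet L G) (hA : DefinableSet L A) : DefinableSet L B := by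
  have : B = (F \ G) \ A := by
    rw [← h.union_eq, union_sdiff_left]
    exact (h.disjoint.symm.sdiff_eq_left).symm
  rw [this]
  exact Set.Definable.sdiff (Set.Definable.sdiff hF hG) hA

end Definability

/-! ### Monotone maps as cells -/

section MonotoneMaps

variable {L : FirstOrder.Language.{u, v}} [L.Structure ℝ] {n k : ℕ}

theorem IsMonotoneMap.isAdmissibleMap {X : Set (Fin n → ℝ)} {f : (Fin n → ℝ) → (Fin k → ℝ)}
    (h : IsMonotoneMap L n X f) : IsAdmissibleMap L X f := by
  match n, X, f, h with
  | 0, _, _, h => exact h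
  | 1, _, _, h => exact h.1
  | _ + 2, _, _, h => exact h.1

/-- The coordinates of a level slice, as coordinates of the ambient space: the slot of `y_i` is
taken by `x_j`. -/
def sliceIndex (i : Fin k) (j : Fin (n + 1)) : Fin n ⊕ Fin k → Fin (n + 1) ⊕ Fin k :=
  Sum.elim (fun l => Sum.inl (j.succAbove l)) (Function.update Sum.inr i (Sum.inl j))

theorem sliceIndex_inl (i : Fin k) (j : Fin (n + 1)) (l : Fin n) :
    sliceIndex i j (Sum.inl l) = Sum.inl (j.succAbove l) := rfl

theorem sliceIndex_inr_self (i : Fin k) (j : Fin (n + 1)) :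
    sliceIndex i j (Sum.inr i) = Sum.inl j := by
  rw [sliceIndex, Sum.elim_inr, Function.update_self]

theorem sliceIndex_inr_of_ne {i l : Fin k} (j : Fin (n + 1)) (h : l ≠ i) :
    sliceIndex i j (Sum.inr l) = Sum.inr l := by
  rw [sliceIndex, Sum.elim_inr, Function.update_of_ne h]

theorem levelSlice_eq (F : Set (Fin (n + 1) ⊕ Fin k → ℝ)) (i : Fin k) (j : Fin (n + 1)) (b : ℝ) :
    levelSlice F i j b = (fun z => z ∘ sliceIndex i j) '' {z ∈ F | z (Sum.inr i) = b} := by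
  unfold levelSlice
  congr 1
  funext z a
  rcases a with l | l
  · rfl
  · by_cases hl : l = i
    · subst hl
      rw [Function.comp_apply, sliceIndex_inr_self, Sum.elim_inr, Function.update_self]
    · rw [Function.comp_apply, sliceIndex_inr_of_ne j hl, Sum.elim_inr, Function.update_of_ne hl]

theorem sliceIndex_injective (i : Fin k) (j : Fin (n + 1)) : Function.Injective (sliceIndex i j) := by
  rintro (a | a) (b | b) hab
  · simpa [sliceIndex] using hab
  · by_cases hb : b = i
    · subst hb; simp [sliceIndex, Fin.succAbove_ne] at hab
    · simp [sliceIndex, hb] at hab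
  · by_cases ha : a = i
    · subst ha; simp [sliceIndex, (Fin.succAbove_ne _ _).symm] at hab
    · simp [sliceIndex, ha] at hab
  · by_cases ha : a = i <;> by_cases hb : b = i
    · rw [ha, hb]
    · subst ha; simp [sliceIndex, hb] at hab
    · subst hb; simp [sliceIndex, ha] at hab
    · simpa [sliceIndex, ha, hb] using hab

theorem sliceIndex_ne (i : Fin k) (j : Fin (n + 1)) (a : Fin n ⊕ Fin k) :
    sliceIndex i j a ≠ Sum.inr i := by
  rcases a with a | a
  · simp [sliceIndex]
  · by_cases ha : a = i
    · subst ha; simp [sliceIndex]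
    · simp [sliceIndex, ha]

theorem exists_sliceIndex_eq {i : Fin k} {j : Fin (n + 1)} {s : Fin (n + 1) ⊕ Fin k}
    (hs : s ≠ Sum.inr i) : ∃ a, sliceIndex i j a = s := by
  rcases s with s | s
  · by_cases hsj : s = j
    · exact ⟨Sum.inr i, by simp [sliceIndex, hsj]⟩
    · obtain ⟨l, rfl⟩ := Fin.exists_succAbove_eq hsj
      exact ⟨Sum.inl l, rfl⟩
  · exact ⟨Sum.inr s, by simp [sliceIndex, show s ≠ i from fun h => hs (by rw [h])]⟩

section Embedding

variable {α : Type} [Fintype α] [DecidableEq α]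

/-- A copy of the graph of `f` in `ℝ^α`, with constant coordinates added. -/
def embeddedGraph (e : Fin n ⊕ Fin k → α) (v₀ : α → ℝ) (X : Set (Fin n → ℝ))
    (f : (Fin n → ℝ) → (Fin k → ℝ)) : Set (α → ℝ) :=
  (fun z => Function.extend e z v₀) '' mapGraph X f

theorem mem_embeddedGraph {e : Fin n ⊕ Fin k → α} {v₀ : α → ℝ} {X : Set (Fin n → ℝ)}
    {f : (Fin n → ℝ) → (Fin k → ℝ)} {p : α → ℝ} : p ∈ embeddedGraph e v₀ X f ↔
      ∃ x ∈ X, Function.extend e (Sum.elim x (f x)) v₀ = p := by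
  simp [embeddedGraph, mapGraph]

theorem IsAdmissibleMap.isCellBase {X : Set (Fin n → ℝ)} {f : (Fin n → ℝ) → (Fin k → ℝ)}
    (h : IsAdmissibleMap L X f) {e : Fin n ⊕ Fin k → α} (he : Function.Injective e) (v₀ : α → ℝ) :
    IsCellBase n (embeddedGraph e v₀ X f) (Finset.univ.image (e ∘ Sum.inl)) where
  card := by
    rw [Finset.card_image_of_injective _ (he.comp Sum.inl_injective), Finset.card_univ,
      Fintype.card_fin]
  nonempty := (h.nonempty.image _).image _
  chart := by
    constructor
    · intro p hp q hq hpq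
      obtain ⟨x, -, rfl⟩ := mem_embeddedGraph.1 hp
      obtain ⟨y, -, rfl⟩ := mem_embeddedGraph.1 hq
      have : x = y := funext fun l => by
        simpa [he.extend_apply] using hpq (e (Sum.inl l)) (by simp)
      rw [this]
    · intro p hp ε hε
      obtain ⟨x, hx, rfl⟩ := mem_embeddedGraph.1 hp
      obtain ⟨η₁, hη₁, hX⟩ := Metric.isOpen_iff.1 h.domain.isOpen x hx
      obtain ⟨η₂, hη₂, hf⟩ := Metric.continuousOn_iff.1 h.continuousOn x hx ε hε
      have hδ : 0 < min (min η₁ η₂) ε := lt_min (lt_min hη₁ hη₂) hε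
      refine ⟨_, hδ, fun k hk => ?_⟩
      have hd : dist (fun l => k (e (Sum.inl l))) x < min (min η₁ η₂) ε := by
        rw [dist_pi_lt_iff hδ]
        intro l
        simpa [he.extend_apply, Real.dist_eq] using hk (e (Sum.inl l)) (by simp)
      have hx' := hX (hd.trans_le ((min_le_left _ _).trans (min_le_left _ _)))
      refine ⟨_, mem_embeddedGraph.2 ⟨_, hx', rfl⟩, fun a ha => ?_, ?_⟩
      · obtain ⟨l, -, rfl⟩ := Finset.mem_image.1 ha
        simp [he.extend_apply]
      · rw [dist_pi_lt_iff hε]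
        intro a
        by_cases ha : ∃ s, e s = a
        · obtain ⟨s, rfl⟩ := ha
          rw [he.extend_apply, he.extend_apply]
          rcases s with l | l
          · exact (dist_le_pi_dist (fun l => k (e (Sum.inl l))) x l).trans_lt
              (hd.trans_le (min_le_right _ _))
          · exact (dist_le_pi_dist _ _ l).trans_lt
              (hf _ hx' (hd.trans_le ((min_le_left _ _).trans (min_le_right _ _))))
        · rw [Function.extend_apply' _ _ _ ha, Function.extend_apply' _ _ _ ha, dist_self]
          exact hε
  preconnected := by
    intro T hT c
    have hcone : IsCoordinateCone {x : Fin n → ℝ | ∀ l ∈ Finset.univ.filter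
        (fun l => e (Sum.inl l) ∈ T), Ordering.eq.Compares (x l) (c (e (Sum.inl l)))} :=
      ⟨_, fun _ => Ordering.eq, fun l => c (e (Sum.inl l)), rfl⟩
    have hcont : ContinuousOn (fun x => Function.extend e (Sum.elim x (f x)) v₀) X := by
      rw [continuousOn_pi]
      intro a
      by_cases ha : ∃ s, e s = a
      · obtain ⟨s, rfl⟩ := ha
        simp only [he.extend_apply]
        rcases s with l | l
        · exact (continuous_apply l).continuousOn
        · exact (continuous_apply l).comp_continuousOn h.continuousOn
      · simp only [Function.extend_apply' _ _ _ ha]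
        exact continuousOn_const
    convert (h.domain.connected _ hcone).image _ (hcont.mono inter_subset_left) using 1
    ext p
    constructor
    · rintro ⟨hp, hpT⟩
      obtain ⟨x, hx, rfl⟩ := mem_embeddedGraph.1 hp
      refine ⟨x, ⟨hx, fun l hl => ?_⟩, rfl⟩
      simpa [he.extend_apply] using hpT _ (Finset.mem_filter.1 hl).2
    · rintro ⟨x, ⟨hx, hxT⟩, rfl⟩
      refine ⟨mem_embeddedGraph.2 ⟨x, hx, rfl⟩, fun a ha => ?_⟩
      obtain ⟨l, -, rfl⟩ := Finset.mem_image.1 (hT ha)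
      simpa [he.extend_apply] using hxT l (by simpa using ha)

theorem separates_embeddedGraph_iff {e : Fin n ⊕ Fin k → α} (he : Function.Injective e)
    {v₀ : α → ℝ} {X : Set (Fin n → ℝ)} {f : (Fin n → ℝ) → (Fin k → ℝ)} {H : Finset α}
    {H₀ : Finset (Fin n ⊕ Fin k)} (hH : ∀ t, e t ∈ H ↔ t ∈ H₀) :
    Separates H (embeddedGraph e v₀ X f) ↔
      InjOn (fun x (t : H₀) => Sum.elim x (f x) t.1) X := by
  constructor
  · intro h x hx y hy hxy
    have := h _ (mem_embeddedGraph.2 ⟨x, hx, rfl⟩) _ (mem_embeddedGraph.2 ⟨y, hy, rfl⟩) fun a ha => by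
      by_cases hr : ∃ t, e t = a
      · obtain ⟨t, rfl⟩ := hr
        rw [he.extend_apply, he.extend_apply]
        exact congrFun hxy ⟨t, (hH t).1 ha⟩
      · rw [Function.extend_apply' _ _ _ hr, Function.extend_apply' _ _ _ hr]
    funext l
    simpa [he.extend_apply] using congrFun this (e (Sum.inl l))
  · intro h p hp q hq hpq
    obtain ⟨x, hx, rfl⟩ := mem_embeddedGraph.1 hp
    obtain ⟨y, hy, rfl⟩ := mem_embeddedGraph.1 hq
    have : x = y := h hx hy <| funext fun t => by
      simpa [he.extend_apply] using hpq _ ((hH t.1).2 t.2)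
    rw [this]

/-- A level slice lives in a smaller, reindexed space. Recording the level `b` as a constant
coordinate puts it back, so that all iterated slices lie in the same `ℝ^α`. -/
theorem coordSlice_embeddedGraph {e : Fin (n + 1) ⊕ Fin k → α} (he : Function.Injective e)
    {v₀ : α → ℝ} {X : Set (Fin (n + 1) → ℝ)} {f : (Fin (n + 1) → ℝ) → (Fin k → ℝ)} {i : Fin k}
    {j : Fin (n + 1)} {b : ℝ} {Y : Set (Fin n → ℝ)} {h : (Fin n → ℝ) → (Fin k → ℝ)}
    (hY : mapGraph Y h = levelSlice (mapGraph X f) i j b) :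
    coordSlice (embeddedGraph e v₀ X f) (e (Sum.inr i)) b =
      embeddedGraph (e ∘ sliceIndex i j) (Function.update v₀ (e (Sum.inr i)) b) Y h := by
  have hinj := he.comp (sliceIndex_injective i j)
  have key : ∀ z : Fin (n + 1) ⊕ Fin k → ℝ, z (Sum.inr i) = b →
      Function.extend (e ∘ sliceIndex i j) (z ∘ sliceIndex i j)
        (Function.update v₀ (e (Sum.inr i)) b) = Function.extend e z v₀ := by
    intro z hz
    funext a
    by_cases ha : ∃ s, e s = a
    · obtain ⟨s, rfl⟩ := ha
      rw [he.extend_apply]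
      by_cases hs : s = Sum.inr i
      · subst hs
        rw [Function.extend_apply', Function.update_self, hz]
        rintro ⟨t, ht⟩
        exact sliceIndex_ne i j t (he ht)
      · obtain ⟨t, rfl⟩ := exists_sliceIndex_eq (j := j) hs
        exact hinj.extend_apply (z ∘ sliceIndex i j) _ t
    · rw [Function.extend_apply' _ _ _ ha, Function.extend_apply' _ _ _ fun ⟨t, ht⟩ => ha ⟨_, ht⟩,
        Function.update_of_ne fun h => ha ⟨_, h.symm⟩]
  unfold embeddedGraph
  rw [hY, levelSlice_eq]
  ext p
  constructor
  · rintro ⟨⟨z, hz, rfl⟩, hb⟩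
    simp only [he.extend_apply] at hb
    exact ⟨_, ⟨z, ⟨hz, hb⟩, rfl⟩, key z hb⟩
  · rintro ⟨_, ⟨z, ⟨hz, hb⟩, rfl⟩, rfl⟩
    simp only [key z hb]
    exact ⟨⟨z, hz, rfl⟩, by rw [he.extend_apply, hb]⟩

theorem isCellBase_zero {E : Set (α → ℝ)} (hne : E.Nonempty) (hs : E.Subsingleton) :
    IsCellBase 0 E ∅ where
  card := rfl
  nonempty := hne
  chart := ⟨fun x hx y hy _ => hs hx hy, fun p hp ε hε =>
    ⟨1, one_pos, fun _ _ => ⟨p, hp, by simp, by simpa using hε⟩⟩⟩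
  preconnected _ _ _ := (hs.anti fun _ h => h.1).isPreconnected

/-- Induction on the dimension. The common system of basis sets yields level independence; constant
coordinates added by the embedding do not help to separate points. -/
theorem IsMonotoneMap.isCellOver {X : Set (Fin n → ℝ)} {f : (Fin n → ℝ) → (Fin k → ℝ)}
    (h : IsMonotoneMap L n X f) {e : Fin n ⊕ Fin k → α} (he : Function.Injective e) (v₀ : α → ℝ) :
    IsCellOver n (embeddedGraph e v₀ X f) (Finset.univ.image (e ∘ Sum.inl)) := by
  have hvar : ∀ {n : ℕ} {X : Set (Fin n → ℝ)} {f : (Fin n → ℝ) → (Fin k → ℝ)}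
      {e : Fin n ⊕ Fin k → α} (_ : Function.Injective e) {v₀ : α → ℝ},
      ∀ i ∉ Finset.univ.image (e ∘ Sum.inl), ∀ j ∈ Finset.univ.image (e ∘ Sum.inl),
      VariesWith (embeddedGraph e v₀ X f) (Finset.univ.image (e ∘ Sum.inl)) i j →
      ∃ i' j', e (Sum.inr i') = i ∧ e (Sum.inl j') = j ∧ ¬ IndependentOf X (fun x => f x i') j' := by
    intro n X f e he v₀ i hi j hj hij
    obtain ⟨j', -, rfl⟩ := Finset.mem_image.1 hj
    obtain ⟨p, hp, q, hq, hpq, hne⟩ := hij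
    obtain ⟨x, hx, rfl⟩ := mem_embeddedGraph.1 hp
    obtain ⟨y, hy, rfl⟩ := mem_embeddedGraph.1 hq
    by_cases hr : ∃ s, e s = i
    swap
    · rw [Function.extend_apply' _ _ _ hr, Function.extend_apply' _ _ _ hr] at hne
      exact absurd rfl hne
    obtain ⟨i' | i', rfl⟩ := hr
    · exact absurd (Finset.mem_image.2 ⟨i', Finset.mem_univ _, rfl⟩) hi
    refine ⟨i', j', rfl, rfl, fun hind => hne ?_⟩
    rw [he.extend_apply, he.extend_apply]
    refine hind x hx y hy fun l hl => ?_
    have := hpq (e (Sum.inl l)) (by simp) fun h => hl (Sum.inl_injective (he h))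
    simpa [he.extend_apply] using this
  induction n generalizing v₀ with
  | zero => exact h.isAdmissibleMap.isCellBase he v₀
  | succ n ih =>
    refine ⟨h.isAdmissibleMap.isCellBase he v₀, fun i hi j hj hij => ?_⟩
    obtain ⟨i, j, rfl, rfl, hind⟩ := hvar he i hi j hj hij
    cases n with
    | zero =>
      have : Subsingleton (Fin (0 + 1)) := inferInstanceAs (Subsingleton (Fin 1))
      -- In dimension one a component that is not independent of `x_j` is strictly monotone, so its
      -- level sets have at most one point.
      have hsub : ∀ b, (coordSlice (embeddedGraph e v₀ X f) (e (Sum.inr i)) b).Subsingleton := by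
        rintro b p ⟨hp, hpb⟩ q ⟨hq, hqb⟩
        obtain ⟨x, hx, rfl⟩ := mem_embeddedGraph.1 hp
        obtain ⟨y, hy, rfl⟩ := mem_embeddedGraph.1 hq
        rw [he.extend_apply] at hpb hqb
        have hxy : f x i = f y i := hpb.trans hqb.symm
        have hl : ∀ l, l ≠ j → x l = y l := fun l hl => absurd (Subsingleton.elim l j) hl
        have hl' : ∀ l, l ≠ j → y l = x l := fun l hl => absurd (Subsingleton.elim l j) hl
        have : x j = y j := by
          rcases (h.2 i).trichotomy j with h | h | h
          · rcases lt_trichotomy (x j) (y j) with hlt | heq | hlt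
            · exact absurd hxy (h x hx y hy hl hlt).ne
            · exact heq
            · exact absurd hxy (h y hy x hx hl' hlt).ne'
          · rcases lt_trichotomy (x j) (y j) with hlt | heq | hlt
            · exact absurd hxy (h x hx y hy hl hlt).ne'
            · exact heq
            · exact absurd hxy (h y hy x hx hl' hlt).ne
          · exact absurd h hind
        have hxy' : x = y := funext fun l => by rw [Subsingleton.elim l j, this]
        rw [hxy']
      refine ⟨fun b hb => ?_, fun b b' _ H _ _ x hx y hy _ => hsub b' hx hy⟩
      have : (Finset.univ.image (e ∘ Sum.inl)).erase (e (Sum.inl j)) = ∅ := by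
        ext a
        simp only [Finset.mem_erase, Finset.mem_image, Finset.mem_univ, true_and,
          Finset.notMem_empty, iff_false, not_and]
        rintro ha ⟨l, rfl⟩
        exact ha (by rw [Subsingleton.elim l j]; rfl)
      rw [this]
      exact isCellBase_zero hb (hsub b)
    | succ n =>
      obtain ⟨m, hm⟩ := h.2 i j hind
      have hne : ∀ b, (coordSlice (embeddedGraph e v₀ X f) (e (Sum.inr i)) b).Nonempty →
          (levelSlice (mapGraph X f) i j b).Nonempty := by
        rintro b ⟨_, ⟨z, hz, rfl⟩, hzb⟩
        simp only [he.extend_apply] at hzb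
        rw [levelSlice_eq]
        exact ⟨_, z, ⟨hz, hzb⟩, rfl⟩
      have hinj := he.comp (sliceIndex_injective i j)
      constructor
      · intro b hb
        obtain ⟨Y, g, hY, hYg, -⟩ := hm b (hne b hb)
        rw [coordSlice_embeddedGraph he hY]
        convert ih hYg hinj _ using 1
        ext a
        simp only [Finset.mem_erase, Finset.mem_image, Finset.mem_univ, true_and,
          Function.comp_apply]
        constructor
        · rintro ⟨ha, l, rfl⟩
          have hl : l ≠ j := fun h => ha (by rw [h])
          obtain ⟨l', rfl⟩ := Fin.exists_succAbove_eq hl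
          exact ⟨l', rfl⟩
        · rintro ⟨l, rfl⟩
          exact ⟨fun h => Fin.succAbove_ne j l (Sum.inl_injective (he h)), _, rfl⟩
      · intro b b' hb H hH hs
        rcases eq_empty_or_nonempty (coordSlice (embeddedGraph e v₀ X f) (e (Sum.inr i)) b')
          with hb' | hb'
        · rw [hb']; exact fun x hx => absurd hx (notMem_empty x)
        obtain ⟨Y, g, hY, hYg, hYm⟩ := hm b (hne b hb)
        obtain ⟨Y', g', hY', hYg', hYm'⟩ := hm b' (hne b' hb')
        rw [coordSlice_embeddedGraph he hY] at hs
        rw [coordSlice_embeddedGraph he hY']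
        set e' := e ∘ sliceIndex i j
        -- The part of `H` consisting of non-added coordinates. It still separates, so `le_card`
        -- forces its cardinality to be exactly the dimension of the slice, as basis sets require.
        set H₀ := Finset.univ.filter fun t => e' t ∈ H with hH₀
        have hmem : ∀ t, e' t ∈ H ↔ t ∈ H₀ := by simp [hH₀]
        have hmem' : ∀ t, e' t ∈ H₀.image e' ↔ t ∈ H₀ := fun t => hinj.mem_finset_image
        have hi := (separates_embeddedGraph_iff hinj hmem).1 hs
        have hle := (ih hYg hinj 0).le_card ((separates_embeddedGraph_iff hinj hmem').2 hi)
        rw [Finset.card_image_of_injective _ hinj] at hle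
        have hle' : H₀.card ≤ H.card := by
          rw [← Finset.card_image_of_injective H₀ hinj]
          refine Finset.card_le_card fun a ha => ?_
          obtain ⟨t, ht, rfl⟩ := Finset.mem_image.1 ha
          exact (hmem t).2 ht
        have : H₀ ∈ basisSets Y g := ⟨by omega, hi⟩
        rw [hYm, ← hYm'] at this
        exact (separates_embeddedGraph_iff hinj hmem).2 this.2

theorem IsMonotoneMap.isCell_mapGraph {X : Set (Fin n → ℝ)} {f : (Fin n → ℝ) → (Fin k → ℝ)}
    (h : IsMonotoneMap L n X f) : IsCell n (mapGraph X f) := by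
  have := h.isCellOver Function.injective_id 0
  rw [embeddedGraph] at this
  simp only [Function.extend_id, image_id'] at this
  exact ⟨_, this⟩

end Embedding

/-! ### Restricting monotone maps to pieces of the graph -/

section Restriction

/-- Open intervals and points: the conditions on one coordinate in the definition of a cone, and
their intersections. -/
def IsConeInterval (I : Set ℝ) : Prop := (IsOpen I ∧ I.OrdConnected) ∨ ∃ c, I = {c}

/-- The intersections of `Z` with coordinate cones are connected. -/
def IsConeConnected {γ : Type*} (Z : Set (γ → ℝ)) : Prop :=
  ∀ I : γ → Set ℝ, (∀ a, IsConeInterval (I a)) → IsPreconnected {z ∈ Z | ∀ a, z a ∈ I a}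

theorem IsConeInterval.univ : IsConeInterval univ := Or.inl ⟨isOpen_univ, ordConnected_univ⟩

theorem IsConeInterval.inter {I J : Set ℝ} (hI : IsConeInterval I) (hJ : IsConeInterval J) :
    IsConeInterval (I ∩ J) := by
  have key : ∀ (c : ℝ) (K : Set ℝ), IsConeInterval ({c} ∩ K) := fun c K => by
    by_cases hc : c ∈ K
    · exact Or.inr ⟨c, inter_eq_left.2 (singleton_subset_iff.2 hc)⟩
    · rw [singleton_inter_eq_empty.2 hc]
      exact Or.inl ⟨isOpen_empty, ordConnected_empty⟩
  rcases hI with hI | ⟨c, rfl⟩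
  · rcases hJ with hJ | ⟨c, rfl⟩
    · exact Or.inl ⟨hI.1.inter hJ.1, hI.2.inter hJ.2⟩
    · rw [inter_comm]; exact key c I
  · exact key c J

theorem IsConeConnected.coord_mem {γ : Type*} [DecidableEq γ] {Z : Set (γ → ℝ)}
    (h : IsConeConnected Z) (a : γ) {J : Set ℝ} (hJ : IsConeInterval J) :
    IsConeConnected {z ∈ Z | z a ∈ J} := by
  intro I hI
  convert h (Function.update I a (I a ∩ J)) (fun b => ?_) using 1
  · ext z
    simp only [mem_ofPred_eq, and_assoc]
    refine and_congr_right fun _ => ⟨fun ⟨h1, h2⟩ b => ?_, fun h => ⟨?_, fun b => ?_⟩⟩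
    · by_cases hb : b = a
      · subst hb; simpa using ⟨h2 b, h1⟩
      · simpa [hb] using h2 b
    · have := h a; simp only [Function.update_self] at this; exact this.2
    · have := h b
      by_cases hb : b = a
      · subst hb; simp only [Function.update_self] at this; exact this.1
      · simpa [hb] using this
  · by_cases hb : b = a
    · subst hb; simpa using (hI b).inter hJ
    · simpa [hb] using hI b

/-- Forgetting coordinates amounts to imposing no condition on them. -/
theorem IsConeConnected.image_comp {γ γ' : Type*} {Z : Set (γ → ℝ)} (h : IsConeConnected Z)
    {ι : γ' → γ} (hι : Function.Injective ι) : IsConeConnected ((fun z => z ∘ ι) '' Z) := by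
  intro I hI
  convert (h (Function.extend ι I fun _ => univ) (fun a => ?_)).image (fun z => z ∘ ι)
    (by fun_prop) using 1
  · ext y
    constructor
    · rintro ⟨⟨z, hz, rfl⟩, hzI⟩
      refine ⟨z, ⟨hz, fun a => ?_⟩, rfl⟩
      by_cases ha : ∃ b, ι b = a
      · obtain ⟨b, rfl⟩ := ha
        rw [hι.extend_apply]; exact hzI b
      · rw [Function.extend_apply' _ _ _ ha]; trivial
    · rintro ⟨z, ⟨hz, hzI⟩, rfl⟩
      refine ⟨⟨z, hz, rfl⟩, fun b => ?_⟩
      have := hzI (ι b)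
      rwa [hι.extend_apply] at this
  · by_cases ha : ∃ b, ι b = a
    · obtain ⟨b, rfl⟩ := ha
      rw [hι.extend_apply]; exact hI b
    · rw [Function.extend_apply' _ _ _ ha]; exact IsConeInterval.univ

theorem IsConeConnected.isPreconnected_inter {Z : Set (Fin n → ℝ)} (h : IsConeConnected Z)
    {C : Set (Fin n → ℝ)} (hC : IsCoordinateCone C) : IsPreconnected (Z ∩ C) := by
  obtain ⟨J, σ, c, rfl⟩ := hC
  convert h (fun j => if j ∈ J then {t | (σ j).Compares t (c j)} else univ) (fun j => ?_) using 1
  · ext z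
    refine and_congr_right fun _ => forall_congr' fun j => ?_
    by_cases hj : j ∈ J <;> simp [hj]
  · split_ifs
    · rcases σ j with _ | _ | _
      · exact Or.inl ⟨isOpen_Iio (a := c j), ordConnected_Iio⟩
      · exact Or.inr ⟨c j, rfl⟩
      · exact Or.inl ⟨isOpen_Ioi (a := c j), ordConnected_Ioi⟩
    · exact IsConeInterval.univ

theorem image_inl_mapGraph (X : Set (Fin n → ℝ)) (f : (Fin n → ℝ) → (Fin k → ℝ)) :
    (fun z => z ∘ Sum.inl) '' mapGraph X f = X := by
  simp [mapGraph, image_image]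

theorem IsSubmonotone.restrict {X X₁ : Set (Fin n → ℝ)} {φ : (Fin n → ℝ) → ℝ}
    (h : IsSubmonotone L X φ) (hX : X₁ ⊆ X) (hne : X₁.Nonempty) (h₁ : IsSemiMonotone L X₁)
    (hc : ∀ b, IsConeConnected {x ∈ X₁ | φ x < b}) : IsSubmonotone L X₁ φ where
  nonempty := hne
  domain := h₁
  definable := by
    have := h.definable.and (h₁.definable.comp (Sum.inl : Fin n → Fin n ⊕ Fin 1))
    convert this using 1
    ext z
    constructor
    · rintro ⟨x, hx, rfl⟩
      exact ⟨⟨x, hX hx, rfl⟩, hx⟩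
    · rintro ⟨⟨x, -, rfl⟩, hx⟩
      exact ⟨x, hx, rfl⟩
  bounded := h.bounded.subset (image_mono hX)
  upperSemicontinuous := h.upperSemicontinuous.mono hX
  sublevel b := by
    have he : {x ∈ X₁ | φ x < b} = X₁ ∩ {x ∈ X | φ x < b} := by
      ext x; exact ⟨fun hx => ⟨hx.1, hX hx.1, hx.2⟩, fun hx => ⟨hx.1, hx.2.2⟩⟩
    refine ⟨?_, ?_, h₁.isBounded.subset fun x hx => hx.1, fun C hC => (hc b).isPreconnected_inter hC⟩
    · rw [he]; exact h₁.definable.and (h.sublevel b).definable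
    · rw [he]; exact h₁.isOpen.inter (h.sublevel b).isOpen

/-- Because of this, the basis sets of restricted slices are still independent of the level. -/
theorem IsMonotoneMap.basisSets_eq {X X₁ : Set (Fin n → ℝ)} {f : (Fin n → ℝ) → (Fin k → ℝ)}
    (h : IsMonotoneMap L n X f) (hX : X₁ ⊆ X) (hne : X₁.Nonempty) (ho : IsOpen X₁) :
    basisSets X₁ f = basisSets X f := by
  refine subset_antisymm (fun H hH => ⟨hH.1, ?_⟩) fun H hH => ⟨hH.1, hH.2.mono hX⟩
  have hiff : ∀ X' : Set (Fin n → ℝ), Separates H (mapGraph X' f) ↔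
      InjOn (fun x (t : H) => Sum.elim x (f x) t.1) X' := by
    intro X'
    have := separates_embeddedGraph_iff (X := X') (f := f) (v₀ := 0) (H := H) (H₀ := H)
      Function.injective_id fun t => Iff.rfl
    rw [embeddedGraph] at this
    simpa only [Function.extend_id, image_id'] using this
  rw [← hiff]
  refine h.isCell_mapGraph.separates_of_isRelOpen (image_mono hX) (hne.image _) ?_ hH.1.le
    ((hiff X₁).2 hH.2)
  rintro _ ⟨x, hx, rfl⟩
  obtain ⟨ε, hε, hεX⟩ := Metric.isOpen_iff.1 ho x hx
  refine ⟨ε, hε, ?_⟩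
  rintro _ ⟨y, hy, rfl⟩ hyx
  refine ⟨y, hεX ?_, rfl⟩
  rw [Metric.mem_ball, dist_pi_lt_iff hε]
  exact fun l => (dist_le_pi_dist (Sum.elim y (f y)) (Sum.elim x (f x)) (Sum.inl l)).trans_lt hyx

theorem IsAdmissibleMap.restrict {X X₁ : Set (Fin n → ℝ)} {f : (Fin n → ℝ) → (Fin k → ℝ)}
    (h : IsAdmissibleMap L X f) (hX : X₁ ⊆ X) (hne : X₁.Nonempty) (ho : IsOpen X₁)
    (hd : DefinableSet L (mapGraph X₁ f)) (hc : IsConeConnected (mapGraph X₁ f)) :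
    IsAdmissibleMap L X₁ f where
  nonempty := hne
  domain := by
    have hc' := hc.image_comp (ι := (Sum.inl : Fin n → Fin n ⊕ Fin k)) Sum.inl_injective
    have hd' : DefinableSet L _ := Set.Definable.image_comp hd (Sum.inl : Fin n → Fin n ⊕ Fin k)
    rw [image_inl_mapGraph] at hc' hd'
    exact ⟨hd', ho, h.domain.isBounded.subset hX, fun C hC => hc'.isPreconnected_inter hC⟩
  definable := hd
  continuousOn := h.continuousOn.mono hX
  bounded := h.bounded.subset (image_mono hX)

theorem isOpen_level_domain {X₁ : Set (Fin (n + 1) → ℝ)}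
    {Y : Set (Fin n → ℝ)} {g : (Fin n → ℝ) → (Fin k → ℝ)} (i : Fin k) (j : Fin (n + 1))
    (hY : IsOpen Y) (hg : ContinuousOn g Y) (ho : IsOpen X₁) :
    IsOpen (Y ∩ {y | j.insertNth (g y i) y ∈ X₁}) := by
  refine ContinuousOn.isOpen_inter_preimage (f := fun y => j.insertNth (g y i) y) ?_ hY ho
  rw [continuousOn_pi]
  intro l
  by_cases hl : l = j
  · subst hl
    simp only [Fin.insertNth_apply_same]
    exact (continuous_apply i).comp_continuousOn hg
  · obtain ⟨l, rfl⟩ := Fin.exists_succAbove_eq hl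
    simp only [Fin.insertNth_apply_succAbove]
    exact (continuous_apply l).continuousOn

/-- The missing coordinate `x_j` of a point of the slice is the `i`-th component of `g`, so
inserting it at place `j` recovers the point of the original domain. -/
theorem mapGraph_level {X X₁ : Set (Fin (n + 1) → ℝ)} {f : (Fin (n + 1) → ℝ) → (Fin k → ℝ)}
    {Y : Set (Fin n → ℝ)} {g : (Fin n → ℝ) → (Fin k → ℝ)} {i : Fin k} {j : Fin (n + 1)} {b : ℝ}
    (hX : X₁ ⊆ X) (hY : mapGraph Y g = levelSlice (mapGraph X f) i j b) :
    mapGraph (Y ∩ {y | j.insertNth (g y i) y ∈ X₁}) g = levelSlice (mapGraph X₁ f) i j b := by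
  have hins : ∀ (y : Fin n → ℝ) (x : Fin (n + 1) → ℝ),
      Sum.elim x (f x) ∘ sliceIndex i j = Sum.elim y (g y) → j.insertNth (g y i) y = x := by
    intro y x h
    funext l
    by_cases hl : l = j
    · subst hl
      have := congrFun h (Sum.inr i)
      rw [Function.comp_apply, sliceIndex_inr_self] at this
      rw [Fin.insertNth_apply_same]
      exact this.symm
    · obtain ⟨l, rfl⟩ := Fin.exists_succAbove_eq hl
      have := congrFun h (Sum.inl l)
      rw [Function.comp_apply, sliceIndex_inl] at this
      rw [Fin.insertNth_apply_succAbove]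
      exact this.symm
  rw [levelSlice_eq] at hY ⊢
  ext z
  constructor
  · rintro ⟨y, ⟨hy, hyX⟩, rfl⟩
    have : Sum.elim y (g y) ∈ mapGraph Y g := ⟨y, hy, rfl⟩
    rw [hY] at this
    obtain ⟨_, ⟨⟨x, hx, rfl⟩, hb⟩, h⟩ := this
    refine ⟨_, ⟨⟨x, ?_, rfl⟩, hb⟩, h⟩
    rw [← hins y x h]; exact hyX
  · rintro ⟨_, ⟨⟨x, hx, rfl⟩, hb⟩, rfl⟩
    have : Sum.elim x (f x) ∘ sliceIndex i j ∈ mapGraph Y g := by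
      rw [hY]; exact ⟨_, ⟨⟨x, hX hx, rfl⟩, hb⟩, rfl⟩
    obtain ⟨y, hy, h⟩ := this
    refine ⟨y, ⟨hy, ?_⟩, h⟩
    rw [mem_ofPred_eq, hins y x h.symm]; exact hx

/-- A monotone map is monotone on every open definable subset of its domain over which the graph
has connected intersections with the coordinate cones. -/
theorem IsMonotoneMap.restrict {X X₁ : Set (Fin n → ℝ)} {f : (Fin n → ℝ) → (Fin k → ℝ)}
    (h : IsMonotoneMap L n X f) (hX : X₁ ⊆ X) (hne : X₁.Nonempty) (ho : IsOpen X₁)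
    (hd : DefinableSet L (mapGraph X₁ f)) (hc : IsConeConnected (mapGraph X₁ f)) :
    IsMonotoneMap L n X₁ f := by
  have hadm := h.isAdmissibleMap.restrict hX hne ho hd hc
  induction n with
  | zero => exact hadm
  | succ n ih =>
    cases n with
    | zero =>
      refine ⟨hadm, fun i => ⟨?_, ?_, fun j => ?_⟩⟩
      · refine (h.2 i).submonotone.restrict hX hne hadm.domain fun b => ?_
        convert (hc.coord_mem (Sum.inr i) (J := Iio b)
          (Or.inl ⟨isOpen_Iio, ordConnected_Iio⟩)).image_comp Sum.inl_injective using 1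
        ext x
        constructor
        · rintro ⟨hx, hxb⟩
          exact ⟨_, ⟨⟨x, hx, rfl⟩, hxb⟩, rfl⟩
        · rintro ⟨_, ⟨⟨x, hx, rfl⟩, hxb⟩, rfl⟩
          exact ⟨hx, hxb⟩
      · refine (h.2 i).supermonotone.restrict hX hne hadm.domain fun b => ?_
        convert (hc.coord_mem (Sum.inr i) (J := Ioi (-b))
          (Or.inl ⟨isOpen_Ioi, ordConnected_Ioi⟩)).image_comp Sum.inl_injective using 1
        ext x
        constructor
        · rintro ⟨hx, hxb⟩
          exact ⟨_, ⟨⟨x, hx, rfl⟩, neg_lt.1 hxb⟩, rfl⟩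
        · rintro ⟨_, ⟨⟨x, hx, rfl⟩, hxb⟩, rfl⟩
          exact ⟨hx, neg_lt.1 hxb⟩
      · rcases (h.2 i).trichotomy j with h | h | h
        · exact Or.inl fun x hx y hy => h x (hX hx) y (hX hy)
        · exact Or.inr (Or.inl fun x hx y hy => h x (hX hx) y (hX hy))
        · exact Or.inr (Or.inr fun x hx y hy => h x (hX hx) y (hX hy))
    | succ n =>
      refine ⟨hadm, fun i j hij => ?_⟩
      obtain ⟨m, hm⟩ := h.2 i j fun hind => hij fun x hx y hy => hind x (hX hx) y (hX hy)
      refine ⟨m, fun b hb => ?_⟩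
      have hsub : levelSlice (mapGraph X₁ f) i j b ⊆ levelSlice (mapGraph X f) i j b :=
        image_mono fun z hz => ⟨image_mono hX hz.1, hz.2⟩
      obtain ⟨Y, g, hY, hYg, hYm⟩ := hm b (hb.mono hsub)
      have hYadm := hYg.isAdmissibleMap
      have hgraph := mapGraph_level hX hY
      have hYo := isOpen_level_domain i j hYadm.domain.isOpen hYadm.continuousOn ho
      have hYne : (Y ∩ {y | j.insertNth (g y i) y ∈ X₁}).Nonempty := by
        rw [← hgraph] at hb; exact hb.of_image
      have hYd : DefinableSet L (levelSlice (mapGraph X₁ f) i j b) := by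
        rw [levelSlice_eq]
        exact Set.Definable.image_comp (hd.and (DefinableSet.eq_const _ b)) _
      have hYc : IsConeConnected (levelSlice (mapGraph X₁ f) i j b) := by
        rw [levelSlice_eq]
        exact (hc.coord_mem (Sum.inr i) (Or.inr ⟨b, rfl⟩)).image_comp (sliceIndex_injective i j)
      rw [← hgraph] at hYd hYc
      refine ⟨_, g, hgraph, ih hYg inter_subset_left hYne hYo hYd hYc ?_, ?_⟩
      · exact hYadm.restrict inter_subset_left hYne hYo hYd hYc
      · rw [hYg.basisSets_eq inter_subset_left hYne hYo, hYm]

theorem IsMonotoneMap.exists_of_isRelOpen {X : Set (Fin n → ℝ)} {f : (Fin n → ℝ) → (Fin k → ℝ)}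
    (h : IsMonotoneMap L n X f) {A : Set (Fin n ⊕ Fin k → ℝ)} (hA : A ⊆ mapGraph X f)
    (hne : A.Nonempty) (ho : IsRelOpen A (mapGraph X f)) (hd : DefinableSet L A)
    (hc : IsConeConnected A) : ∃ X₁, IsMonotoneMap L n X₁ f ∧ mapGraph X₁ f = A := by
  have hadm := h.isAdmissibleMap
  have hgraph : mapGraph {x ∈ X | Sum.elim x (f x) ∈ A} f = A := by
    ext z
    constructor
    · rintro ⟨x, hx, rfl⟩; exact hx.2
    · intro hz
      obtain ⟨x, hx, rfl⟩ := hA hz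
      exact ⟨x, ⟨hx, hz⟩, rfl⟩
  refine ⟨{x ∈ X | Sum.elim x (f x) ∈ A}, h.restrict (fun x hx => hx.1) ?_ ?_ ?_ ?_, hgraph⟩
  · rw [← hgraph] at hne; exact hne.of_image
  · rw [isOpen_iff_mem_nhds]
    rintro x ⟨hx, hxA⟩
    have hcont : ContinuousOn (fun x => Sum.elim x (f x)) X := by
      rw [continuousOn_pi]
      rintro (l | l)
      · exact (continuous_apply l).continuousOn
      · exact (continuous_apply l).comp_continuousOn hadm.continuousOn
    have h1 : ∀ᶠ y in 𝓝[X] x, Sum.elim y (f y) ∈ A :=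
      ((hcont x hx).tendsto_nhdsWithin (mapsTo_image _ X)).eventually (ho.eventually hxA)
    rw [hadm.domain.isOpen.nhdsWithin_eq hx] at h1
    filter_upwards [h1, hadm.domain.isOpen.mem_nhds hx] with y hy hyX
    exact ⟨hyX, hy⟩
  · rwa [hgraph]
  · rwa [hgraph]

end Restriction

theorem IsCut.isConeConnected {α : Type*} [Fintype α] [DecidableEq α] {m : ℕ}
    {F G A B : Set (α → ℝ)} (h : IsCut m F G A B) : IsConeConnected A := by
  classical
  intro I hI
  have hc : ∃ c : α → ℝ, ∀ a, ¬ (IsOpen (I a) ∧ (I a).OrdConnected) → I a = {c a} := by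
    have : ∀ a, ∃ c, ¬ (IsOpen (I a) ∧ (I a).OrdConnected) → I a = {c} := fun a => by
      rcases hI a with h | ⟨c, hc⟩
      · exact ⟨0, fun h' => absurd h h'⟩
      · exact ⟨c, fun _ => hc⟩
    choose c hc using this
    exact ⟨c, hc⟩
  obtain ⟨c, hc⟩ := hc
  convert h.isPreconnected_cone (Finset.univ.filter fun a => ¬ (IsOpen (I a) ∧ (I a).OrdConnected))
    (Finset.univ.filter fun a => IsOpen (I a) ∧ (I a).OrdConnected) c
    (fun a ha => (Finset.mem_filter.1 ha).2) using 1
  ext x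
  refine and_congr_right fun _ => ⟨fun hx => ⟨fun a ha => ?_, fun a _ => hx a⟩, fun hx a => ?_⟩
  · have := hx a
    rwa [hc a (Finset.mem_filter.1 ha).2] at this
  · by_cases ha : IsOpen (I a) ∧ (I a).OrdConnected
    · exact hx.2 a (by simpa using ha)
    · rw [hc a ha]; exact hx.1 a (Finset.mem_filter.2 ⟨Finset.mem_univ _, ha⟩)

theorem IsMonotoneGraph.isCell {α : Type} [Fintype α] [DecidableEq α] {d m : ℕ} {E : Set (α → ℝ)}
    (h : IsMonotoneGraph L d m E) : IsCell d E := by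
  obtain ⟨e, Y, g, hg, rfl⟩ := h
  have := hg.isCellOver e.injective 0
  refine ⟨Finset.univ.image (e ∘ Sum.inl), ?_⟩
  convert this using 1
  ext z
  rw [embeddedGraph]
  constructor
  · intro hz
    refine ⟨_, hz, ?_⟩
    funext a
    obtain ⟨s, rfl⟩ := e.surjective a
    exact e.injective.extend_apply _ _ s
  · rintro ⟨y, hy, rfl⟩
    rw [mem_ofPred_eq]
    rwa [Function.extend_comp e.injective]

theorem IsMonotoneGraph.definable {α : Type} {d m : ℕ} {E : Set (α → ℝ)}
    (h : IsMonotoneGraph L d m E) : DefinableSet L E := by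
  obtain ⟨e, Y, g, hg, rfl⟩ := h
  exact hg.isAdmissibleMap.definable.comp e

end MonotoneMaps

end MonotoneGraphs

theorem theorem4p7 (L : FirstOrder.Language.{u, v}) [L.Structure ℝ] (hL : IsOMinimalOverReals L)
    (n k : ℕ) (X : Set (Fin (n + 1) → ℝ)) (f : (Fin (n + 1) → ℝ) → (Fin k → ℝ))
    (hf : IsMonotoneMap L (n + 1) X f)
    (G : Set (Fin (n + 1) ⊕ Fin k → ℝ)) (hGF : G ⊆ mapGraph X f)
    (hG : IsMonotoneGraph L n (k + 1) G)
    (hbd : relBoundary G ⊆ relBoundary (mapGraph X f)) :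
    ∃ (X₁ X₂ : Set (Fin (n + 1) → ℝ)) (f₁ f₂ : (Fin (n + 1) → ℝ) → (Fin k → ℝ)),
      IsMonotoneMap L (n + 1) X₁ f₁ ∧ IsMonotoneMap L (n + 1) X₂ f₂ ∧
      Disjoint (mapGraph X₁ f₁) (mapGraph X₂ f₂) ∧
      mapGraph X f \ G = mapGraph X₁ f₁ ∪ mapGraph X₂ f₂ := by
  have hFc := hf.isCell_mapGraph
  have hGc := hG.isCell
  -- The boundary condition enters only here, as closedness of `G` in `F`.
  have hcl : closure G ∩ mapGraph X f ⊆ G := fun z hz => by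
    by_contra hzG
    exact (hbd ⟨hz.1, hzG⟩).2 hz.2
  obtain ⟨H, hH⟩ := id hGc
  have hcard := hH.base.card
  have hsG := hH.base.chart.separates
  obtain ⟨w, hw, hsF⟩ := hGc.exists_separates_insert hFc hGF hcard hsG
  obtain ⟨A, B, hcut, hA⟩ := exists_isCut hFc hGc hGF hcl hcard hsG hw hsF
  have hFd := hf.isAdmissibleMap.definable
  have hAd := hcut.definable_left hL hFd hG.definable hcard hsG hw hsF hA
  have hBd := hcut.definable_right hFd hG.definable hAd
  have hAne : A.Nonempty := closure_nonempty_iff.1 (hGc.nonempty.mono hcut.subset_closure_left)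
  have hBne : B.Nonempty := closure_nonempty_iff.1 (hGc.nonempty.mono hcut.subset_closure_right)
  obtain ⟨X₁, h₁, he₁⟩ := hf.exists_of_isRelOpen (fun x hx => (hcut.subset_left hx).1) hAne
    hcut.isRelOpen_left hAd hcut.isConeConnected
  obtain ⟨X₂, h₂, he₂⟩ := hf.exists_of_isRelOpen (fun x hx => (hcut.symm.subset_left hx).1) hBne
    hcut.isRelOpen_right hBd hcut.symm.isConeConnected
  refine ⟨X₁, X₂, f, f, h₁, h₂, ?_, ?_⟩
  · rw [he₁, he₂]; exact hcut.disjoint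
  · rw [he₁, he₂, hcut.union_eq]
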